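/- Let $K$ be a field of characteristic $0$, let $q\in K^*$ be not a root of unity, and let $n\ge 2$. Let $R=\mathcal O_q(M_n)$ be the $K$-algebra generated by $Y_{i,\alpha}$, $1\le i,\alpha\le n$, subject to the relations $$Y_{i,\beta}Y_{i,\alpha}=q^{-1}Y_{i,\alpha}Y_{i,\beta}\ (\alpha<\beta),\qquad Y_{j,\alpha}Y_{i,\alpha}=q^{-1}Y_{i,\alpha}Y_{j,\alpha}\ (i<j),$$ $$Y_{j,\beta}Y_{i,\alpha}=Y_{i,\alpha}Y_{j,\beta}\ (i<j,\ \alpha>\beta),\qquad Y_{j,\beta}Y_{i,\alpha}=Y_{i,\alpha}Y_{j,\beta}-(q-q^{-1})Y_{i,\beta}Y_{j,\alpha}\ (i<j,\ \alpha<\beta).$$ Let $\det_q=\sum_{\sigma\in S_n}(-q)^{l(\sigma)}Y_{1,\sigma(1)}\cdots Y_{n,\sigma(n)}$, where $l(\sigma)$ is the number of inversions of $\sigma$. Let $\mathrm{Der}(R)$ be the set of $K$-linear derivations of $R$, a module over the centre $Z(R)$ via $(zD)(a)=zD(a)$; for $x\in R$ let $\mathrm{ad}_x(a)=xa-ax$;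 let $\mathrm{InnDer}(R)=\{\mathrm{ad}_x\mid x\in R\}$ and $\mathrm{HH}^1(R)=\mathrm{Der}(R)/\mathrm{InnDer}(R)$, a $Z(R)$-module. Let $D_{i,*}$ and $D_{*,\alpha}$ be the derivations of $R$ with $D_{i,*}(Y_{j,\beta})=\delta_{ij}Y_{j,\beta}$ and $D_{*,\alpha}(Y_{j,\beta})=\delta_{\alpha\beta}Y_{j,\beta}$, and put $$D_j=D_{*,n+1-j}\ (1\le j\le n-1),\qquad D_n=D_{1,*}+D_{*,1}-\sum_{i=1}^nD_{i,*},\qquad D_j=D_{j-n+1,*}\ (n+1\le j\le 2n-1).$$ Then: 0. $Z(R)=K[\det_q]$, a polynomial ring in $\det_q$ (that is, $Z(R)$ is generated as a $K$-algebra by $\det_q$, and $\det_q$ is transcendental over $K$). 1. Every derivation $D$ of $R$ can be written uniquely as $D=\mathrm{ad}_x+\mu_1D_1+\dots+\mu_{2n-1}D_{2n-1}$ with $\mathrm{ad}_x\in\mathrm{InnDer}(R)$ and $\mu_1,\dots,\mu_{2n-1}\in Z(R)$ (the derivation $\mathrm{ad}_x$ and the $\mu_j$ are unique; $x$ itself is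 unique only up to adding a central element). 2. $\mathrm{HH}^1(R)$ is a free $Z(R)$-module of rank $2n-1$, with basis the classes $\overline{D_1},\dots,\overline{D_{2n-1}}$. -/

import Mathlib

noncomputable section

namespace QMatrix

section HochschildOne

variable (K A : Type*) [CommRing K] [Ring A] [Algebra K A]

/-- The `K`-linear derivations of a (noncommutative) `K`-algebra `A`, as a submodule of
`End_K(A)` over the centre `Z(A)`, which acts by `(z • D) a = z * D a`. -/
def derSubmodule : Submodule (Subalgebra.center K A) (A →ₗ[K] A) where
  carrier := {D | ∀ a b : A, D (a * b) = D a * b + a * D b}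
  zero_mem' := by intro a b; simp
  add_mem' := by
    intro D E hD hE a b
    simp only [LinearMap.add_apply, hD a b, hE a b, add_mul, mul_add]
    abel
  smul_mem' := by
    intro z D hD a b
    have hz : (z : A) * a = a * z := (Subalgebra.mem_center_iff.1 z.2 a).symm
    simp only [LinearMap.smul_apply, hD a b, Subalgebra.smul_def, smul_eq_mul, mul_add,
      ← mul_assoc, hz]

/-- The `Z(A)`-module `Der(A)` of `K`-linear derivations of `A`. -/
def Der : Type _ := derSubmodule K A

instance : AddCommGroup (Der K A) := Submodule.addCommGroup (derSubmodule K A)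

instance : Module (Subalgebra.center K A) (Der K A) := Submodule.module (derSubmodule K A)

variable {K A}

/-- The linear map underlying a derivation. -/
def Der.toLin (D : Der K A) : A →ₗ[K] A := D.1

instance : CoeFun (Der K A) fun _ => A → A := ⟨fun D => D.toLin⟩

theorem Der.ext {D E : Der K A} (h : ∀ a, D a = E a) : D = E :=
  Subtype.ext (LinearMap.ext h)

theorem Der.leibniz (D : Der K A) (a b : A) : D (a * b) = D a * b + a * D b := D.2 a b

theorem Der.zero_apply (a : A) : (0 : Der K A) a = 0 := rfl

theorem Der.add_apply (D E : Der K A) (a : A) : (D + E) a = D a + E a := rfl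

theorem Der.sub_apply (D E : Der K A) (a : A) : (D - E) a = D a - E a := rfl

theorem Der.smul_apply (z : Subalgebra.center K A) (D : Der K A) (a : A) :
    (z • D) a = (z : A) * D a := rfl

variable (K)

/-- The inner derivation `ad_x : a ↦ x * a - a * x`. -/
def ad (x : A) : Der K A :=
  ⟨LinearMap.mulLeft K x - LinearMap.mulRight K x, by
    intro a b
    simp only [LinearMap.sub_apply, LinearMap.mulLeft_apply, LinearMap.mulRight_apply]
    noncomm_ring⟩

theorem ad_apply (x a : A) : ad K x a = x * a - a * x := rfl

variable (A)

/-- The `Z(A)`-module of inner derivations `{ad_x | x ∈ A}`. -/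
def InnDer : Submodule (Subalgebra.center K A) (Der K A) where
  carrier := Set.range (ad K)
  zero_mem' := ⟨0, Der.ext fun a => by simp [ad_apply, Der.zero_apply]⟩
  add_mem' := by
    rintro _ _ ⟨x, rfl⟩ ⟨y, rfl⟩
    refine ⟨x + y, Der.ext fun a => ?_⟩
    simp only [Der.add_apply, ad_apply]
    noncomm_ring
  smul_mem' := by
    rintro z _ ⟨x, rfl⟩
    refine ⟨z * x, Der.ext fun a => ?_⟩
    have hz : (z : A) * a = a * z := (Subalgebra.mem_center_iff.1 z.2 a).symm
    simp only [Der.smul_apply, ad_apply, mul_sub, ← mul_assoc, hz]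

/-- The first Hochschild cohomology group `HH¹(A) = Der(A) / InnDer(A)`, a `Z(A)`-module. -/
abbrev HH1 : Type _ := Der K A ⧸ InnDer K A

end HochschildOne

variable {K : Type*} [Field K] (q : K) (n : ℕ)

/-- The defining relations of `O_q(M_n)` among the free generators `Y (i, α)`. -/
inductive Rel : FreeAlgebra K (Fin n × Fin n) → FreeAlgebra K (Fin n × Fin n) → Prop
  | row (i α β : Fin n) (h : α < β) :
      Rel (FreeAlgebra.ι K (i, β) * FreeAlgebra.ι K (i, α))
        (q⁻¹ • (FreeAlgebra.ι K (i, α) * FreeAlgebra.ι K (i, β)))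
  | col (i j α : Fin n) (h : i < j) :
      Rel (FreeAlgebra.ι K (j, α) * FreeAlgebra.ι K (i, α))
        (q⁻¹ • (FreeAlgebra.ι K (i, α) * FreeAlgebra.ι K (j, α)))
  | anti (i j α β : Fin n) (h : i < j) (h' : β < α) :
      Rel (FreeAlgebra.ι K (j, β) * FreeAlgebra.ι K (i, α))
        (FreeAlgebra.ι K (i, α) * FreeAlgebra.ι K (j, β))
  | diag (i j α β : Fin n) (h : i < j) (h' : α < β) :
      Rel (FreeAlgebra.ι K (j, β) * FreeAlgebra.ι K (i, α))
        (FreeAlgebra.ι K (i, α) * FreeAlgebra.ι K (j, β)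
          - (q - q⁻¹) • (FreeAlgebra.ι K (i, β) * FreeAlgebra.ι K (j, α)))

/-- The algebra `O_q(M_n)` of `n × n` quantum matrices over `K`. -/
def QMat : Type _ := RingQuot (Rel q n)

instance : Ring (QMat q n) := inferInstanceAs (Ring (RingQuot (Rel q n)))

instance : Algebra K (QMat q n) := inferInstanceAs (Algebra K (RingQuot (Rel q n)))

/-- The canonical generators of `O_q(M_n)`; row and column indices start at `0`. -/
def Y (i α : Fin n) : QMat q n := RingQuot.mkAlgHom K (Rel q n) (FreeAlgebra.ι K (i, α))

/-- The number of inversions of a permutation, i.e. its usual length. -/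
def len (σ : Equiv.Perm (Fin n)) : ℕ :=
  (Finset.univ.filter fun p : Fin n × Fin n => p.1 < p.2 ∧ σ p.2 < σ p.1).card

/-- The quantum determinant `∑_σ (-q)^{l(σ)} Y_{1,σ(1)} ⋯ Y_{n,σ(n)}`. -/
def detq : QMat q n :=
  ∑ σ : Equiv.Perm (Fin n), (-q) ^ len n σ • (List.ofFn fun i => Y q n i (σ i)).prod

theorem row_rel (i α β : Fin n) (h : α < β) :
    Y q n i β * Y q n i α = q⁻¹ • (Y q n i α * Y q n i β) := by
  have h₀ := RingQuot.mkAlgHom_rel K (Rel.row (q := q) i α β h)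
  simp only [map_mul, map_smul] at h₀
  exact h₀

theorem col_rel (i j α : Fin n) (h : i < j) :
    Y q n j α * Y q n i α = q⁻¹ • (Y q n i α * Y q n j α) := by
  have h₀ := RingQuot.mkAlgHom_rel K (Rel.col (q := q) i j α h)
  simp only [map_mul, map_smul] at h₀
  exact h₀

theorem anti_rel (i j α β : Fin n) (h : i < j) (h' : β < α) :
    Y q n j β * Y q n i α = Y q n i α * Y q n j β := by
  have h₀ := RingQuot.mkAlgHom_rel K (Rel.anti (q := q) i j α β h h')
  simp only [map_mul] at h₀
  exact h₀

theorem diag_rel (i j α β : Fin n) (h : i < j) (h' : α < β) :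
    Y q n j β * Y q n i α =
      Y q n i α * Y q n j β - (q - q⁻¹) • (Y q n i β * Y q n j α) := by
  have h₀ := RingQuot.mkAlgHom_rel K (Rel.diag (q := q) i j α β h h')
  simp only [map_mul, map_smul, map_sub] at h₀
  exact h₀

/-- The algebra map `a ↦ a + ε D(a)` into the dual numbers over `O_q(M_n)`, where
`D(Y_{i,α}) = (r i + c α) Y_{i,α}`. -/
def scalingHom (r c : Fin n → K) : QMat q n →ₐ[K] DualNumber (QMat q n) :=
  RingQuot.liftAlgHom K ⟨FreeAlgebra.lift K fun p : Fin n × Fin n =>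
      (TrivSqZeroExt.inl (Y q n p.1 p.2) +
        TrivSqZeroExt.inr ((r p.1 + c p.2) • Y q n p.1 p.2) : DualNumber (QMat q n)), by
    intro x y hxy
    induction hxy with
    | row i α β h =>
      ext
      · simpa using row_rel q n i α β h
      · simp [row_rel q n i α β h, ← add_smul, smul_smul]
        congr 1; ring
    | col i j α h =>
      ext
      · simpa using col_rel q n i j α h
      · simp [col_rel q n i j α h, ← add_smul, smul_smul]
        congr 1; ring
    | anti i j α β h h' =>
      ext
      · simpa using anti_rel q n i j α β h h'
      · simp [anti_rel q n i j α β h h', ← add_smul]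
        congr 1; ring
    | diag i j α β h h' =>
      ext
      · simpa using diag_rel q n i j α β h h'
      · simp [diag_rel q n i j α β h h', smul_sub, smul_smul]
        module⟩

theorem scalingHom_Y (r c : Fin n → K) (i α : Fin n) :
    scalingHom q n r c (Y q n i α) =
      TrivSqZeroExt.inl (Y q n i α) + TrivSqZeroExt.inr ((r i + c α) • Y q n i α) := by
  exact (RingQuot.liftAlgHom_mkAlgHom_apply K _ _ _).trans (FreeAlgebra.lift_ι_apply _ _)

theorem fst_scalingHom (r c : Fin n → K) (a : QMat q n) : (scalingHom q n r c a).fst = a := by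
  have h : (TrivSqZeroExt.fstHom K (QMat q n) (QMat q n)).comp (scalingHom q n r c) =
      AlgHom.id K (QMat q n) := by
    apply RingQuot.ringQuot_ext'
    apply FreeAlgebra.hom_ext
    funext p
    have := congrArg TrivSqZeroExt.fst (scalingHom_Y q n r c p.1 p.2)
    simp only [TrivSqZeroExt.fst_add, TrivSqZeroExt.fst_inl, TrivSqZeroExt.fst_inr,
      add_zero] at this
    exact this
  exact DFunLike.congr_fun h a

/-- The derivation of `O_q(M_n)` with `Y_{i,α} ↦ (r i + c α) Y_{i,α}`; see `scalingDer_Y`. -/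
def scalingDer (r c : Fin n → K) : Der K (QMat q n) :=
  ⟨(TrivSqZeroExt.sndHom (QMat q n) (QMat q n)).restrictScalars K ∘ₗ
      (scalingHom q n r c).toLinearMap, by
    intro a b
    simp [fst_scalingHom, add_comm]⟩

theorem scalingDer_Y (r c : Fin n → K) (i α : Fin n) :
    scalingDer q n r c (Y q n i α) = (r i + c α) • Y q n i α := by
  change (scalingHom q n r c (Y q n i α)).snd = _
  simp [scalingHom_Y]

/-- The row derivation `D_{i,*}`, with `D_{i,*}(Y_{j,β}) = δ_{ij} Y_{j,β}`. -/
def rowDer (i : Fin n) : Der K (QMat q n) := scalingDer q n (Pi.single i 1) 0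

/-- The column derivation `D_{*,α}`, with `D_{*,α}(Y_{j,β}) = δ_{αβ} Y_{j,β}`. -/
def colDer (α : Fin n) : Der K (QMat q n) := scalingDer q n 0 (Pi.single α 1)

theorem rowDer_Y (i j β : Fin n) :
    rowDer q n i (Y q n j β) = if j = i then Y q n j β else 0 := by
  simp [rowDer, scalingDer_Y, Pi.single_apply]

theorem colDer_Y (α j β : Fin n) :
    colDer q n α (Y q n j β) = if β = α then Y q n j β else 0 := by
  simp [colDer, scalingDer_Y, Pi.single_apply]

/-- The derivations `D_1, …, D_{2n-1}`, where `D q n j` is `D_{j+1}` in numbering from `1`.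
With rows and columns also numbered from `1`, one has `D_k = D_{*,n+1-k}` for `1 ≤ k ≤ n-1`,
`D_n = D_{1,*} + D_{*,1} - ∑ i, D_{i,*}`, and `D_k = D_{k-n+1,*}` for `n+1 ≤ k ≤ 2n-1`. -/
def D (j : Fin (2 * n - 1)) : Der K (QMat q n) :=
  if (j : ℕ) + 1 < n then colDer q n ⟨n - 1 - j, by have := j.2; omega⟩
  else if (j : ℕ) + 1 = n then
    rowDer q n ⟨0, by have := j.2; omega⟩ + colDer q n ⟨0, by have := j.2; omega⟩
      - ∑ i, rowDer q n i
  else rowDer q n ⟨j + 1 - n, by have := j.2; omega⟩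

end QMatrix

end

noncomputable section

namespace QMatrix

/-! ### Quantum matrices in an arbitrary algebra -/

/-! The whole theorem is read off from leading terms. Any two generators satisfy Y_p Y_r = q^c Y_r
Y_p + (lower), with c = `comm p r` skew-symmetric. "Lower" means that the exponent matrix drops by
some e_{iα} + e_{jβ} - e_{iβ} - e_{jα} with i < j and α < β; such blocks generate the monoid `cone`.
Ordered monomials form a basis (`monoBasis`): straightening shows that they span, and a
representation built one row at a time shows that they are independent
(`exists_isQM_linearIndependent`). If w is a top exponent of x, the coefficients of Y_r x and x Y_r
at w + e_r differ by the factor q^(`eps r w`), and since q is not a root of unity this factor is 1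
only if `eps r w = 0`.

Centre. The quantum determinant is central by evaluating one double sum of cofactors in two ways
(`Y_mul_detq`), and its m-th power has leading exponent m times the identity matrix, with
coefficient 1. A top exponent of a central element is nonnegative and killed by every `eps p`, hence
is such a multiple (`eq_smul_diagExp`); subtracting multiples of powers of the determinant finishes
the induction.

Generation. For a derivation D, take v maximal such that some D(Y_p) has a monomial of exponent v +
e_p, and let `lead` be the normalized coefficients there. The relations give lead(p)(1 - q^eps(r)) =
lead(r)(1 - q^eps(p)) (`SuppIn.lead_mul`). If `eps` is not identically zero on v, the family `lead`
is that of an inner derivation by a multiple of one monomial. If `eps` vanishes and v ≥ 0, then v is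
m times the identity, and every unit cell forces lead(i,α) + lead(j,β) = lead(i,β) + lead(j,α)
(`SuppIn.lead_cell`); so lead(i,α) = r_i + c_α, which is the family of the m-th power of the
determinant times a scaling derivation. Off the diagonal the cell identity comes from one relation
and the combinatorics of `cone` (`SuppIn.lead_add_lead`). On the diagonal D is restricted to a two
by two block with entries a, b, c, d: there D(det) is a polynomial in det, and its coefficients at
a^(m+1) d^(m+1) and b^(m+1) c^(m+1) are compared (`coef2_der_diag`). The last case, an entry -1 in a
corner of v, is excluded by `SuppIn.lead_eq_zero_of_neg`. Subtracting the matching derivation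
removes v from a finite lower closed set, and induction applies.

Uniqueness. A multiple of the identity is maximal among nonnegative exponents, so an inner
derivation has no coefficient at m·1 + e_p (`coef_ad_eq_zero`). There ∑ μ_j D_j has, up to a power
of q, the weighted sum of the coefficients of the m-th power of the determinant in the μ_j, and the
weight functions are linearly independent (`eq_zero_of_sum_weight`). -/

/-- The entries `y i α` satisfy the defining relations of quantum matrices. -/
structure IsQM {K A I J : Type*} [Field K] [Ring A] [Algebra K A] [LinearOrder I] [LinearOrder J]
    (q : K) (y : I → J → A) : Prop where
  row : ∀ i {α β}, α < β → y i β * y i α = q⁻¹ • (y i α * y i β)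
  col : ∀ {i j} α, i < j → y j α * y i α = q⁻¹ • (y i α * y j α)
  anti : ∀ {i j α β}, i < j → β < α → y j β * y i α = y i α * y j β
  diag : ∀ {i j α β}, i < j → α < β →
    y j β * y i α = y i α * y j β - (q - q⁻¹) • (y i β * y j α)

section IsQM

variable {K A I J L : Type*} [Field K] [Ring A] [Algebra K A]
  [LinearOrder I] [LinearOrder J] [LinearOrder L] {q : K}

/-- The defining relations of quantum matrices in the uniform shape `R T₁ T₂ = T₂ T₁ R`. -/
theorem IsQM.uniform (hq : q ≠ 0) {y : I → J → A} (h : IsQM q y) (i j : I) (α β : J) :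
    (if i = j then q else 1) • (y i α * y j β) +
      (if j < i then q - q⁻¹ else 0) • (y j α * y i β) =
    (if α = β then q else 1) • (y j β * y i α) +
      (if α < β then q - q⁻¹ else 0) • (y j α * y i β) := by
  rcases lt_trichotomy i j with hij | rfl | hij <;> rcases lt_trichotomy α β with hab | rfl | hab
  · have h2 := h.anti hij hab
    simp [hij.ne, hab.ne, hij.not_gt, hab, h.diag hij hab, h2]
  · simp [hij.ne, hij.not_gt, h.col α hij, smul_smul, hq]
  · simp [hij.ne, hab.ne', hij.not_gt, hab.not_gt, h.anti hij hab]
  · simp only [if_true, lt_irrefl, if_false, zero_smul, add_zero, hab.ne, one_smul, hab,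
      h.row i hab]
    module
  · simp
  · simp [hab.ne', hab.not_gt, h.row i hab, smul_smul, hq]
  · simp [hij.ne', hab.ne, hij, hab, h.anti hij hab]
  · simp only [hij.ne', if_false, one_smul, hij, if_true, h.col α hij, lt_irrefl, zero_smul,
      add_zero]
    module
  · have h2 := h.anti hij hab
    simp [hij.ne', hab.ne', hij, hab.not_gt, h.diag hij hab, ← h2]

/-- Lets closure properties be checked on one identity instead of four families. The `diag` relation
needs two instances, one for each order of the columns. -/
theorem IsQM.of_uniform (hq : q ≠ 0) {y : I → J → A}
    (h : ∀ (i j : I) (α β : J), (if i = j then q else 1) • (y i α * y j β) +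
      (if j < i then q - q⁻¹ else 0) • (y j α * y i β) =
    (if α = β then q else 1) • (y j β * y i α) +
      (if α < β then q - q⁻¹ else 0) • (y j α * y i β)) : IsQM q y where
  row i α β hab := by
    have := h i i α β
    simp only [if_true, lt_irrefl, if_false, zero_smul, add_zero, hab.ne, one_smul, hab] at this
    rw [← sub_eq_iff_eq_add] at this
    rw [← this]
    module
  col {i j} α hij := by
    have := h i j α α
    simp only [hij.ne, if_false, one_smul, hij.not_gt, zero_smul, add_zero, if_true,
      lt_irrefl] at this
    rw [this, smul_smul, inv_mul_cancel₀ hq, one_smul]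
  anti {i j α β} hij hab := by
    have := h i j α β
    simpa [hij.ne, hab.ne', hij.not_gt, hab.not_gt] using this.symm
  diag {i j α β} hij hab := by
    have h1 := h i j α β
    have h2 := h i j β α
    simp only [hij.ne, if_false, one_smul, hij.not_gt, zero_smul, add_zero, hab.ne, hab.ne',
      hab.not_gt, hab, if_true] at h1 h2
    rw [h1, h2]
    module

theorem IsQM.map {B : Type*} [Ring B] [Algebra K B] {y : I → J → A} (h : IsQM q y)
    (φ : A →ₐ[K] B) : IsQM q fun i α => φ (y i α) where
  row _ _ _ hab := by rw [← map_mul, h.row _ hab, map_smul, map_mul]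
  col α hij := by rw [← map_mul, h.col α hij, map_smul, map_mul]
  anti hij hab := by rw [← map_mul, h.anti hij hab, map_mul]
  diag hij hab := by rw [← map_mul, h.diag hij hab, map_sub, map_smul, map_mul, map_mul]

theorem IsQM.comp {I' J' : Type*} [LinearOrder I'] [LinearOrder J'] {y : I → J → A}
    (h : IsQM q y) {f : I' → I} {g : J' → J} (hf : StrictMono f) (hg : StrictMono g) :
    IsQM q fun i α => y (f i) (g α) where
  row _ _ _ hab := h.row _ (hg hab)
  col _ hij := h.col _ (hf hij)
  anti hij hab := h.anti (hf hij) (hg hab)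
  diag hij hab := h.diag (hf hij) (hg hab)

/-- Quantum matrices are closed under transposition. -/
theorem IsQM.transpose {y : I → J → A} (h : IsQM q y) : IsQM q fun α i => y i α where
  row α _ _ hij := h.col α hij
  col i hab := h.row i hab
  anti hab hij := (h.anti hij hab).symm
  diag {α β i j} hab hij := by rw [h.diag hij hab, h.anti hij hab]

/-- The product of two quantum matrices whose entries commute with each other is a quantum
matrix. -/
theorem IsQM.mul [Fintype L] (hq : q ≠ 0) {x : I → L → A} {z : L → J → A} (hx : IsQM q x)
    (hz : IsQM q z) (hc : ∀ i k l α, x i k * z l α = z l α * x i k) :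
    IsQM q fun i α => ∑ k, x i k * z k α := by
  refine IsQM.of_uniform hq fun i j α β => ?_
  have key : ∀ (i j : I) (α β : J), (∑ k, x i k * z k α) * (∑ l, x j l * z l β) =
      ∑ k, ∑ l, x i k * x j l * (z k α * z l β) := by
    intro i j α β
    rw [Finset.sum_mul_sum]
    refine Finset.sum_congr rfl fun k _ => Finset.sum_congr rfl fun l _ => ?_
    rw [mul_assoc, ← mul_assoc (z k α), ← hc, mul_assoc, mul_assoc]
  have key' : ∀ (i j : I) (α β : J), (∑ k, x i k * z k α) * (∑ l, x j l * z l β) =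
      ∑ k, ∑ l, x i l * x j k * (z l α * z k β) := by
    intro i j α β
    rw [key, Finset.sum_comm]
  rw [key i j α β, key j i α β, key' j i β α]
  nth_rewrite 2 [← key j i α β]
  rw [key' j i α β]
  simp only [Finset.smul_sum, ← Finset.sum_add_distrib]
  -- The factors of `x` are exchanged on one side and those of `z` on the other. Both sides then
  -- have the same main term, and their correction terms match after interchanging the summation
  -- indices `k` and `l`.
  have h1 : ∀ k l, (if i = j then q else 1) • (x i k * x j l * (z k α * z l β)) +
      (if j < i then q - q⁻¹ else 0) • (x j k * x i l * (z k α * z l β)) =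
      (if k = l then q else 1) • (x j l * x i k * (z k α * z l β)) +
      (if k < l then q - q⁻¹ else 0) • (x j k * x i l * (z k α * z l β)) := by
    intro k l
    simpa only [add_mul, smul_mul_assoc] using
      congrArg (· * (z k α * z l β)) (hx.uniform hq i j k l)
  have h2 : ∀ k l, (if α = β then q else 1) • (x j l * x i k * (z l β * z k α)) +
      (if α < β then q - q⁻¹ else 0) • (x j l * x i k * (z l α * z k β)) =
      (if k = l then q else 1) • (x j l * x i k * (z k α * z l β)) +
      (if l < k then q - q⁻¹ else 0) • (x j l * x i k * (z l α * z k β)) := by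
    intro k l
    simpa only [mul_add, mul_smul_comm] using
      congrArg ((x j l * x i k) * ·) (hz.uniform hq k l α β).symm
  simp only [h1, h2, Finset.sum_add_distrib]
  congr 1
  exact Finset.sum_comm

end IsQM

theorem isQM_Y {K : Type*} [Field K] (q : K) (n : ℕ) : IsQM q (Y q n) where
  row i _ _ h := row_rel q n i _ _ h
  col α h := col_rel q n _ _ α h
  anti h h' := anti_rel q n _ _ _ _ h h'
  diag h h' := diag_rel q n _ _ _ _ h h'

/-! ### The universal property of the algebra of quantum matrices. -/

section Lift

variable {K : Type*} [Field K] {q : K} {n : ℕ} {A : Type*} [Ring A] [Algebra K A]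

/-- The universal property of `O_q(M_n)`. -/
def liftQM {y : Fin n → Fin n → A} (h : IsQM q y) : QMat q n →ₐ[K] A :=
  RingQuot.liftAlgHom K ⟨FreeAlgebra.lift K fun p : Fin n × Fin n => y p.1 p.2, by
    intro a b hab
    induction hab with
    | row i α β hl => simpa using h.row i hl
    | col i j α hl => simpa using h.col α hl
    | anti i j α β hl hl' => simpa using h.anti hl hl'
    | diag i j α β hl hl' => simpa using h.diag hl hl'⟩

theorem liftQM_Y {y : Fin n → Fin n → A} (h : IsQM q y) (i α : Fin n) :
    liftQM h (Y q n i α) = y i α :=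
  (RingQuot.liftAlgHom_mkAlgHom_apply K _ _ _).trans (FreeAlgebra.lift_ι_apply _ _)

theorem QMat.algHom_ext {φ ψ : QMat q n →ₐ[K] A} (h : ∀ i α, φ (Y q n i α) = ψ (Y q n i α)) :
    φ = ψ := by
  apply RingQuot.ringQuot_ext'
  apply FreeAlgebra.hom_ext
  funext p
  exact h p.1 p.2

end Lift

end QMatrix

end

noncomputable section

universe u

namespace QMatrix

/-! ### Linear independence of the ordered monomials -/

section Words

variable {m n : ℕ}

/-- The row-major ordered word in which the position `p` occurs `u p` times. -/
def word (u : Fin m × Fin n → ℕ) : List (Fin m × Fin n) :=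
  (List.finRange m).flatMap fun i => (List.finRange n).flatMap fun β =>
    List.replicate (u (i, β)) (i, β)

theorem word_succ (u : Fin (m + 1) × Fin n → ℕ) :
    word u = ((List.finRange n).flatMap fun β => List.replicate (u (0, β)) (0, β)) ++
      (word fun p : Fin m × Fin n => u (p.1.succ, p.2)).map fun p => (p.1.succ, p.2) := by
  simp [word, List.finRange_succ, List.flatMap_map, List.map_flatMap]

/-- The product of the entries `y i α` along a word. -/
def wordProd {A : Type*} [Monoid A] (y : Fin m → Fin n → A) (l : List (Fin m × Fin n)) : A :=
  (l.map fun p => y p.1 p.2).prod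

variable {A : Type*} [Monoid A] (y : Fin m → Fin n → A)

@[simp] theorem wordProd_nil : wordProd y [] = 1 := rfl

@[simp] theorem wordProd_cons (p : Fin m × Fin n) (l : List (Fin m × Fin n)) :
    wordProd y (p :: l) = y p.1 p.2 * wordProd y l := by simp [wordProd]

@[simp] theorem wordProd_append (l l' : List (Fin m × Fin n)) :
    wordProd y (l ++ l') = wordProd y l * wordProd y l' := by simp [wordProd]

end Words

/-! ### A representation that separates ordered monomials, built row by row. -/

section Representation

variable {K : Type*} [Field K] {V : Type*} [AddCommGroup V] [Module K V]

/-- The indicator function of the interval `(α, β]`. -/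
def seg (α β : ℕ) : ℕ → ℤ := fun s => if α < s ∧ s ≤ β then 1 else 0

/-- The weighted shift `e^t ⊗ v ↦ q^(φ t) e^(t + s) ⊗ v`. -/
def shiftOp (V : Type*) [AddCommGroup V] [Module K V] (q : K) (s : ℕ → ℤ) (φ : (ℕ → ℤ) → ℤ) :
    Module.End K ((ℕ → ℤ) →₀ V) :=
  Finsupp.lsum ℕ fun t => q ^ φ t • Finsupp.lsingle (t + s)

theorem shiftOp_single (q : K) (s : ℕ → ℤ) (φ : (ℕ → ℤ) → ℤ) (t : ℕ → ℤ) (v : V) :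
    shiftOp V q s φ (Finsupp.single t v) = q ^ φ t • Finsupp.single (t + s) v := by
  simp [shiftOp]

/-- The entries of an explicit upper triangular quantum matrix. -/
def triOp (V : Type*) [AddCommGroup V] [Module K V] (q : K) (α β : ℕ) :
    Module.End K ((ℕ → ℤ) →₀ V) :=
  if α ≤ β then shiftOp V q (seg α β) fun t => t (β + 1) - t α else 0

/-- The right factor acts first and moves `t` by `seg j β`; this changes the weight `t (α + 1) - t
i` of the left factor by the two indicators. -/
theorem triOp_mul {q : K} (hq : q ≠ 0) {i α j β : ℕ} (h : i ≤ α) (h' : j ≤ β) :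
    triOp V q i α * triOp V q j β =
      q ^ ((if j ≤ α ∧ α < β then 1 else 0) - (if j < i ∧ i ≤ β then 1 else 0) : ℤ) •
        shiftOp V q (seg i α + seg j β)
          fun t => (t (α + 1) - t i) + (t (β + 1) - t j) := by
  rw [triOp, triOp, if_pos h, if_pos h']
  refine Finsupp.lhom_ext fun t v => ?_
  simp only [Module.End.mul_apply, shiftOp_single, map_smul, LinearMap.smul_apply, smul_smul,
    ← zpow_add₀ hq]
  congr 2
  · simp only [Pi.add_apply, seg, Order.lt_add_one_iff, Order.add_one_le_iff]
    ring
  · rw [add_assoc, add_comm (seg j β)]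

theorem triOp_eq_zero (q : K) {α β : ℕ} (h : β < α) : triOp V q α β = 0 := by
  rw [triOp, if_neg (by omega)]

/-- Each relation compares weighted shifts, so only powers of q need checking. In the diagonal
relation with `j ≤ α` all three products are the same shift, because the intervals (i,α], (j,β] and
(i,β], (j,α] have the same sum of indicators, and the relation reads q⁻¹ = q - (q - q⁻¹). With `α <
j` the correction term vanishes by triangularity. -/
theorem isQM_triOp {q : K} (hq : q ≠ 0) : IsQM q (triOp V q) where
  row i α β h := by
    rcases le_or_gt i α with hi | hi
    · rw [triOp_mul hq hi (by omega), triOp_mul hq (by omega) hi, smul_smul, if_neg (by omega),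
        if_neg (by omega), if_pos (by omega), if_neg (by omega)]
      simp only [add_comm (seg i α)]
      simp only [sub_zero, zpow_one, inv_mul_cancel₀ hq, zpow_zero]
      congr 2
      funext t
      ring
    · simp [triOp_eq_zero q hi]
  col {i j} α h := by
    rcases le_or_gt j α with hi | hi
    · rw [triOp_mul hq hi (by omega), triOp_mul hq (by omega) hi, smul_smul, if_neg (by omega),
        if_pos (by omega), if_neg (by omega), if_neg (by omega)]
      simp only [add_comm (seg i α)]
      simp only [sub_zero, zero_sub, zpow_zero, zpow_neg, zpow_one, mul_one]
      congr 2
      funext t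
      ring
    · simp [triOp_eq_zero q hi]
  anti {i j α β} h h' := by
    rcases le_or_gt j β with hi | hi
    · rw [triOp_mul hq hi (by omega), triOp_mul hq (by omega) hi]
      have e1 : (if i ≤ β ∧ β < α then 1 else 0 : ℤ) - (if i < j ∧ j ≤ α then 1 else 0) = 0 := by
        rw [if_pos (by omega), if_pos (by omega), sub_self]
      have e2 : (if j ≤ α ∧ α < β then 1 else 0 : ℤ) - (if j < i ∧ i ≤ β then 1 else 0) = 0 := by
        rw [if_neg (by omega), if_neg (by omega), sub_self]
      rw [e1, e2, add_comm (seg i α)]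
      congr 2
      funext t
      ring
    · simp [triOp_eq_zero q hi]
  diag {i j α β} h h' := by
    rcases le_or_gt i α with hi | hi
    swap
    · simp [triOp_eq_zero q hi, triOp_eq_zero q (hi.trans h)]
    rcases le_or_gt j β with hj | hj
    swap
    · simp [triOp_eq_zero q hj, triOp_eq_zero q (h'.trans hj)]
    rcases le_or_gt j α with hja | hja
    · rw [triOp_mul hq hj hi, triOp_mul hq hi hj, triOp_mul hq (by omega) hja, if_neg (by omega),
        if_pos (by omega), if_pos (by omega), if_neg (by omega), if_neg (by omega),
        if_neg (by omega)]
      have e1 : seg j β + seg i α = seg i α + seg j β := add_comm _ _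
      have e2 : seg i β + seg j α = seg i α + seg j β := by
        funext s
        simp only [seg, Pi.add_apply]
        split_ifs <;> omega
      have e3 : (fun t : ℕ → ℤ => (t (β + 1) - t j) + (t (α + 1) - t i)) =
          fun t => (t (α + 1) - t i) + (t (β + 1) - t j) := by funext t; ring
      have e4 : (fun t : ℕ → ℤ => (t (β + 1) - t i) + (t (α + 1) - t j)) =
          fun t => (t (α + 1) - t i) + (t (β + 1) - t j) := by funext t; ring
      rw [e1, e2, e3, e4]
      simp only [zero_sub, sub_zero, zpow_neg, zpow_one, zpow_zero]
      module
    · rw [triOp_eq_zero q hja, mul_zero, smul_zero, sub_zero, triOp_mul hq hj hi,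
        triOp_mul hq hi hj, if_neg (by omega), if_neg (by omega), if_neg (by omega),
        if_neg (by omega), add_comm (seg i α)]
      congr 2
      funext t
      ring

/-- The action of `End V` on finitely supported functions with values in `V`. -/
def coeffEnd (K V : Type*) [Field K] [AddCommGroup V] [Module K V] :
    Module.End K V →ₐ[K] Module.End K ((ℕ → ℤ) →₀ V) where
  toFun T := Finsupp.mapRange.linearMap T
  map_one' := Finsupp.mapRange.linearMap_id
  map_mul' T S := Finsupp.mapRange.linearMap_comp T S
  map_zero' := by ext; simp
  map_add' T S := by
    refine Finsupp.lhom_ext fun t v => ?_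
    simp
  commutes' r := by
    refine Finsupp.lhom_ext fun t v => ?_
    simp [Module.algebraMap_end_apply]

theorem coeffEnd_single (T : Module.End K V) (t : ℕ → ℤ) (v : V) :
    coeffEnd K V T (Finsupp.single t v) = Finsupp.single t (T v) := by
  simp [coeffEnd]

/-- The block matrix with blocks `1` and `M`. -/
def oneBlock {A : Type*} [Ring A] {m n : ℕ} (M : Fin m → Fin n → A) (i : Fin (m + 1))
    (k : Fin (n + 1)) : A :=
  Fin.cases (if k = 0 then 1 else 0) (fun j => Fin.cases 0 (fun α => M j α) k) i

theorem isQM_oneBlock {A : Type*} [Ring A] [Algebra K A] {q : K} {m n : ℕ}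
    {M : Fin m → Fin n → A} (h : IsQM q M) : IsQM q (oneBlock M) where
  row i α β hl := by
    induction i using Fin.cases <;> induction α using Fin.cases <;>
      induction β using Fin.cases <;>
      simp_all [oneBlock, h.row]
  col {i j} α hl := by
    induction i using Fin.cases <;> induction j using Fin.cases <;>
      induction α using Fin.cases <;>
      simp_all [oneBlock, h.col]
  anti {i j α β} hl hl' := by
    induction i using Fin.cases <;> induction j using Fin.cases <;>
      induction α using Fin.cases <;> induction β using Fin.cases <;>
      simp_all [oneBlock, h.anti]
  diag {i j α β} hl hl' := by
    induction i using Fin.cases <;> induction j using Fin.cases <;>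
      induction α using Fin.cases <;> induction β using Fin.cases <;>
      simp_all [oneBlock, h.diag]

/-- The quantum matrix with one more row obtained from `M` by means of `triOp`. -/
def extendRow {m n : ℕ} (q : K) (M : Fin m → Fin n → Module.End K V) (i : Fin (m + 1))
    (β : Fin n) : Module.End K ((ℕ → ℤ) →₀ V) :=
  ∑ k : Fin (n + 1), coeffEnd K V (oneBlock M i k) * triOp V q k (β + 1)

/-- The matrix is the product of diag(1, M) with a submatrix of the triangular one. The two factors
act on the values and on the exponents respectively, so their entries commute and `IsQM.mul`
applies. -/
theorem isQM_extendRow {m n : ℕ} {q : K} (hq : q ≠ 0) {M : Fin m → Fin n → Module.End K V}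
    (h : IsQM q M) : IsQM q (extendRow q M) := by
  have h1 := ((isQM_oneBlock h).map (coeffEnd K V)).mul hq
    ((isQM_triOp (V := V) hq).comp (f := fun k : Fin (n + 1) => (k : ℕ)) (fun _ _ h => h)
      (g := fun β : Fin n => (β : ℕ) + 1) (fun a b h => Nat.succ_lt_succ h)) ?_
  · exact h1
  · intro i k l α
    refine Finsupp.lhom_ext fun t v => ?_
    simp only [Module.End.mul_apply, triOp]
    split_ifs
    · simp [coeffEnd_single, shiftOp_single]
    · simp

theorem extendRow_zero {m n : ℕ} (q : K) (M : Fin m → Fin n → Module.End K V) (β : Fin n) :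
    extendRow q M 0 β = triOp V q 0 (β + 1) := by
  rw [extendRow, Fin.sum_univ_succ]
  simp [oneBlock]

theorem extendRow_succ {m n : ℕ} (q : K) (M : Fin m → Fin n → Module.End K V) (j : Fin m)
    (β : Fin n) : extendRow q M j.succ β =
      ∑ α : Fin n, coeffEnd K V (M j α) * triOp V q (α + 1) (β + 1) := by
  rw [extendRow, Fin.sum_univ_succ]
  simp [oneBlock]

/-- The functions supported in degree at least `d`, where `t` has degree `t 1 + ⋯ + t n`. -/
def highDeg (K V : Type*) [Field K] [AddCommGroup V] [Module K V] (n : ℕ) (d : ℤ) :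
    Submodule K ((ℕ → ℤ) →₀ V) :=
  Finsupp.supported V K {t | d ≤ ∑ s ∈ Finset.Icc 1 n, t s}

theorem single_mem_highDeg {n : ℕ} {d : ℤ} {t : ℕ → ℤ} (h : d ≤ ∑ s ∈ Finset.Icc 1 n, t s)
    (v : V) : Finsupp.single t v ∈ highDeg K V n d :=
  Finsupp.single_mem_supported K v h

theorem highDeg_map {n : ℕ} {d e : ℤ} {T : Module.End K ((ℕ → ℤ) →₀ V)}
    (hT : ∀ t v, d ≤ ∑ s ∈ Finset.Icc 1 n, t s → T (Finsupp.single t v) ∈ highDeg K V n e)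
    {x : (ℕ → ℤ) →₀ V} (hx : x ∈ highDeg K V n d) : T x ∈ highDeg K V n e := by
  rw [← Finsupp.sum_single x, Finsupp.sum, map_sum]
  refine Submodule.sum_mem _ fun t ht => hT t _ ?_
  exact (Finsupp.mem_supported K x).1 hx ht

theorem sum_seg {n α β : ℕ} (h : α ≤ β) (hn : β ≤ n) :
    ∑ s ∈ Finset.Icc 1 n, seg α β s = (β : ℤ) - α := by
  have : ∑ s ∈ Finset.Icc 1 n, seg α β s = ∑ s ∈ Finset.Ioc α β, (1 : ℤ) := by
    rw [← Finset.sum_subset (s₁ := Finset.Ioc α β) (s₂ := Finset.Icc 1 n)]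
    · refine Finset.sum_congr rfl fun s hs => ?_
      rw [Finset.mem_Ioc] at hs
      simp [seg, hs]
    · intro s
      simp only [Finset.mem_Ioc, Finset.mem_Icc]
      omega
    · intro s _ hs
      simp only [Finset.mem_Ioc] at hs
      simp [seg, hs]
  rw [this]
  simp [h]

theorem triOp_mem_highDeg {n : ℕ} (q : K) {α β : ℕ} (hn : β ≤ n) {d e : ℤ}
    (he : α ≤ β → e ≤ d + (β - α)) {x : (ℕ → ℤ) →₀ V} (hx : x ∈ highDeg K V n d) :
    triOp V q α β x ∈ highDeg K V n e := by
  rcases le_or_gt α β with h | h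
  · refine highDeg_map (fun t v ht => ?_) hx
    rw [triOp, if_pos h, shiftOp_single]
    refine Submodule.smul_mem _ _ (single_mem_highDeg ?_ _)
    simp only [Pi.add_apply, Finset.sum_add_distrib, sum_seg h hn]
    have := he h
    linarith
  · simp [triOp_eq_zero q h]

theorem coeffEnd_mem_highDeg {n : ℕ} {d : ℤ} (T : Module.End K V) {x : (ℕ → ℤ) →₀ V}
    (hx : x ∈ highDeg K V n d) : coeffEnd K V T x ∈ highDeg K V n d :=
  highDeg_map (fun t v ht => by
    rw [coeffEnd_single]; exact single_mem_highDeg ht _) hx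

/-- In a lower row only the summand with the diagonal entry of the triangular matrix preserves
degree, and that entry acts as the identity at `t = 0`. All other nonzero summands raise the degree,
so in degree zero only the action of `M` is visible. -/
theorem wordProd_extendRow_succ {m n : ℕ} (q : K) (M : Fin m → Fin n → Module.End K V) (v : V)
    (l : List (Fin m × Fin n)) :
    wordProd (extendRow q M) (l.map fun p => (p.1.succ, p.2)) (Finsupp.single 0 v) -
      Finsupp.single 0 (wordProd M l v) ∈ highDeg K V n 1 := by
  induction l with
  | nil => simp
  | cons p l ih =>
    rw [List.map_cons, wordProd_cons, wordProd_cons, Module.End.mul_apply, Module.End.mul_apply]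
    set x := wordProd (extendRow q M) (l.map fun p => (p.1.succ, p.2)) (Finsupp.single 0 v)
    set w := wordProd M l v
    have e : extendRow q M p.1.succ p.2 x - Finsupp.single 0 (M p.1 p.2 w) =
        extendRow q M p.1.succ p.2 (x - Finsupp.single 0 w) +
        (extendRow q M p.1.succ p.2 (Finsupp.single 0 w) -
          Finsupp.single 0 (M p.1 p.2 w)) := by
      rw [map_sub]; abel
    rw [e]
    refine Submodule.add_mem _ ?_ ?_
    · rw [extendRow_succ, LinearMap.sum_apply]
      refine Submodule.sum_mem _ fun α _ => ?_
      rw [Module.End.mul_apply]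
      refine coeffEnd_mem_highDeg _ (triOp_mem_highDeg q (by omega) (fun h => ?_) ih)
      push_cast
      linarith [(Nat.cast_le (α := ℤ)).2 h]
    · rw [extendRow_succ, LinearMap.sum_apply, ← Finset.add_sum_erase _ _ (Finset.mem_univ p.2),
        add_sub_right_comm]
      refine Submodule.add_mem _ ?_ (Submodule.sum_mem _ fun α hα => ?_)
      · have : seg ((p.2 : ℕ) + 1) (p.2 + 1) = 0 := by
          funext s; simp [seg]
        simp [triOp, shiftOp_single, coeffEnd_single, this]
      · rw [Module.End.mul_apply]
        refine coeffEnd_mem_highDeg _ (triOp_mem_highDeg (d := 0) q (by omega) (fun h => ?_)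
          (single_mem_highDeg (by simp) _))
        have : (α : ℕ) ≠ p.2 := fun h => (Finset.mem_erase.1 hα).1 (Fin.ext h)
        push_cast
        omega

/-- The degree of the leading term contributed by a monomial in the first row. -/
def rowShift {n : ℕ} (u : Fin n → ℕ) : ℕ → ℤ := ∑ β, (u β : ℤ) • seg 0 (β + 1)

/-- The exponent `u β` is the drop of the shift between `β + 1` and `β + 2`. -/
theorem rowShift_injective {n : ℕ} : Function.Injective (rowShift (n := n)) := by
  have key : ∀ (u : Fin n → ℕ) (s : ℕ), rowShift u (s + 1) =
      ∑ β : Fin n, if s ≤ β then (u β : ℤ) else 0 := by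
    intro u s
    simp [rowShift, seg, Finset.sum_apply]
  have key2 : ∀ (u : Fin n → ℕ) (β : Fin n),
      rowShift u (β + 1) - rowShift u (β + 1 + 1) = u β := by
    intro u β
    rw [key, key, ← Finset.sum_sub_distrib, Finset.sum_eq_single β]
    · simp
    · intro γ _ h
      have : (γ : ℕ) ≠ β := fun h' => h (Fin.ext h')
      split_ifs <;> omega
    · simp
  intro u w h
  funext β
  have := key2 u β
  rw [h, key2] at this
  exact_mod_cast this.symm

/-- The entries of row zero are single weighted shifts. Hence their products send each basis
exponent to a nonzero multiple of another and raise degrees by the degree of the total shift; the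
first part controls the error terms, the second the leading term. -/
theorem exists_wordProd_replicate {m n : ℕ} (q : K) (hq : q ≠ 0)
    (M : Fin m → Fin n → Module.End K V) (u : Fin n → ℕ) (L : List (Fin n)) :
    (∀ d, ∀ x ∈ highDeg K V n d, wordProd (extendRow q M)
        (L.flatMap fun β => List.replicate (u β) (0, β)) x ∈
          highDeg K V n (d + ∑ s ∈ Finset.Icc 1 n, (L.map fun β => (u β : ℤ) • seg 0 (β + 1)).sum s)) ∧
    ∀ t, ∃ a : K, a ≠ 0 ∧ ∀ v, wordProd (extendRow q M)
        (L.flatMap fun β => List.replicate (u β) (0, β)) (Finsupp.single t v) =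
        a • Finsupp.single (t + (L.map fun β => (u β : ℤ) • seg 0 (β + 1)).sum) v := by
  induction L with
  | nil => exact ⟨fun d x hx => by simpa using hx, fun t => ⟨1, one_ne_zero, fun v => by simp⟩⟩
  | cons β L ih =>
    obtain ⟨ih1, ih2⟩ := ih
    have rep : ∀ k : ℕ, (∀ d, ∀ x ∈ highDeg K V n d,
        wordProd (extendRow q M) (List.replicate k (0, β)) x ∈
          highDeg K V n (d + ∑ s ∈ Finset.Icc 1 n, ((k : ℤ) • seg 0 (β + 1)) s)) ∧
        ∀ t, ∃ a : K, a ≠ 0 ∧ ∀ v, wordProd (extendRow q M) (List.replicate k (0, β))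
          (Finsupp.single t v) = a • Finsupp.single (t + (k : ℤ) • seg 0 (β + 1)) v := by
      intro k
      induction k with
      | zero => exact ⟨fun d x hx => by simpa using hx, fun t => ⟨1, one_ne_zero, fun v => by simp⟩⟩
      | succ k ihk =>
        refine ⟨fun d x hx => ?_, fun t => ?_⟩
        · rw [List.replicate_succ, wordProd_cons, Module.End.mul_apply, extendRow_zero]
          refine triOp_mem_highDeg q (by omega) (fun _ => ?_) (ihk.1 d x hx)
          have e : ∀ k : ℕ, ∑ s ∈ Finset.Icc 1 n, ((k : ℤ) • seg 0 ((β : ℕ) + 1)) s =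
              k * ((β : ℤ) + 1) := by
            intro k
            simp only [Pi.smul_apply]
            rw [← Finset.smul_sum, sum_seg (Nat.zero_le _) (by omega)]
            simp
          rw [e, e]
          push_cast
          apply le_of_eq
          ring
        · obtain ⟨a, ha, h⟩ := ihk.2 t
          refine ⟨a * q ^ ((t + (k : ℤ) • seg 0 (β + 1)) ((β : ℕ) + 1 + 1) -
            (t + (k : ℤ) • seg 0 (β + 1)) 0), mul_ne_zero ha (zpow_ne_zero _ hq), fun v => ?_⟩
          have e : t + ((k + 1 : ℕ) : ℤ) • seg 0 ((β : ℕ) + 1) =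
              t + (k : ℤ) • seg 0 (β + 1) + seg 0 (β + 1) := by
            push_cast
            rw [add_smul, one_smul, add_assoc]
          rw [List.replicate_succ, wordProd_cons, Module.End.mul_apply, extendRow_zero, h,
            map_smul, triOp, if_pos (Nat.zero_le _), shiftOp_single, smul_smul, e]
    refine ⟨fun d x hx => ?_, fun t => ?_⟩
    · rw [List.flatMap_cons, wordProd_append, Module.End.mul_apply]
      have := (rep (u β)).1 _ _ (ih1 d x hx)
      rw [add_assoc, ← Finset.sum_add_distrib] at this
      convert this using 4
      rw [List.map_cons, List.sum_cons, Pi.add_apply, add_comm]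
    · obtain ⟨a, ha, h⟩ := ih2 t
      obtain ⟨b, hb, h'⟩ := (rep (u β)).2 (t + (L.map fun β => (u β : ℤ) • seg 0 (β + 1)).sum)
      refine ⟨a * b, mul_ne_zero ha hb, fun v => ?_⟩
      rw [List.flatMap_cons, wordProd_append, Module.End.mul_apply, h, map_smul, h', smul_smul,
        List.map_cons, List.sum_cons, add_assoc, add_comm (List.sum _)]

/-- In a linear relation choose, among the indices with nonzero coefficient, one whose leading
exponent has least degree, and evaluate at that exponent. The error terms have larger degree and
vanish there, which leaves a relation among the vectors `w i` with equal leading exponent. -/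
theorem linearIndependent_of_leading {ι : Type*} {n : ℕ} (F : ι → (ℕ → ℤ) →₀ V) (τ : ι → ℕ → ℤ)
    (w : ι → V) (a : ι → K) (ha : ∀ i, a i ≠ 0)
    (hF : ∀ i, F i - a i • Finsupp.single (τ i) (w i) ∈
      highDeg K V n (∑ s ∈ Finset.Icc 1 n, τ i s + 1))
    (hw : ∀ g, LinearIndependent K fun i : {i // τ i = g} => w i) : LinearIndependent K F := by
  classical
  rw [linearIndependent_iff']
  intro s c hc
  by_contra! hne
  obtain ⟨i, hi, hci⟩ := hne
  obtain ⟨i₀, hi₀, hmin⟩ := (s.filter fun i => c i ≠ 0).exists_min_image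
    (fun i => ∑ s ∈ Finset.Icc 1 n, τ i s) ⟨i, by simp [hi, hci]⟩
  rw [Finset.mem_filter] at hi₀
  have hval : ∀ i ∈ s, c i • F i (τ i₀) = if τ i = τ i₀ then (c i * a i) • w i else 0 := by
    intro i hi
    by_cases h0 : c i = 0
    · simp [h0]
    have hle := hmin i (by simp [hi, h0])
    have hz : (F i - a i • Finsupp.single (τ i) (w i)) (τ i₀) = 0 := by
      by_contra hne
      have := (Finsupp.mem_supported K _).1 (hF i) (Finsupp.mem_support_iff.2 hne)
      simp only [Set.mem_ofPred_eq] at this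
      linarith
    rw [Finsupp.sub_apply, sub_eq_zero] at hz
    rw [hz, Finsupp.smul_apply, Finsupp.single_apply, smul_smul]
    split_ifs <;> simp
  have hsum : ∑ i ∈ s.filter (fun i => τ i = τ i₀), (c i * a i) • w i = 0 := by
    rw [Finset.sum_filter, ← Finset.sum_congr rfl hval]
    simpa [Finsupp.finsetSum_apply] using DFunLike.congr_fun hc (τ i₀)
  have h1 := (linearIndependent_iff'.1 (hw (τ i₀))) (s.subtype fun i => τ i = τ i₀)
    (fun i => c i * a i) (by rw [← hsum, ← Finset.sum_subtype_eq_sum_filter]) ⟨i₀, rfl⟩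
    (by simp [hi₀.1])
  exact mul_ne_zero hi₀.2 (ha _) h1

end Representation

/-- Induction on the number of rows: the leading exponent of a monomial determines its exponents in
row zero, and the leading vector is the monomial in the remaining rows, separated by the inductive
hypothesis. -/
theorem exists_isQM_linearIndependent {K : Type u} [Field K] {q : K} (hq : q ≠ 0) (m n : ℕ) :
    ∃ (V : Type u) (_ : AddCommGroup V) (_ : Module K V) (M : Fin m → Fin n → Module.End K V)
      (v : V), IsQM q M ∧
        LinearIndependent K fun u : Fin m × Fin n → ℕ => wordProd M (word u) v := by
  induction m with
  | zero =>
    refine ⟨K, inferInstance, inferInstance, fun i => i.elim0, 1,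
      ⟨fun i => i.elim0, fun {i} => i.elim0, fun {i} => i.elim0, fun {i} => i.elim0⟩, ?_⟩
    refine LinearIndependent.of_subsingleton (fun p => p.1.elim0) ?_
    simp [word]
  | succ m ih =>
    obtain ⟨V, _, _, M, v, hM, hli⟩ := ih
    refine ⟨(ℕ → ℤ) →₀ V, inferInstance, inferInstance, extendRow q M, Finsupp.single 0 v,
      isQM_extendRow hq hM, ?_⟩
    choose a ha hlead using fun u : Fin (m + 1) × Fin n → ℕ =>
      (exists_wordProd_replicate q hq M (fun β => u (0, β)) (List.finRange n)).2 0
    refine linearIndependent_of_leading (n := n) _ (fun u => rowShift fun β => u (0, β))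
      (fun u => wordProd M (word fun p : Fin m × Fin n => u (p.1.succ, p.2)) v) a ha
      (fun u => ?_) fun g => ?_
    · have hs : ((List.finRange n).map fun β => (u (0, β) : ℤ) • seg 0 (β + 1)).sum =
          rowShift fun β => u (0, β) := by
        rw [rowShift, ← List.ofFn_eq_map, List.sum_ofFn]
      have h1 := (exists_wordProd_replicate q hq M (fun β => u (0, β)) (List.finRange n)).1 1 _
        (wordProd_extendRow_succ q M v (word fun p : Fin m × Fin n => u (p.1.succ, p.2)))
      rw [map_sub, hlead, hs, zero_add, add_comm] at h1
      rw [word_succ, wordProd_append, Module.End.mul_apply]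
      exact h1
    · refine hli.comp (fun i : {u : Fin (m + 1) × Fin n → ℕ // (rowShift fun β => u (0, β)) = g} =>
        fun p : Fin m × Fin n => i.1 (p.1.succ, p.2)) ?_
      rintro ⟨u, hu⟩ ⟨w, hw⟩ h
      have h0 := rowShift_injective (hu.trans hw.symm)
      refine Subtype.ext (funext fun p => ?_)
      obtain ⟨i, β⟩ := p
      induction i using Fin.cases with
      | zero => exact congrFun h0 β
      | succ i => exact congrFun h (i, β)

theorem linearIndependent_monomials {K : Type*} [Field K] {q : K} (hq : q ≠ 0) (n : ℕ) :
    LinearIndependent K fun u : Fin n × Fin n → ℕ => wordProd (Y q n) (word u) := by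
  obtain ⟨V, _, _, M, v, hM, hli⟩ := exists_isQM_linearIndependent hq n n
  refine LinearIndependent.of_comp ((LinearMap.applyₗ v).comp (liftQM hM).toLinearMap) ?_
  convert hli using 2 with u
  simp [wordProd, map_list_prod, Function.comp_def, liftQM_Y]

end QMatrix

end

noncomputable section

namespace QMatrix

/-! ### Straightening and the basis of ordered monomials -/

/-! ### Exponent vectors, the cone order and the powers of q produced by sorting. -/

section Exponents

variable {n : ℕ}

/-- The exponent vector `e_a + e_d - e_b - e_c` of the two by two block with rows `i, j` and
columns `α, β`. -/
def block (i j α β : Fin n) : Fin n × Fin n → ℤ :=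
  Pi.single (i, α) 1 + Pi.single (j, β) 1 - (Pi.single (i, β) 1 + Pi.single (j, α) 1)

/-- The monoid generated by the exponent vectors of two by two blocks. An exponent `w` is lower
than an exponent `u` if `u - w` belongs to it. -/
def cone (n : ℕ) : AddSubmonoid (Fin n × Fin n → ℤ) :=
  AddSubmonoid.closure {z | ∃ i j α β : Fin n, i < j ∧ α < β ∧ z = block i j α β}

theorem block_mem_cone {i j α β : Fin n} (h : i < j) (h' : α < β) : block i j α β ∈ cone n :=
  AddSubmonoid.subset_closure ⟨i, j, α, β, h, h', rfl⟩

/-- A height function which is positive on the nonzero elements of `cone n`. -/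
def ht (v : Fin n × Fin n → ℤ) : ℤ := ∑ p, v p * ((p.1 : ℤ) * p.2)

theorem ht_add (v w : Fin n × Fin n → ℤ) : ht (v + w) = ht v + ht w := by
  simp [ht, add_mul, Finset.sum_add_distrib]

theorem ht_sub (v w : Fin n × Fin n → ℤ) : ht (v - w) = ht v - ht w := by
  simp [ht, sub_mul, Finset.sum_sub_distrib]

theorem ht_single (p : Fin n × Fin n) : ht (Pi.single p 1) = (p.1 : ℤ) * p.2 := by
  simp [ht, Pi.single_apply, ite_mul]

theorem ht_block (i j α β : Fin n) :
    ht (block i j α β) = ((j : ℤ) - i) * ((β : ℤ) - α) := by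
  simp only [block, ht_sub, ht_add, ht_single]
  ring

theorem eq_zero_or_sub_block_mem {z : Fin n × Fin n → ℤ} (hz : z ∈ cone n) :
    z = 0 ∨ ∃ i j α β : Fin n, i < j ∧ α < β ∧ z - block i j α β ∈ cone n := by
  induction hz using AddSubmonoid.closure_induction with
  | mem z h =>
    obtain ⟨i, j, α, β, h, h', rfl⟩ := h
    exact Or.inr ⟨i, j, α, β, h, h', by simp⟩
  | zero => exact Or.inl rfl
  | add x y hx hy ihx ihy =>
    rcases ihx with rfl | ⟨i, j, α, β, h, h', hm⟩
    · simpa using ihy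
    · refine Or.inr ⟨i, j, α, β, h, h', ?_⟩
      rw [add_sub_right_comm]
      exact add_mem hm hy

theorem ht_nonneg {z : Fin n × Fin n → ℤ} (hz : z ∈ cone n) : 0 ≤ ht z := by
  induction hz using AddSubmonoid.closure_induction with
  | mem z h =>
    obtain ⟨i, j, α, β, h, h', rfl⟩ := h
    rw [ht_block]
    have : (i : ℤ) < j := by exact_mod_cast h
    have : (α : ℤ) < β := by exact_mod_cast h'
    nlinarith
  | zero => simp [ht]
  | add x y hx hy ihx ihy => rw [ht_add]; omega

theorem ht_pos {z : Fin n × Fin n → ℤ} (hz : z ∈ cone n) (h0 : z ≠ 0) : 0 < ht z := by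
  rcases eq_zero_or_sub_block_mem hz with h | ⟨i, j, α, β, h, h', hm⟩
  · exact absurd h h0
  · have h1 := ht_nonneg hm
    rw [ht_sub, ht_block] at h1
    have : (i : ℤ) < j := by exact_mod_cast h
    have : (α : ℤ) < β := by exact_mod_cast h'
    nlinarith

/-- The exponents `w` and `z + w` with `z` in the cone have the same entry sum. -/
theorem sum_eq_zero_of_mem_cone {z : Fin n × Fin n → ℤ} (hz : z ∈ cone n) : ∑ p, z p = 0 := by
  induction hz using AddSubmonoid.closure_induction with
  | mem z h =>
    obtain ⟨i, j, α, β, h, h', rfl⟩ := h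
    simp [block, Finset.sum_add_distrib, Finset.sum_sub_distrib]
  | zero => simp
  | add x y hx hy ihx ihy => simp [Finset.sum_add_distrib, ihx, ihy]

/-- The sign of `b - a`. -/
def sg (a b : Fin n) : ℤ := if a < b then 1 else if b < a then -1 else 0

theorem sg_swap (a b : Fin n) : sg b a = -sg a b := by
  unfold sg
  split_ifs <;> omega

/-- The exponent of `q` in the commutation of `Y p` and `Y s` up to lower terms. -/
def comm (p s : Fin n × Fin n) : ℤ :=
  (if p.1 = s.1 then sg p.2 s.2 else 0) + (if p.2 = s.2 then sg p.1 s.1 else 0)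

theorem comm_swap (p s : Fin n × Fin n) : comm s p = -comm p s := by
  simp only [comm, sg_swap p.1, sg_swap p.2, eq_comm (a := s.1), eq_comm (a := s.2)]
  split_ifs <;> ring

theorem comm_self (p : Fin n × Fin n) : comm p p = 0 := by simp [comm, sg]

/-- The total exponent of `q` in the commutation of `Y p` with a monomial of exponent `v`. -/
def eps (p : Fin n × Fin n) (v : Fin n × Fin n → ℤ) : ℤ := ∑ s, v s * comm p s

/-- The exponent of `q` for moving `Y r` to its place from the right of a monomial. -/
def rightExp (v : Fin n × Fin n → ℤ) (r : Fin n × Fin n) : ℤ :=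
  ∑ s, v s * if toLex r < toLex s then comm s r else 0

/-- The exponent of `q` for moving `Y r` to its place from the left of a monomial. -/
def leftExp (r : Fin n × Fin n) (v : Fin n × Fin n → ℤ) : ℤ :=
  ∑ s, v s * if toLex s < toLex r then comm r s else 0

/-- Moving Y_r in from the left rather than from the right amounts to passing it through the whole
monomial, which costs `eps r v`. -/
theorem leftExp_eq (r : Fin n × Fin n) (v : Fin n × Fin n → ℤ) :
    leftExp r v = rightExp v r + eps r v := by
  rw [leftExp, rightExp, eps, ← Finset.sum_add_distrib]
  refine Finset.sum_congr rfl fun s _ => ?_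
  rw [← mul_add]
  congr 1
  rcases lt_trichotomy (toLex r) (toLex s) with h | h | h
  · rw [if_neg h.not_gt, if_pos h, comm_swap r s]; ring
  · obtain rfl := toLex_inj.1 h
    simp [comm_self]
  · rw [if_pos h, if_neg h.not_gt]; ring

theorem rightExp_add (v w : Fin n × Fin n → ℤ) (r : Fin n × Fin n) :
    rightExp (v + w) r = rightExp v r + rightExp w r := by
  simp only [rightExp, Pi.add_apply, add_mul, Finset.sum_add_distrib]

theorem rightExp_single (s r : Fin n × Fin n) :
    rightExp (Pi.single s 1) r = if toLex r < toLex s then comm s r else 0 := by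
  rw [rightExp, Finset.sum_eq_single s]
  · simp
  · intro t _ h
    simp [Pi.single_eq_of_ne h]
  · simp

theorem eps_add (p : Fin n × Fin n) (v w : Fin n × Fin n → ℤ) :
    eps p (v + w) = eps p v + eps p w := by
  simp [eps, add_mul, Finset.sum_add_distrib]

theorem eps_single (p s : Fin n × Fin n) : eps p (Pi.single s 1) = comm p s := by
  rw [eps, Finset.sum_eq_single s]
  · simp
  · intro t _ h
    simp [Pi.single_eq_of_ne h]
  · simp

/-- The quadratic form of the skew-symmetric `comm` vanishes. -/
theorem sum_mul_eps_self (v : Fin n × Fin n → ℤ) : ∑ p, v p * eps p v = 0 := by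
  have h : ∑ p, v p * eps p v = -∑ p, v p * eps p v := by
    simp only [eps, Finset.mul_sum]
    conv_rhs => rw [Finset.sum_comm, ← Finset.sum_neg_distrib]
    refine Finset.sum_congr rfl fun p _ => ?_
    rw [← Finset.sum_neg_distrib]
    refine Finset.sum_congr rfl fun s _ => ?_
    rw [comm_swap p s]
    ring
  omega

/-- The exponent vector of a word. -/
def cnt (l : List (Fin n × Fin n)) : Fin n × Fin n → ℤ := fun p => l.count p

theorem cnt_cons (p : Fin n × Fin n) (l : List (Fin n × Fin n)) :
    cnt (p :: l) = Pi.single p 1 + cnt l := by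
  funext s
  by_cases h : p = s
  · subst h; simp [cnt, add_comm]
  · simp [cnt, List.count_cons_of_ne h, Pi.single_eq_of_ne (Ne.symm h)]

theorem cnt_nil : cnt ([] : List (Fin n × Fin n)) = 0 := by
  funext s; simp [cnt]

theorem cnt_append (l l' : List (Fin n × Fin n)) : cnt (l ++ l') = cnt l + cnt l' := by
  funext s; simp [cnt]

theorem cnt_perm {l l' : List (Fin n × Fin n)} (h : l.Perm l') : cnt l = cnt l' := by
  funext s; simp [cnt, h.count_eq]

theorem sum_map_eq_sum_cnt (l : List (Fin n × Fin n)) (g : Fin n × Fin n → ℤ) :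
    (l.map g).sum = ∑ s, cnt l s * g s := by
  induction l with
  | nil => simp [cnt_nil]
  | cons p l ih =>
    rw [List.map_cons, List.sum_cons, ih, cnt_cons]
    simp [add_mul, Finset.sum_add_distrib, Pi.single_apply, ite_mul]

/-- The exponent of `q` obtained on sorting a word. -/
def invExp : List (Fin n × Fin n) → ℤ
  | [] => 0
  | p :: l => leftExp p (cnt l) + invExp l

theorem invExp_append_singleton (l : List (Fin n × Fin n)) (r : Fin n × Fin n) :
    invExp (l ++ [r]) = invExp l + rightExp (cnt l) r := by
  induction l with
  | nil => simp [invExp, cnt_nil, leftExp, rightExp]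
  | cons p l ih =>
    rw [List.cons_append, invExp, invExp, ih, cnt_cons, rightExp_add, rightExp_single, cnt_append,
      leftExp, leftExp]
    simp only [Pi.add_apply, add_mul, Finset.sum_add_distrib]
    have : ∑ x, cnt [r] x * (if toLex x < toLex p then comm p x else 0) =
        if toLex r < toLex p then comm p r else 0 := by
      rw [← sum_map_eq_sum_cnt]; simp
    rw [this]
    ring

theorem invExp_eq_zero {l : List (Fin n × Fin n)}
    (h : l.Pairwise fun p s => toLex p ≤ toLex s) : invExp l = 0 := by
  induction l with
  | nil => rfl
  | cons p l ih =>
    rw [List.pairwise_cons] at h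
    rw [invExp, ih h.2, leftExp, ← sum_map_eq_sum_cnt, add_zero]
    apply List.sum_eq_zero
    intro x hx
    obtain ⟨s, hs, rfl⟩ := List.mem_map.1 hx
    rw [if_neg (h.1 s hs).not_gt]

theorem word_pairwise {m : ℕ} (u : Fin m × Fin n → ℕ) :
    (word u).Pairwise fun p s => toLex p ≤ toLex s := by
  rw [word, List.pairwise_flatMap]
  refine ⟨fun i _ => ?_, (List.pairwise_lt_finRange m).imp fun {i j} hij => ?_⟩
  · rw [List.pairwise_flatMap]
    refine ⟨fun β _ => List.pairwise_replicate.2 (Or.inr le_rfl),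
      (List.pairwise_lt_finRange n).imp fun {α β} hab => ?_⟩
    intro x hx y hy
    rw [List.eq_of_mem_replicate hx, List.eq_of_mem_replicate hy]
    exact Prod.Lex.toLex_le_toLex.2 (Or.inr ⟨rfl, hab.le⟩)
  · intro x hx y hy
    simp only [List.mem_flatMap] at hx hy
    obtain ⟨α, _, hx⟩ := hx
    obtain ⟨β, _, hy⟩ := hy
    rw [List.eq_of_mem_replicate hx, List.eq_of_mem_replicate hy]
    exact Prod.Lex.toLex_le_toLex.2 (Or.inl hij)

theorem count_word {m : ℕ} (u : Fin m × Fin n → ℕ) (p : Fin m × Fin n) :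
    (word u).count p = u p := by
  obtain ⟨i, α⟩ := p
  simp only [word, List.count_flatMap, Function.comp_def, List.count_replicate]
  rw [← List.ofFn_eq_map, List.sum_ofFn, Finset.sum_eq_single i]
  · rw [← List.ofFn_eq_map, List.sum_ofFn, Finset.sum_eq_single α]
    · simp
    · intro β _ h; simp [h]
    · simp
  · intro j _ h
    simp [h]
  · simp

theorem cnt_word (u : Fin n × Fin n → ℕ) : cnt (word u) = fun p => (u p : ℤ) := by
  funext p; simp [cnt, count_word]

theorem eq_word_of_pairwise {l : List (Fin n × Fin n)}
    (h : l.Pairwise fun p s => toLex p ≤ toLex s) {u : Fin n × Fin n → ℕ}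
    (hu : ∀ p, l.count p = u p) : l = word u := by
  refine List.Perm.eq_of_pairwise (fun a b _ _ h1 h2 => toLex_inj.1 (le_antisymm h1 h2)) h
    (word_pairwise u) (List.perm_iff_count.2 fun p => by rw [hu, count_word])

end Exponents

/-! ### Straightening, the monomial basis and leading coefficients. -/

section Straightening

variable {K : Type*} [Field K] {q : K} {n : ℕ}

/-- The span of the words whose exponent is strictly lower than `u`. -/
def lowSpan (q : K) (u : Fin n × Fin n → ℤ) : Submodule K (QMat q n) :=
  Submodule.span K {x | ∃ l, u - cnt l ∈ cone n ∧ u ≠ cnt l ∧ x = wordProd (Y q n) l}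

theorem wordProd_mem_lowSpan {u : Fin n × Fin n → ℤ} {l : List (Fin n × Fin n)}
    (h : u - cnt l ∈ cone n) (h' : u ≠ cnt l) : wordProd (Y q n) l ∈ lowSpan q u :=
  Submodule.subset_span ⟨l, h, h', rfl⟩

theorem mul_mem_lowSpan {u : Fin n × Fin n → ℤ} {x : QMat q n} (hx : x ∈ lowSpan q u)
    (l l' : List (Fin n × Fin n)) :
    wordProd (Y q n) l * x * wordProd (Y q n) l' ∈ lowSpan q (cnt l + u + cnt l') := by
  induction hx using Submodule.span_induction with
  | mem x h =>
    obtain ⟨l₀, h, h', rfl⟩ := h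
    rw [← wordProd_append, ← wordProd_append]
    have e : cnt l + u + cnt l' - cnt (l ++ l₀ ++ l') = u - cnt l₀ := by
      rw [cnt_append, cnt_append]; abel
    refine wordProd_mem_lowSpan (by rwa [e]) fun h0 => h' ?_
    rw [← sub_eq_zero, e] at h0
    exact sub_eq_zero.1 h0
  | zero => simp
  | add x y _ _ hx hy => rw [mul_add, add_mul]; exact add_mem hx hy
  | smul a x _ hx => rw [mul_smul_comm, smul_mul_assoc]; exact Submodule.smul_mem _ _ hx

theorem block_ne_zero {i j α β : Fin n} (h : i < j) (h' : α < β) : block i j α β ≠ 0 := by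
  intro h0
  have := ht_block i j α β
  rw [h0] at this
  have h1 : (i : ℤ) < j := by exact_mod_cast h
  have h2 : (α : ℤ) < β := by exact_mod_cast h'
  simp only [ht, Pi.zero_apply, zero_mul, Finset.sum_const_zero] at this
  nlinarith

/-- Only pairs in diagonal position leave a remainder, and its exponent is lower by exactly one
block. -/
theorem mul_sub_mem_lowSpan (hq : q ≠ 0) (p r : Fin n × Fin n) :
    Y q n p.1 p.2 * Y q n r.1 r.2 - q ^ comm p r • (Y q n r.1 r.2 * Y q n p.1 p.2) ∈
      lowSpan q (Pi.single p 1 + Pi.single r 1) := by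
  obtain ⟨i, α⟩ := p
  obtain ⟨j, β⟩ := r
  have hY := isQM_Y q n
  have low : ∀ {i j α β : Fin n}, i < j → α < β → Y q n i β * Y q n j α ∈
      lowSpan q (Pi.single (i, α) 1 + Pi.single (j, β) 1) := by
    intro i j α β hij hab
    have : Y q n i β * Y q n j α = wordProd (Y q n) [(i, β), (j, α)] := by simp
    rw [this]
    have e : Pi.single (i, α) 1 + Pi.single (j, β) 1 - cnt [(i, β), (j, α)] =
        block i j α β := by
      simp [cnt_cons, cnt_nil, block]
    refine wordProd_mem_lowSpan (e ▸ block_mem_cone hij hab) fun h => block_ne_zero hij hab ?_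
    rw [← e, h, sub_self]
  dsimp only
  rcases lt_trichotomy i j with hij | rfl | hij <;> rcases lt_trichotomy α β with hab | rfl | hab
  · have : comm (i, α) (j, β) = 0 := by simp [comm, hij.ne, hab.ne]
    rw [this, zpow_zero, one_smul, hY.diag hij hab, sub_sub_cancel]
    exact Submodule.smul_mem _ _ (low hij hab)
  · have : comm (i, α) (j, α) = 1 := by simp [comm, hij.ne, hij, sg]
    rw [this, zpow_one, hY.col α hij, smul_smul, mul_inv_cancel₀ hq, one_smul, sub_self]
    exact zero_mem _
  · have : comm (i, α) (j, β) = 0 := by simp [comm, hij.ne, hab.ne']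
    rw [this, zpow_zero, one_smul, hY.anti hij hab, sub_self]
    exact zero_mem _
  · have : comm (i, α) (i, β) = 1 := by simp [comm, hab.ne, hab, sg]
    rw [this, zpow_one, hY.row i hab, smul_smul, mul_inv_cancel₀ hq, one_smul, sub_self]
    exact zero_mem _
  · rw [comm_self, zpow_zero, one_smul, sub_self]
    exact zero_mem _
  · have : comm (i, α) (i, β) = -1 := by simp [comm, hab.ne', hab, hab.not_gt, sg]
    rw [this, zpow_neg_one, hY.row i hab, sub_self]
    exact zero_mem _
  · have : comm (i, α) (j, β) = 0 := by simp [comm, hij.ne', hab.ne]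
    rw [this, zpow_zero, one_smul, hY.anti hij hab, sub_self]
    exact zero_mem _
  · have : comm (i, α) (j, α) = -1 := by simp [comm, hij.ne', hij, hij.not_gt, sg]
    rw [this, zpow_neg_one, hY.col α hij, sub_self]
    exact zero_mem _
  · have : comm (i, α) (j, β) = 0 := by simp [comm, hij.ne', hab.ne']
    rw [this, zpow_zero, one_smul, hY.diag hij hab, sub_right_comm, sub_self, zero_sub, add_comm]
    exact neg_mem (Submodule.smul_mem _ _ (low hij hab))

/-- An adjacent transposition of `p` and `r` changes `invExp` by `comm p r`, which is the power of q
in the commutation relation. -/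
theorem wordProd_perm (hq : q ≠ 0) {l l' : List (Fin n × Fin n)} (h : l.Perm l') :
    wordProd (Y q n) l - q ^ (invExp l - invExp l') • wordProd (Y q n) l' ∈
      lowSpan q (cnt l) := by
  induction h with
  | nil => simp
  | @cons p l l' h ih =>
    have e : invExp (p :: l) - invExp (p :: l') = invExp l - invExp l' := by
      rw [invExp, invExp, cnt_perm h]; ring
    have := mul_mem_lowSpan ih [p] []
    rw [e, cnt_cons]
    simpa [mul_sub, cnt_cons, cnt_nil] using this
  | swap r p l =>
    have e : invExp (p :: r :: l) - invExp (r :: p :: l) = comm p r := by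
      have h1 : ∀ p r : Fin n × Fin n, leftExp p (cnt (r :: l)) =
          (if toLex r < toLex p then comm p r else 0) + leftExp p (cnt l) := by
        intro p r
        simp only [leftExp, ← sum_map_eq_sum_cnt, List.map_cons, List.sum_cons]
      rw [invExp, invExp, invExp, invExp, h1, h1]
      rcases lt_trichotomy (toLex r) (toLex p) with h | h | h
      · rw [if_pos h, if_neg h.not_gt]; ring
      · obtain rfl := toLex_inj.1 h
        rw [comm_self]; simp
      · rw [if_neg h.not_gt, if_pos h, comm_swap p r]; ring
    have := mul_mem_lowSpan (mul_sub_mem_lowSpan hq p r) [] l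
    rw [e, cnt_cons, cnt_cons, ← add_assoc]
    simpa [sub_mul, cnt_nil, mul_assoc] using this
  | @trans l l' l'' h h' ih ih' =>
    rw [← cnt_perm h] at ih'
    have := add_mem ih (Submodule.smul_mem _ (q ^ (invExp l - invExp l')) ih')
    rw [smul_sub, smul_smul, ← zpow_add₀ hq] at this
    convert this using 1
    rw [show invExp l - invExp l' + (invExp l' - invExp l'') = invExp l - invExp l'' by ring]
    abel

/-- The ordered monomial of exponent `u`. -/
def mono (q : K) (u : Fin n × Fin n → ℕ) : QMat q n := wordProd (Y q n) (word u)

theorem wordProd_sub_mono_mem (hq : q ≠ 0) (l : List (Fin n × Fin n)) :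
    wordProd (Y q n) l - q ^ invExp l • mono q (fun p => l.count p) ∈ lowSpan q (cnt l) := by
  have h : l.Perm (word fun p => l.count p) := List.perm_iff_count.2 fun p => by rw [count_word]
  have := wordProd_perm hq h
  rwa [invExp_eq_zero (word_pairwise _), sub_zero] at this

/-- Straightening terminates because the height is nonnegative on words and strictly smaller on the
words of the remainder. -/
theorem wordProd_mem_span_mono (hq : q ≠ 0) (l : List (Fin n × Fin n)) :
    wordProd (Y q n) l ∈ Submodule.span K
      (mono q '' {u | cnt l - (fun p => (u p : ℤ)) ∈ cone n}) := by
  obtain ⟨k, hk⟩ : ∃ k : ℕ, ht (cnt l) = k := by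
    refine ⟨(ht (cnt l)).toNat, (Int.toNat_of_nonneg ?_).symm⟩
    exact Finset.sum_nonneg fun p _ => mul_nonneg (by simp [cnt]) (by positivity)
  induction k using Nat.strong_induction_on generalizing l with
  | _ k ih =>
    rw [← sub_add_cancel (wordProd (Y q n) l) (q ^ invExp l • mono q (fun p => l.count p))]
    refine add_mem ?_ (Submodule.smul_mem _ _ (Submodule.subset_span ⟨_, ?_, rfl⟩))
    · refine (?_ : lowSpan q (cnt l) ≤ _) (wordProd_sub_mono_mem hq l)
      refine Submodule.span_le.2 ?_
      rintro _ ⟨l', h1, h2, rfl⟩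
      have hlt := ht_pos h1 (sub_ne_zero.2 h2)
      rw [ht_sub] at hlt
      have hnn : 0 ≤ ht (cnt l') :=
        Finset.sum_nonneg fun p _ => mul_nonneg (by simp [cnt]) (by positivity)
      refine Submodule.span_mono (Set.image_mono ?_)
        (ih (ht (cnt l')).toNat (by omega) l' (by omega))
      intro u hu
      have := add_mem h1 hu
      rwa [sub_add_sub_cancel] at this
    · change cnt l - cnt l ∈ cone n
      rw [sub_self]
      exact zero_mem _

theorem span_wordProd : Submodule.span K (Set.range (wordProd (Y q n))) = ⊤ := by
  rw [eq_top_iff]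
  rintro x -
  obtain ⟨x, rfl⟩ := RingQuot.mkAlgHom_surjective K (Rel q n) x
  induction x using FreeAlgebra.induction with
  | grade0 r =>
    rw [AlgHom.commutes, Algebra.algebraMap_eq_smul_one]
    exact Submodule.smul_mem _ _ (Submodule.subset_span ⟨[], rfl⟩)
  | grade1 p => exact Submodule.subset_span ⟨[p], by rw [wordProd_cons, wordProd_nil, mul_one]; rfl⟩
  | mul a b ha hb =>
    rw [map_mul]
    generalize (RingQuot.mkAlgHom K (Rel q n)) a = a at *
    generalize (RingQuot.mkAlgHom K (Rel q n)) b = b at *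
    have := Submodule.mul_mem_mul ha hb
    rw [Submodule.span_mul_span] at this
    refine Submodule.span_mono ?_ this
    rintro _ ⟨_, ⟨l, rfl⟩, _, ⟨l', rfl⟩, rfl⟩
    exact ⟨l ++ l', wordProd_append _ _ _⟩
  | add a b ha hb => rw [map_add]; exact add_mem ha hb

/-- The basis of ordered monomials. -/
def monoBasis (hq : q ≠ 0) (n : ℕ) : Module.Basis (Fin n × Fin n → ℕ) K (QMat q n) :=
  Module.Basis.mk (v := mono q) (linearIndependent_monomials hq n) (by
    rw [← span_wordProd]
    refine Submodule.span_le.2 ?_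
    rintro _ ⟨l, rfl⟩
    exact Submodule.span_mono (Set.image_subset_range _ _) (wordProd_mem_span_mono hq l))

theorem monoBasis_apply (hq : q ≠ 0) (u : Fin n × Fin n → ℕ) : monoBasis hq n u = mono q u :=
  Module.Basis.mk_apply _ _ _

/-- The coefficient of the ordered monomial with exponent `w`; it is zero if `w` has a negative
entry. -/
def coef (hq : q ≠ 0) (w : Fin n × Fin n → ℤ) : QMat q n →ₗ[K] K :=
  open Classical in if ∀ p, 0 ≤ w p then (monoBasis hq n).coord fun p => (w p).toNat else 0

variable (hq : q ≠ 0)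

theorem coef_mono (w : Fin n × Fin n → ℤ) (u : Fin n × Fin n → ℕ) :
    coef hq w (mono q u) = if w = (fun p => (u p : ℤ)) then 1 else 0 := by
  classical
  rw [coef]
  split_ifs with h h' h'
  · subst h'
    rw [← monoBasis_apply hq, Module.Basis.coord_apply, Module.Basis.repr_self]
    simp
  · rw [← monoBasis_apply hq, Module.Basis.coord_apply, Module.Basis.repr_self,
      Finsupp.single_apply, if_neg]
    rintro rfl
    exact h' (funext fun p => (Int.toNat_of_nonneg (h p)).symm)
  · subst h'
    exact absurd (fun p => Int.natCast_nonneg _) h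
  · rfl

theorem coef_natCast (u : Fin n × Fin n → ℕ) (x : QMat q n) :
    coef hq (fun p => (u p : ℤ)) x = (monoBasis hq n).coord u x := by
  rw [coef, if_pos fun p => Int.natCast_nonneg _]
  simp

theorem coef_eq_zero_of_neg {w : Fin n × Fin n → ℤ} {p : Fin n × Fin n} (h : w p < 0)
    (x : QMat q n) : coef hq w x = 0 := by
  rw [coef, if_neg fun h' => (h' p).not_gt h]
  rfl

theorem map_eq_sum_coef {A : Type*} [AddCommMonoid A] [Module K A]
    (φ : QMat q n →ₗ[K] A) (x : QMat q n) :
    φ x = ∑ u ∈ ((monoBasis hq n).repr x).support,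
      coef hq (fun p => (u p : ℤ)) x • φ (mono q u) := by
  conv_lhs => rw [← (monoBasis hq n).linearCombination_repr x]
  rw [Finsupp.linearCombination_apply, Finsupp.sum, map_sum]
  refine Finset.sum_congr rfl fun u _ => ?_
  rw [map_smul, monoBasis_apply, coef_natCast]
  rfl

theorem eq_zero_of_coef {x : QMat q n} (h : ∀ w, coef hq w x = 0) : x = 0 := by
  apply (monoBasis hq n).repr.injective
  ext u
  have := h fun p => (u p : ℤ)
  rw [coef_natCast] at this
  simpa using this

theorem finite_coef_ne_zero (x : QMat q n) : {w | coef hq w x ≠ 0}.Finite := by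
  refine (((monoBasis hq n).repr x).support.finite_toSet.image
    fun u p => ((u p : ℕ) : ℤ)).subset ?_
  intro w hw
  have hnn : ∀ p, 0 ≤ w p := by
    intro p
    by_contra! h
    exact hw (coef_eq_zero_of_neg hq h x)
  have e : w = fun p => ((w p).toNat : ℤ) := funext fun p => (Int.toNat_of_nonneg (hnn p)).symm
  refine ⟨fun p => (w p).toNat, ?_, e.symm⟩
  rw [Set.mem_ofPred_eq, e, coef_natCast] at hw
  simpa using hw

theorem sub_mem_cone_of_coef_ne_zero {w : Fin n × Fin n → ℤ} {l : List (Fin n × Fin n)}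
    (h : coef hq w (wordProd (Y q n) l) ≠ 0) : cnt l - w ∈ cone n := by
  by_contra hw
  apply h
  have hle : Submodule.span K (mono q '' {u | cnt l - (fun p => (u p : ℤ)) ∈ cone n}) ≤
      LinearMap.ker (coef hq w) := by
    refine Submodule.span_le.2 ?_
    rintro _ ⟨u, hu, rfl⟩
    rw [SetLike.mem_coe, LinearMap.mem_ker, coef_mono, if_neg]
    rintro rfl
    exact hw hu
  exact hle (wordProd_mem_span_mono hq l)

theorem coef_cnt_wordProd (l : List (Fin n × Fin n)) :
    coef hq (cnt l) (wordProd (Y q n) l) = q ^ invExp l := by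
  have hle : lowSpan q (cnt l) ≤ LinearMap.ker (coef hq (cnt l)) := by
    refine Submodule.span_le.2 ?_
    rintro _ ⟨l', h1, h2, rfl⟩
    rw [SetLike.mem_coe, LinearMap.mem_ker]
    by_contra h
    have h3 := ht_pos h1 (sub_ne_zero.2 h2)
    have h4 := ht_nonneg (sub_mem_cone_of_coef_ne_zero hq h)
    rw [ht_sub] at h3 h4
    omega
  have := hle (wordProd_sub_mono_mem hq l)
  rw [LinearMap.mem_ker, map_sub, map_smul, coef_mono, if_pos (by rfl), sub_eq_zero] at this
  rw [this, smul_eq_mul, mul_one]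

/-- The leading coefficient of `x * Y r`. -/
theorem coef_mul_Y {x : QMat q n} {w : Fin n × Fin n → ℤ}
    (h : ∀ z ∈ cone n, z ≠ 0 → coef hq (w + z) x = 0) (r : Fin n × Fin n) :
    coef hq (w + Pi.single r 1) (x * Y q n r.1 r.2) = q ^ rightExp w r * coef hq w x := by
  have h1 := map_eq_sum_coef hq ((coef hq (w + Pi.single r 1)).comp
    (LinearMap.mulRight K (Y q n r.1 r.2))) x
  rw [map_eq_sum_coef hq (coef hq w) x, Finset.mul_sum]
  refine h1.trans (Finset.sum_congr rfl fun u _ => ?_)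
  have e : mono q u * Y q n r.1 r.2 = wordProd (Y q n) (word u ++ [r]) := by simp [mono]
  have ec : cnt (word u ++ [r]) = (fun p => (u p : ℤ)) + Pi.single r 1 := by
    rw [cnt_append, cnt_word, cnt_cons, cnt_nil, add_zero]
  simp only [LinearMap.comp_apply, LinearMap.mulRight_apply, smul_eq_mul, coef_mono, e]
  split_ifs with hw
  · subst hw
    rw [← ec, coef_cnt_wordProd, invExp_append_singleton, invExp_eq_zero (word_pairwise u),
      cnt_word, zero_add]
    ring
  -- A monomial other than `w` reaches `w + e_r` only if it lies strictly above `w`, where `x` has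
  -- no coefficient by hypothesis.
  · by_cases h0 : coef hq (w + Pi.single r 1) (wordProd (Y q n) (word u ++ [r])) = 0
    · rw [h0]; ring
    · have h2 := sub_mem_cone_of_coef_ne_zero hq h0
      rw [ec, add_sub_add_right_eq_sub] at h2
      have h3 := h _ h2 (sub_ne_zero.2 (Ne.symm hw))
      rw [add_sub_cancel] at h3
      rw [h3]; ring

/-- The leading coefficient of `Y r * x`. -/
theorem coef_Y_mul {x : QMat q n} {w : Fin n × Fin n → ℤ}
    (h : ∀ z ∈ cone n, z ≠ 0 → coef hq (w + z) x = 0) (r : Fin n × Fin n) :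
    coef hq (w + Pi.single r 1) (Y q n r.1 r.2 * x) = q ^ leftExp r w * coef hq w x := by
  have h1 := map_eq_sum_coef hq ((coef hq (w + Pi.single r 1)).comp
    (LinearMap.mulLeft K (Y q n r.1 r.2))) x
  rw [map_eq_sum_coef hq (coef hq w) x, Finset.mul_sum]
  refine h1.trans (Finset.sum_congr rfl fun u _ => ?_)
  have e : Y q n r.1 r.2 * mono q u = wordProd (Y q n) (r :: word u) := by simp [mono]
  have ec : cnt (r :: word u) = (fun p => (u p : ℤ)) + Pi.single r 1 := by
    rw [cnt_cons, cnt_word, add_comm]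
  simp only [LinearMap.comp_apply, LinearMap.mulLeft_apply, smul_eq_mul, coef_mono, e]
  split_ifs with hw
  · subst hw
    rw [← ec, coef_cnt_wordProd, invExp, invExp_eq_zero (word_pairwise u), cnt_word, add_zero]
    ring
  · by_cases h0 : coef hq (w + Pi.single r 1) (wordProd (Y q n) (r :: word u)) = 0
    · rw [h0]; ring
    · have h2 := sub_mem_cone_of_coef_ne_zero hq h0
      rw [ec, add_sub_add_right_eq_sub] at h2
      have h3 := h _ h2 (sub_ne_zero.2 (Ne.symm hw))
      rw [add_sub_cancel] at h3
      rw [h3]; ring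

end Straightening

end QMatrix

end

noncomputable section

namespace QMatrix

/-! ### Quantum minors and the centrality of the quantum determinant -/

section Minors

variable {J : Type*} [LinearOrder J]

/-- The number of elements of `S` below `a`. -/
def below (S : Finset J) (a : J) : ℕ := (S.filter (· < a)).card

/-- The number of elements of `S` above `a`. -/
def above (S : Finset J) (a : J) : ℕ := (S.filter (a < ·)).card

theorem below_erase_of_le {S : Finset J} {a b : J} (h : a ≤ b) :
    below (S.erase b) a = below S a := by
  rw [below, below, Finset.filter_erase, Finset.erase_eq_of_notMem]
  simp [h]

theorem below_erase_of_lt {S : Finset J} {a b : J} (hb : b ∈ S) (h : b < a) :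
    below (S.erase b) a + 1 = below S a := by
  rw [below, below, Finset.filter_erase]
  exact Finset.card_erase_add_one (by simp [hb, h])

theorem above_erase_of_le {S : Finset J} {a b : J} (h : b ≤ a) :
    above (S.erase b) a = above S a := by
  rw [above, above, Finset.filter_erase, Finset.erase_eq_of_notMem]
  simp [h]

theorem above_erase_of_lt {S : Finset J} {a b : J} (hb : b ∈ S) (h : a < b) :
    above (S.erase b) a + 1 = above S a := by
  rw [above, above, Finset.filter_erase]
  exact Finset.card_erase_add_one (by simp [hb, h])

variable {K A I : Type*} [Field K] [Ring A] [Algebra K A]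

/-- The quantum minor with the given sequence of rows and the columns in `S`. -/
def minor (q : K) (y : I → J → A) : List I → Finset J → A
  | [], S => if S = ∅ then 1 else 0
  | r :: rs, S => ∑ a ∈ S, (-q) ^ below S a • (y r a * minor q y rs (S.erase a))

variable {q : K} {y : I → J → A}

theorem minor_nil (S : Finset J) : minor q y [] S = if S = ∅ then 1 else 0 := rfl

theorem minor_cons (r : I) (rs : List I) (S : Finset J) : minor q y (r :: rs) S =
    ∑ a ∈ S, (-q) ^ below S a • (y r a * minor q y rs (S.erase a)) := rfl

theorem minor_append_congr {rs rs' : List I} {c : K}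
    (h : ∀ S, minor q y rs S = c • minor q y rs' S) (l : List I) (S : Finset J) :
    minor q y (l ++ rs) S = c • minor q y (l ++ rs') S := by
  induction l generalizing S with
  | nil => exact h S
  | cons r l ih =>
    simp only [List.cons_append, minor_cons, ih, Finset.smul_sum, mul_smul_comm]
    exact Finset.sum_congr rfl fun a _ => smul_comm _ _ _

/-- Pairing the two orders of each pair of columns, which differ by the factor -q, makes the first
two rows enter only through their two by two quantum minors. -/
theorem minor_cons_cons (r s : I) (rs : List I) (S : Finset J) :
    minor q y (r :: s :: rs) S = ∑ p ∈ S.offDiag with p.1 < p.2,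
      (-q) ^ (below S p.1 + below (S.erase p.1) p.2) •
        ((y r p.1 * y s p.2 - q • (y r p.2 * y s p.1)) *
          minor q y rs ((S.erase p.1).erase p.2)) := by
  have h1 : minor q y (r :: s :: rs) S = ∑ p ∈ S.offDiag,
      (-q) ^ (below S p.1 + below (S.erase p.1) p.2) •
        (y r p.1 * y s p.2 * minor q y rs ((S.erase p.1).erase p.2)) := by
    have ho : S.offDiag = (S ×ˢ S).filter fun p => p.1 ≠ p.2 := by
      ext
      simp [Finset.mem_offDiag, and_assoc]
    rw [ho, Finset.sum_filter, Finset.sum_product, minor_cons]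
    refine Finset.sum_congr rfl fun a _ => ?_
    rw [minor_cons, ← Finset.sum_filter, Finset.filter_ne, Finset.mul_sum, Finset.smul_sum]
    refine Finset.sum_congr rfl fun b _ => ?_
    rw [mul_smul_comm, smul_smul, pow_add, mul_assoc]
  rw [h1, ← Finset.sum_filter_add_sum_filter_not _ (fun p : J × J => p.1 < p.2)]
  have h2 : ∑ p ∈ S.offDiag with ¬ p.1 < p.2,
      (-q) ^ (below S p.1 + below (S.erase p.1) p.2) •
        (y r p.1 * y s p.2 * minor q y rs ((S.erase p.1).erase p.2)) =
      ∑ p ∈ S.offDiag with p.1 < p.2,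
      (-q) ^ (below S p.2 + below (S.erase p.2) p.1) •
        (y r p.2 * y s p.1 * minor q y rs ((S.erase p.2).erase p.1)) := by
    refine Finset.sum_bij' (fun p _ => p.swap) (fun p _ => p.swap) ?_ ?_ ?_ ?_ ?_
    · rintro ⟨a, b⟩ h
      simp only [Finset.mem_filter, Finset.mem_offDiag, not_lt] at h ⊢
      exact ⟨⟨h.1.2.1, h.1.1, h.1.2.2.symm⟩, lt_of_le_of_ne h.2 h.1.2.2.symm⟩
    · rintro ⟨a, b⟩ h
      simp only [Finset.mem_filter, Finset.mem_offDiag, not_lt] at h ⊢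
      exact ⟨⟨h.1.2.1, h.1.1, h.1.2.2.symm⟩, h.2.le⟩
    · simp
    · simp
    · simp
  rw [h2, ← Finset.sum_add_distrib]
  refine Finset.sum_congr rfl fun p hp => ?_
  simp only [Finset.mem_filter, Finset.mem_offDiag] at hp
  rw [Finset.erase_right_comm (a := p.2), below_erase_of_le hp.2.le,
    ← below_erase_of_lt hp.1.1 hp.2, sub_mul, smul_sub, smul_mul_assoc, smul_smul, sub_eq_add_neg,
    ← neg_smul]
  congr 2
  ring

/-- Expansion of a minor along its last row. -/
theorem minor_append_singleton (rs : List I) (r : I) (S : Finset J) :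
    minor q y (rs ++ [r]) S =
      ∑ a ∈ S, (-q) ^ above S a • (minor q y rs (S.erase a) * y r a) := by
  induction rs generalizing S with
  | nil =>
    simp only [List.nil_append, minor_cons, minor_nil]
    refine Finset.sum_congr rfl fun a ha => ?_
    by_cases h : S.erase a = ∅
    · have : S = {a} := by
        rw [← Finset.insert_erase ha, h]
        rfl
      subst this
      simp [below, above, Finset.filter_singleton]
    · simp [h]
  | cons s rs ih =>
    simp only [List.cons_append, minor_cons, ih, Finset.mul_sum, Finset.smul_sum, Finset.sum_mul]
    rw [Finset.sum_sigma', Finset.sum_sigma']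
    refine Finset.sum_bij' (fun p _ => ⟨p.2, p.1⟩) (fun p _ => ⟨p.2, p.1⟩) ?_ ?_ ?_ ?_ ?_
    · rintro ⟨a, b⟩ h
      simp only [Finset.mem_sigma, Finset.mem_erase] at h ⊢
      exact ⟨h.2.2, h.2.1.symm, h.1⟩
    · rintro ⟨a, b⟩ h
      simp only [Finset.mem_sigma, Finset.mem_erase] at h ⊢
      exact ⟨h.2.2, h.2.1.symm, h.1⟩
    · simp
    · simp
    · rintro ⟨a, b⟩ h
      simp only [Finset.mem_sigma, Finset.mem_erase] at h ⊢
      obtain ⟨ha, hba, hb⟩ := h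
      simp only [mul_smul_comm, smul_mul_assoc, smul_smul, ← pow_add, mul_assoc]
      rw [Finset.erase_right_comm]
      congr 2
      rcases lt_or_gt_of_ne hba with h | h
      · rw [← below_erase_of_lt hb h, ← above_erase_of_lt ha h]
        ring
      · rw [above_erase_of_le h.le, below_erase_of_le h.le]
        ring

theorem minor_cons_toFinset (r : I) (rs : List I) {c : J} {cs : List J} (hc : ∀ x ∈ cs, c < x) :
    minor q y (r :: rs) (c :: cs).toFinset = y r c * minor q y rs cs.toFinset +
      ∑ a ∈ cs.toFinset, (-q) ^ (below cs.toFinset a + 1) •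
        (y r a * minor q y rs (insert c (cs.toFinset.erase a))) := by
  have hcn : c ∉ cs.toFinset := fun h => lt_irrefl c (hc c (List.mem_toFinset.1 h))
  rw [List.toFinset_cons, minor_cons, Finset.sum_insert hcn, Finset.erase_insert hcn]
  congr 1
  · have : below (insert c cs.toFinset) c = 0 := by
      rw [below, Finset.card_eq_zero, Finset.filter_eq_empty_iff]
      intro x hx
      rcases Finset.mem_insert.1 hx with rfl | hx
      · exact lt_irrefl _
      · exact (hc x (List.mem_toFinset.1 hx)).not_gt
    rw [this, pow_zero, one_smul]
  · refine Finset.sum_congr rfl fun a ha => ?_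
    have hca := hc a (List.mem_toFinset.1 ha)
    rw [Finset.erase_insert_of_ne hca.ne,
      ← below_erase_of_lt (Finset.mem_insert_self c _) hca, Finset.erase_insert hcn]

variable [LinearOrder I]

/-- By `minor_cons_cons` it suffices to exchange the rows of a two by two minor, where the `diag`
and `anti` relations produce the factor -q. -/
theorem minor_swap (h : IsQM q y) (hq : q ≠ 0) (l : List I) {r s : I} (hrs : r < s) (rs : List I)
    (S : Finset J) :
    minor q y (l ++ s :: r :: rs) S = (-q) • minor q y (l ++ r :: s :: rs) S := by
  refine minor_append_congr (fun S => ?_) l S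
  rw [minor_cons_cons, minor_cons_cons, Finset.smul_sum]
  refine Finset.sum_congr rfl fun p hp => ?_
  have hp' : p.1 < p.2 := (Finset.mem_filter.1 hp).2
  have hM : y s p.1 * y r p.2 - q • (y s p.2 * y r p.1) =
      (-q) • (y r p.1 * y s p.2 - q • (y r p.2 * y s p.1)) := by
    have hc : q * (q - q⁻¹) = q * q - 1 := by
      rw [mul_sub, mul_inv_cancel₀ hq]
    rw [h.diag hrs hp', h.anti hrs hp', smul_sub, smul_smul, hc]
    module
  rw [hM, smul_mul_assoc, smul_comm]

/-- A two by two minor with equal rows vanishes by the `row` relation. -/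
theorem minor_repeat (h : IsQM q y) (hq : q ≠ 0) (l : List I) (r : I) (rs : List I)
    (S : Finset J) : minor q y (l ++ r :: r :: rs) S = 0 := by
  have := minor_append_congr (q := q) (y := y) (rs := r :: r :: rs) (rs' := []) (c := 0)
    (fun S => ?_) l S
  · simpa using this
  rw [zero_smul, minor_cons_cons]
  refine Finset.sum_eq_zero fun p hp => ?_
  have hp' : p.1 < p.2 := (Finset.mem_filter.1 hp).2
  rw [h.row r hp', smul_smul, mul_inv_cancel₀ hq, one_smul, sub_self, zero_mul, smul_zero]

/-- Moving a row to the right past smaller rows. -/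
theorem minor_move_right (h : IsQM q y) (hq : q ≠ 0) (l₀ l : List I) {r : I}
    (hl : ∀ s ∈ l, s < r) (rs : List I) (S : Finset J) :
    minor q y (l₀ ++ r :: (l ++ rs)) S =
      (-q) ^ l.length • minor q y (l₀ ++ l ++ r :: rs) S := by
  induction l generalizing l₀ with
  | nil => simp
  | cons s l ih =>
    have h1 := minor_swap h hq l₀ (hl s (by simp)) (l ++ rs) S
    have h2 := ih (l₀ ++ [s]) fun t ht => hl t (by simp [ht])
    simp only [List.append_assoc, List.cons_append, List.nil_append] at h1 h2 ⊢
    rw [h1, h2, smul_smul, List.length_cons, pow_succ']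

/-- Moving a row to the left past larger rows. -/
theorem minor_move_left (h : IsQM q y) (hq : q ≠ 0) (l₀ l : List I) {r : I}
    (hl : ∀ s ∈ l, r < s) (rs : List I) (S : Finset J) :
    minor q y (l₀ ++ l ++ r :: rs) S =
      (-q) ^ l.length • minor q y (l₀ ++ r :: (l ++ rs)) S := by
  induction l generalizing l₀ with
  | nil => simp
  | cons s l ih =>
    have h1 := minor_swap h hq l₀ (hl s (by simp)) (l ++ rs) S
    have h2 := ih (l₀ ++ [s]) fun t ht => hl t (by simp [ht])
    simp only [List.append_assoc, List.cons_append, List.nil_append] at h1 h2 ⊢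
    rw [h2, h1, smul_smul, List.length_cons, pow_succ]

/-- A minor equals the corresponding minor of the transposed matrix. -/
theorem minor_transpose (h : IsQM q y) (rs : List I) (cs : List J)
    (hrs : rs.Pairwise (· < ·)) (hcs : cs.Pairwise (· < ·)) :
    minor q y rs cs.toFinset = minor q (fun a i => y i a) cs rs.toFinset := by
  obtain ⟨N, hN⟩ : ∃ N, rs.length + cs.length = N := ⟨_, rfl⟩
  induction N using Nat.strong_induction_on generalizing rs cs with
  | _ N ih =>
  match rs, cs with
  | [], [] => rfl
  | [], c :: cs => simp [minor_nil, minor_cons]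
  | r :: rs, [] => simp [minor_nil, minor_cons]
  | r :: rs, c :: cs =>
    rw [List.pairwise_cons] at hrs hcs
    simp only [List.length_cons] at hN
    rw [minor_cons_toFinset r rs hcs.1, minor_cons_toFinset (y := fun a i => y i a) c cs hrs.1,
      ih (rs.length + cs.length) (by omega) rs cs hrs.2 hcs.2 rfl]
    congr 1
    have hndc : cs.Nodup := hcs.2.imp fun h => ne_of_lt h
    have hndr : rs.Nodup := hrs.2.imp fun h => ne_of_lt h
    have e1 : ∀ a ∈ cs.toFinset, minor q y rs (insert c (cs.toFinset.erase a)) =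
        ∑ i ∈ rs.toFinset, (-q) ^ below rs.toFinset i •
          (y i c * minor q (fun a i => y i a) (cs.erase a) (rs.toFinset.erase i)) := by
      intro a ha
      have hs : insert c (cs.toFinset.erase a) = (c :: cs.erase a).toFinset := by
        rw [List.toFinset_cons]
        congr 1
        ext x
        rw [Finset.mem_erase, List.mem_toFinset, List.mem_toFinset,
          hndc.mem_erase_iff]
      have hlen := List.length_erase_of_mem (List.mem_toFinset.1 ha)
      have hpos := List.length_pos_of_mem (List.mem_toFinset.1 ha)
      rw [hs, ih (rs.length + (c :: cs.erase a).length) (by simp only [List.length_cons]; omega)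
        rs _ hrs.2 (List.pairwise_cons.2 ⟨fun x hx => hcs.1 x (List.mem_of_mem_erase hx),
          hcs.2.sublist List.erase_sublist⟩) rfl, minor_cons]
    have e2 : ∀ i ∈ rs.toFinset,
        minor q (fun a i => y i a) cs (insert r (rs.toFinset.erase i)) =
        ∑ a ∈ cs.toFinset, (-q) ^ below cs.toFinset a •
          (y r a * minor q (fun a i => y i a) (cs.erase a) (rs.toFinset.erase i)) := by
      intro i hi
      have hsi : (rs.erase i).toFinset = rs.toFinset.erase i := by
        ext x
        rw [Finset.mem_erase, List.mem_toFinset, List.mem_toFinset,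
          hndr.mem_erase_iff]
      have hs : insert r (rs.toFinset.erase i) = (r :: rs.erase i).toFinset := by
        rw [List.toFinset_cons, hsi]
      have hlen := List.length_erase_of_mem (List.mem_toFinset.1 hi)
      have hpos := List.length_pos_of_mem (List.mem_toFinset.1 hi)
      rw [hs, ← ih ((r :: rs.erase i).length + cs.length)
        (by simp only [List.length_cons]; omega) _ cs
        (List.pairwise_cons.2 ⟨fun x hx => hrs.1 x (List.mem_of_mem_erase hx),
          hrs.2.sublist List.erase_sublist⟩) hcs.2 rfl, minor_cons]
      refine Finset.sum_congr rfl fun a ha => ?_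
      have hsa : (cs.erase a).toFinset = cs.toFinset.erase a := by
        ext x
        rw [Finset.mem_erase, List.mem_toFinset, List.mem_toFinset,
          hndc.mem_erase_iff]
      have hlena := List.length_erase_of_mem (List.mem_toFinset.1 ha)
      rw [← hsi, ← hsa, ih ((rs.erase i).length + (cs.erase a).length) (by omega) _ _
        (hrs.2.sublist List.erase_sublist) (hcs.2.sublist List.erase_sublist) rfl]
    -- Each side is now a double sum over a later row `i` and a later column `a`, one expanded along
    -- the row and then the column, the other in the opposite order. Terms differ only in the order
    -- of `y r a` and `y i c`, which are in antidiagonal position and commute.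
    refine (Finset.sum_congr rfl fun a ha => by rw [e1 a ha]).trans
      (Eq.trans ?_ (Finset.sum_congr rfl fun i hi => by rw [e2 i hi]).symm)
    simp only [Finset.mul_sum, Finset.smul_sum]
    rw [Finset.sum_comm]
    refine Finset.sum_congr rfl fun i hi => Finset.sum_congr rfl fun a ha => ?_
    have hri := hrs.1 i (List.mem_toFinset.1 hi)
    have hca := hcs.1 a (List.mem_toFinset.1 ha)
    simp only [mul_smul_comm, smul_smul, ← mul_assoc]
    rw [h.anti hri hca]
    congr 1
    ring

end Minors

/-! ### The sum over permutations as an iterated Laplace expansion. -/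

section Permutations

/-- The permutation of `Fin (N + 1)` sending `0` to `a` and acting as `σ` on the rest. -/
def consPerm {N : ℕ} (a : Fin (N + 1)) (σ : Equiv.Perm (Fin N)) : Equiv.Perm (Fin (N + 1)) :=
  (Equiv.Perm.decomposeFin.symm (0, σ)).trans a.cycleRange.symm

theorem consPerm_zero {N : ℕ} (a : Fin (N + 1)) (σ : Equiv.Perm (Fin N)) :
    consPerm a σ 0 = a := by
  simp [consPerm]

theorem consPerm_succ {N : ℕ} (a : Fin (N + 1)) (σ : Equiv.Perm (Fin N)) (i : Fin N) :
    consPerm a σ i.succ = a.succAbove (σ i) := by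
  simp [consPerm]

theorem consPerm_bijective (N : ℕ) :
    Function.Bijective fun p : Fin (N + 1) × Equiv.Perm (Fin N) => consPerm p.1 p.2 := by
  rw [Fintype.bijective_iff_injective_and_card]
  constructor
  · rintro ⟨a, σ⟩ ⟨b, τ⟩ h
    have h0 : a = b := by
      have := Equiv.congr_fun h 0
      simpa [consPerm_zero] using this
    subst h0
    refine Prod.ext rfl (Equiv.ext fun i => ?_)
    have := Equiv.congr_fun h i.succ
    simpa [consPerm_succ] using this
  · simp [Fintype.card_perm, Nat.factorial_succ]

theorem len_eq_sum (N : ℕ) (σ : Equiv.Perm (Fin N)) :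
    len N σ = ∑ i, ∑ j, if i < j ∧ σ j < σ i then 1 else 0 := by
  rw [len, Finset.card_filter, Fintype.sum_prod_type]

theorem len_consPerm {N : ℕ} (a : Fin (N + 1)) (σ : Equiv.Perm (Fin N)) :
    len (N + 1) (consPerm a σ) = a + len N σ := by
  rw [len_eq_sum, len_eq_sum, Fin.sum_univ_succ]
  congr 1
  · rw [Fin.sum_univ_succ]
    simp only [consPerm_zero, consPerm_succ, lt_self_iff_false, false_and, if_false, zero_add,
      Fin.succ_pos, true_and]
    rw [Equiv.sum_comp σ fun j => if a.succAbove j < a then 1 else 0, ← Finset.card_filter]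
    have : (Finset.univ.filter fun j : Fin N => a.succAbove j < a) =
        Finset.univ.filter fun j : Fin N => (j : ℕ) < a := by
      ext j
      simp only [Finset.mem_filter, Finset.mem_univ, true_and, Fin.succAbove_lt_iff_castSucc_lt]
      rfl
    rw [this, Fin.card_filter_val_lt]
    have := a.2
    omega
  · refine Finset.sum_congr rfl fun i _ => ?_
    rw [Fin.sum_univ_succ]
    simp [consPerm_zero, consPerm_succ, Fin.succAbove_lt_succAbove_iff]

/-- Permutations are grouped by their value `a` at 0. This value contributes `a` inversions, which
is the number of columns below the one removed. -/
theorem sum_perm_eq_minor {K A I J : Type*} [Field K] [Ring A] [Algebra K A] [LinearOrder J]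
    (q : K) (y : I → J → A) (N : ℕ) (r : Fin N → I) (e : Fin N ↪o J) :
    ∑ σ : Equiv.Perm (Fin N), (-q) ^ len N σ • (List.ofFn fun i => y (r i) (e (σ i))).prod =
      minor q y (List.ofFn r) (Finset.univ.map e.toEmbedding) := by
  induction N with
  | zero =>
    simp [minor_nil, len]
  | succ N ih =>
    rw [List.ofFn_succ, minor_cons, Finset.sum_map,
      ← (consPerm_bijective N).sum_comp, Fintype.sum_prod_type]
    refine Finset.sum_congr rfl fun a _ => ?_
    have h1 := ih (fun i => r i.succ) ((Fin.succAboveOrderEmb a).trans e)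
    have h2 : (Finset.univ.map ((Fin.succAboveOrderEmb a).trans e).toEmbedding) =
        (Finset.univ.map e.toEmbedding).erase (e.toEmbedding a) := by
      ext x
      simp only [Finset.mem_map, Finset.mem_univ, true_and, Finset.mem_erase]
      constructor
      · rintro ⟨k, rfl⟩
        exact ⟨fun h => Fin.succAbove_ne a k (e.injective h), _, rfl⟩
      · rintro ⟨h, k, rfl⟩
        obtain ⟨l, rfl⟩ := Fin.exists_succAbove_eq (x := k) (y := a) fun h' => h (by rw [h'])
        exact ⟨l, rfl⟩
    have h3 : below (Finset.univ.map e.toEmbedding) (e.toEmbedding a) = a := by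
      have : (Finset.univ.map e.toEmbedding).filter (· < e.toEmbedding a) =
          (Finset.univ.filter fun j : Fin (N + 1) => j < a).map e.toEmbedding := by
        rw [Finset.filter_map]
        congr 1
        ext j
        simp
      rw [below, this, Finset.card_map, Finset.filter_gt_eq_Iio, Fin.card_Iio]
    rw [← h2, ← h1, h3, Finset.mul_sum, Finset.smul_sum]
    refine Finset.sum_congr rfl fun σ _ => ?_
    rw [len_consPerm, List.ofFn_succ, List.prod_cons, mul_smul_comm, smul_smul, pow_add]
    simp [consPerm_zero, consPerm_succ]

end Permutations

/-! ### Cofactor identities and centrality of the quantum determinant. -/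

section Centrality

variable {K : Type*} [Field K] {q : K} {n : ℕ}

theorem detq_eq_minor : detq q n = minor q (Y q n) (List.finRange n) Finset.univ := by
  have := sum_perm_eq_minor q (Y q n) n id (OrderIso.refl (Fin n)).toOrderEmbedding
  simp only [List.ofFn_id] at this
  rw [detq]
  simpa using this

theorem below_univ (a : Fin n) : below Finset.univ a = a := by
  rw [below, Finset.filter_gt_eq_Iio, Fin.card_Iio]

theorem above_univ (a : Fin n) : above Finset.univ a = n - 1 - a := by
  rw [above, Finset.filter_lt_eq_Ioi, Fin.card_Ioi]

theorem finRange_eq_append (j : Fin n) : ∃ l l' : List (Fin n), List.finRange n = l ++ j :: l' ∧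
    (List.finRange n).erase j = l ++ l' ∧ (∀ s ∈ l, s < j) ∧ (∀ s ∈ l', j < s) ∧ l.length = j ∧
      l'.length = n - 1 - j := by
  obtain ⟨l, l', h⟩ := List.append_of_mem (List.mem_finRange j)
  have hp := List.pairwise_lt_finRange n
  rw [h, List.pairwise_append] at hp
  have hl : ∀ s ∈ l, s < j := fun s hs => hp.2.2 s hs j (by simp)
  have hl' : ∀ s ∈ l', j < s := (List.pairwise_cons.1 hp.2.1).1
  have hlen : l.length = j := by
    have h1 : (List.finRange n)[l.length]'(by rw [h]; simp) = j := by simp [h]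
    simpa using congrArg Fin.val h1
  refine ⟨l, l', h, ?_, hl, hl', hlen, ?_⟩
  · rw [h, List.erase_append_right _ fun hj => lt_irrefl j (hl j hj), List.erase_cons_head]
  · have := congrArg List.length h
    simp at this
    omega

/-- The extra row is sorted into place past the smaller rows; for `i ≠ j` it then meets a second
copy of itself. Together with `minor_erase_append` this gives the cofactor expansions. -/
theorem minor_cons_erase {y : Fin n → Fin n → QMat q n} (h : IsQM q y) (hq : q ≠ 0)
    (i j : Fin n) : minor q y (i :: (List.finRange n).erase j) Finset.univ =
      if i = j then (-q) ^ (j : ℕ) • minor q y (List.finRange n) Finset.univ else 0 := by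
  split_ifs with hij
  · subst hij
    obtain ⟨l, l', h1, h2, h3, -, h5, -⟩ := finRange_eq_append i
    have := minor_move_right h hq [] l h3 l' Finset.univ
    simp only [List.nil_append] at this
    rw [h2, this, h1, h5]
  · obtain ⟨l, l', h1⟩ := List.append_of_mem
      ((List.mem_erase_of_ne hij).2 (List.mem_finRange i))
    have hp : (l ++ i :: l').Pairwise (· < ·) :=
      h1 ▸ (List.pairwise_lt_finRange n).sublist List.erase_sublist
    rw [List.pairwise_append] at hp
    have := minor_move_right h hq [] l (fun s hs => hp.2.2 s hs i (by simp)) (i :: l') Finset.univ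
    simp only [List.nil_append] at this
    rw [h1, this, minor_repeat h hq, smul_zero]

theorem minor_erase_append {y : Fin n → Fin n → QMat q n} (h : IsQM q y) (hq : q ≠ 0)
    (i j : Fin n) : minor q y ((List.finRange n).erase j ++ [i]) Finset.univ =
      if i = j then (-q) ^ (n - 1 - j) • minor q y (List.finRange n) Finset.univ else 0 := by
  split_ifs with hij
  · subst hij
    obtain ⟨l, l', h1, h2, -, h4, -, h6⟩ := finRange_eq_append i
    have := minor_move_left h hq l l' h4 [] Finset.univ
    rw [h2, this, h1, h6, List.append_nil]
  · obtain ⟨l, l', h1⟩ := List.append_of_mem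
      ((List.mem_erase_of_ne hij).2 (List.mem_finRange i))
    have hp : (l ++ i :: l').Pairwise (· < ·) :=
      h1 ▸ (List.pairwise_lt_finRange n).sublist List.erase_sublist
    rw [List.pairwise_append, List.pairwise_cons] at hp
    have := minor_move_left h hq (l ++ [i]) l' hp.2.1.1 [] Finset.univ
    simp only [List.append_assoc, List.cons_append, List.nil_append, List.append_nil] at this
    rw [h1, List.append_assoc, List.cons_append, this, minor_repeat h hq, smul_zero]

/-- With cofactors A_{ia}, the signed sum of Y_{ka} A_{ia} Y_{il} over i and a collapses in two
ways. Summing over a first uses row expansion and gives det Y_{kl}; summing over i first uses column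
expansion and gives Y_{kl} det. The scalar factor is the same in both cases. -/
theorem Y_mul_detq (hq : q ≠ 0) (k l : Fin n) :
    Y q n k l * detq q n = detq q n * Y q n k l := by
  have hY := isQM_Y q n
  have hnq : -q ≠ 0 := neg_ne_zero.2 hq
  set A : Fin n → Fin n → QMat q n := fun i a =>
    minor q (Y q n) ((List.finRange n).erase i) (Finset.univ.erase a) with hA
  have hfin : ∀ i : Fin n, ((List.finRange n).erase i).toFinset = Finset.univ.erase i := by
    intro i
    ext x
    rw [List.mem_toFinset, (List.nodup_finRange n).mem_erase_iff]
    simp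
  have hsort : ∀ i : Fin n, ((List.finRange n).erase i).Pairwise (· < ·) := fun i =>
    (List.pairwise_lt_finRange n).sublist List.erase_sublist
  -- Cofactors agree with those of the transposed matrix, so column expansion is obtained as row
  -- expansion there.
  have hT : ∀ i a, A i a =
      minor q (fun a i => Y q n i a) ((List.finRange n).erase a) (Finset.univ.erase i) := by
    intro i a
    simp only [hA]
    rw [← hfin a, ← hfin i]
    exact minor_transpose hY _ _ (hsort i) (hsort a)
  have hdT : minor q (fun a i => Y q n i a) (List.finRange n) Finset.univ = detq q n := by
    have := minor_transpose hY (List.finRange n) (List.finRange n)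
      (List.pairwise_lt_finRange n) (List.pairwise_lt_finRange n)
    rw [List.toFinset_finRange] at this
    rw [detq_eq_minor, this]
  have hrow : ∀ i j, ∑ a : Fin n, (-q) ^ (a : ℕ) • (Y q n i a * A j a) =
      if i = j then (-q) ^ (j : ℕ) • detq q n else 0 := by
    intro i j
    rw [detq_eq_minor, ← minor_cons_erase hY hq, minor_cons]
    simp only [below_univ, hA]
  have hcol : ∀ a b, ∑ i : Fin n, (-q) ^ (n - 1 - i : ℕ) • (A i a * Y q n i b) =
      if b = a then (-q) ^ (n - 1 - a : ℕ) • detq q n else 0 := by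
    intro a b
    rw [← hdT, ← minor_erase_append hY.transpose hq, minor_append_singleton]
    simp only [above_univ, hT]
  have e1 : ∑ i : Fin n, ∑ a : Fin n, ((-q) ^ (n - 1 - i : ℕ) * (-q) ^ (a : ℕ)) •
      (Y q n k a * A i a * Y q n i l) = (-q) ^ (n - 1) • (detq q n * Y q n k l) := by
    have : ∀ i : Fin n, ∑ a : Fin n, ((-q) ^ (n - 1 - i : ℕ) * (-q) ^ (a : ℕ)) •
        (Y q n k a * A i a * Y q n i l) =
        if k = i then (-q) ^ (n - 1) • (detq q n * Y q n k l) else 0 := by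
      intro i
      have h1 := congrArg (fun x => (-q) ^ (n - 1 - i : ℕ) • (x * Y q n i l)) (hrow k i)
      simp only [Finset.sum_mul, Finset.smul_sum, smul_mul_assoc, smul_smul] at h1
      rw [h1]
      split_ifs with hk
      · subst hk
        rw [smul_mul_assoc, smul_smul, ← pow_add]
        congr 2
        omega
      · simp
    rw [Finset.sum_congr rfl fun i _ => this i]
    simp
  have e2 : ∑ i : Fin n, ∑ a : Fin n, ((-q) ^ (n - 1 - i : ℕ) * (-q) ^ (a : ℕ)) •
      (Y q n k a * A i a * Y q n i l) = (-q) ^ (n - 1) • (Y q n k l * detq q n) := by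
    rw [Finset.sum_comm]
    have : ∀ a : Fin n, ∑ i : Fin n, ((-q) ^ (n - 1 - i : ℕ) * (-q) ^ (a : ℕ)) •
        (Y q n k a * A i a * Y q n i l) =
        if l = a then (-q) ^ (n - 1) • (Y q n k l * detq q n) else 0 := by
      intro a
      have h1 := congrArg (fun x => (-q) ^ (a : ℕ) • (Y q n k a * x)) (hcol a l)
      simp only [Finset.mul_sum, Finset.smul_sum, mul_smul_comm, smul_smul, ← mul_assoc] at h1
      simp only [mul_comm ((-q) ^ (_ : ℕ)) ((-q) ^ (a : ℕ))]
      rw [h1]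
      split_ifs with hk
      · subst hk
        rw [mul_smul_comm, smul_smul, ← pow_add]
        congr 2
        omega
      · simp
    rw [Finset.sum_congr rfl fun a _ => this a]
    simp
  have h := e2.symm.trans e1
  exact smul_right_injective _ (pow_ne_zero _ hnq) h

theorem QMat.mem_center_of_commute {x : QMat q n}
    (h : ∀ i a, Y q n i a * x = x * Y q n i a) : x ∈ Subalgebra.center K (QMat q n) := by
  rw [Subalgebra.mem_center_iff]
  intro b
  have hb : b ∈ Submodule.span K (Set.range (wordProd (Y q n))) := by
    rw [span_wordProd]
    trivial
  induction hb using Submodule.span_induction with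
  | mem b hb =>
    obtain ⟨l, rfl⟩ := hb
    induction l with
    | nil => simp
    | cons p l ih => rw [wordProd_cons, mul_assoc, ih, ← mul_assoc, h, mul_assoc]
  | zero => simp
  | add b c _ _ hb hc => rw [add_mul, mul_add, hb, hc]
  | smul r b _ hb => rw [smul_mul_assoc, mul_smul_comm, hb]

theorem detq_mem_center (hq : q ≠ 0) : detq q n ∈ Subalgebra.center K (QMat q n) :=
  QMat.mem_center_of_commute fun i a => Y_mul_detq hq i a

end Centrality

end QMatrix

end

noncomputable section

namespace QMatrix

/-! ### Leading terms of powers of the quantum determinant -/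

/-! ### Elements whose support lies below a given exponent. -/

section Support

variable {K : Type*} [Field K] {q : K} {n : ℕ} (hq : q ≠ 0)

/-- The elements all of whose monomials have exponents lower than or equal to `u`. -/
def leSpan (u : Fin n × Fin n → ℤ) : Submodule K (QMat q n) where
  carrier := {x | ∀ w, coef hq w x ≠ 0 → u - w ∈ cone n}
  zero_mem' := by simp
  add_mem' := by
    intro x y hx hy w hw
    by_cases h : coef hq w x = 0
    · exact hy w (by simpa [h] using hw)
    · exact hx w h
  smul_mem' := by
    intro c x hx w hw
    exact hx w fun h => hw (by simp [h])

theorem wordProd_mem_leSpan (l : List (Fin n × Fin n)) :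
    wordProd (Y q n) l ∈ leSpan hq (cnt l) :=
  fun _ => sub_mem_cone_of_coef_ne_zero hq

theorem leSpan_mono {u u' : Fin n × Fin n → ℤ} (h : u' - u ∈ cone n) :
    leSpan hq u ≤ leSpan hq u' := by
  intro x hx w hw
  have := add_mem h (hx w hw)
  rwa [sub_add_sub_cancel] at this

theorem mono_mem_leSpan (u : Fin n × Fin n → ℕ) : mono q u ∈ leSpan hq (fun p => (u p : ℤ)) := by
  have := wordProd_mem_leSpan hq (word u)
  rwa [cnt_word] at this

theorem mul_mem_leSpan {u v : Fin n × Fin n → ℤ} {x y : QMat q n} (hx : x ∈ leSpan hq u)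
    (hy : y ∈ leSpan hq v) : x * y ∈ leSpan hq (u + v) := by
  rw [show x * y = LinearMap.mulRight K y x from rfl, map_eq_sum_coef hq]
  refine Submodule.sum_mem _ fun a _ => ?_
  by_cases ha : coef hq (fun p => (a p : ℤ)) x = 0
  · simp [ha]
  refine Submodule.smul_mem _ _ ?_
  rw [show LinearMap.mulRight K y (mono q a) = LinearMap.mulLeft K (mono q a) y from rfl,
    map_eq_sum_coef hq]
  refine Submodule.sum_mem _ fun b _ => ?_
  by_cases hb : coef hq (fun p => (b p : ℤ)) y = 0
  · simp [hb]
  refine Submodule.smul_mem _ _ ?_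
  have h1 := wordProd_mem_leSpan hq (word a ++ word b)
  rw [wordProd_append, cnt_append, cnt_word, cnt_word] at h1
  refine leSpan_mono hq ?_ h1
  have := add_mem (hx _ ha) (hy _ hb)
  rwa [← add_sub_add_comm] at this

theorem Y_mem_leSpan (p : Fin n × Fin n) : Y q n p.1 p.2 ∈ leSpan hq (Pi.single p 1) := by
  have := wordProd_mem_leSpan hq (q := q) [p]
  simpa [cnt_cons, cnt_nil] using this

theorem eq_zero_of_mem_cone_of_neg_mem {z : Fin n × Fin n → ℤ} (h : z ∈ cone n)
    (h' : -z ∈ cone n) : z = 0 := by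
  by_contra h0
  have h1 := ht_pos h h0
  have h2 := ht_nonneg h'
  rw [← zero_sub, ht_sub] at h2
  simp [ht] at h1 h2
  omega

theorem coef_add_eq_zero {u z : Fin n × Fin n → ℤ} {x : QMat q n} (hx : x ∈ leSpan hq u)
    (hz : z ∈ cone n) (h0 : z ≠ 0) : coef hq (u + z) x = 0 := by
  by_contra h
  have := hx _ h
  rw [sub_add_cancel_left] at this
  exact h0 (eq_zero_of_mem_cone_of_neg_mem hz this)

theorem coef_mul_wordProd {u : Fin n × Fin n → ℤ} {x : QMat q n} (hx : x ∈ leSpan hq u)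
    (l : List (Fin n × Fin n)) : coef hq (u + cnt l) (x * wordProd (Y q n) l) =
      q ^ ((l.map (rightExp u)).sum + invExp l) * coef hq u x := by
  induction l using List.reverseRecOn with
  | nil => simp [cnt_nil, invExp]
  | append_singleton l r ih =>
    have h1 := mul_mem_leSpan hq hx (wordProd_mem_leSpan hq l)
    have h2 := coef_mul_Y hq (fun z hz h0 => coef_add_eq_zero hq h1 hz h0) r
    rw [wordProd_append, cnt_append, cnt_cons, cnt_nil, add_zero, ← add_assoc, wordProd_cons,
      wordProd_nil, mul_one, ← mul_assoc, h2, ih, ← mul_assoc, ← zpow_add₀ hq,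
      invExp_append_singleton, rightExp_add, List.map_append, List.sum_append]
    congr 2
    simp
    ring

end Support

/-! ### The leading term of the quantum determinant and its powers. -/

section Determinant

variable {n : ℕ}

/-- The exponent vector of the diagonal monomial. -/
def diagExp (n : ℕ) : Fin n × Fin n → ℤ := fun p => if p.1 = p.2 then 1 else 0

/-- The exponent vector of the monomial of a permutation. -/
def permExp (σ : Equiv.Perm (Fin n)) : Fin n × Fin n → ℤ := fun p => if σ p.1 = p.2 then 1 else 0

theorem permExp_one : permExp (1 : Equiv.Perm (Fin n)) = diagExp n := rfl

theorem permExp_injective : Function.Injective (permExp (n := n)) := by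
  intro σ τ h
  ext i
  have := congrFun h (i, τ i)
  simp only [permExp, if_true] at this
  by_contra h'
  rw [if_neg fun h'' => h' (by rw [h''])] at this
  simp at this

theorem diagExp_sub_permExp_mem (σ : Equiv.Perm (Fin n)) : diagExp n - permExp σ ∈ cone n := by
  obtain ⟨k, hk⟩ : ∃ k, σ.support.card = k := ⟨_, rfl⟩
  induction k using Nat.strong_induction_on generalizing σ with
  | _ k ih =>
  by_cases h1 : σ = 1
  · rw [h1, permExp_one, sub_self]
    exact zero_mem _
  have hne : σ.support.Nonempty := by
    rw [Finset.nonempty_iff_ne_empty]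
    exact fun h => h1 (Equiv.Perm.support_eq_empty_iff.1 h)
  obtain ⟨x, hx, hmin⟩ := Finset.exists_min_image σ.support id hne
  have hx' : σ x ≠ x := Equiv.Perm.mem_support.1 hx
  set y := σ⁻¹ x with hy
  have hσy : σ y = x := by simp [hy]
  have hyx : y ≠ x := fun h => hx' (by rw [← h, hσy, h])
  have hxy : x < y := lt_of_le_of_ne (hmin y (Equiv.Perm.mem_support.2 (by rw [hσy]; exact hyx.symm)))
    hyx.symm
  have hxs : x < σ x := lt_of_le_of_ne (hmin (σ x) (Equiv.Perm.mem_support.2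
    fun h => hx' (σ.injective h))) hx'.symm
  -- With `x` the least moved point, multiplication by the transposition of `x` and `σ x` makes `x`
  -- fixed and shrinks the support. It raises the exponent by the block with rows x, σ⁻¹ x and
  -- columns x, σ x; minimality of `x` orders both pairs correctly.
  have h2 := ih _ (hk ▸ Equiv.Perm.card_support_swap_mul hx') (Equiv.swap x (σ x) * σ) rfl
  have h3 : permExp (Equiv.swap x (σ x) * σ) - permExp σ = block x y x (σ x) := by
    have hs : ∀ i, i ≠ x → i ≠ y → (Equiv.swap x (σ x) * σ) i = σ i := fun i hi hi' =>
      Equiv.swap_apply_of_ne_of_ne (fun h => hi' (σ.injective (by rw [h, hσy])))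
        fun h => hi (σ.injective h)
    funext ⟨i, a⟩
    simp only [Pi.sub_apply, permExp, block, Pi.add_apply, Pi.single_apply, Prod.mk.injEq]
    by_cases hi : i = x
    · subst hi
      simp [hyx.symm, eq_comm (a := a)]
    · by_cases hi' : i = y
      · subst hi'
        simp [hyx, hσy, eq_comm (a := a)]
      · simp [hs i hi hi', hi, hi']
  have := add_mem h2 (block_mem_cone hxy hxs)
  rw [← h3] at this
  simpa using this

variable {K : Type*} [Field K] {q : K} (hq : q ≠ 0)

theorem cnt_ofFn (σ : Equiv.Perm (Fin n)) : cnt (List.ofFn fun i => (i, σ i)) = permExp σ := by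
  funext ⟨i, a⟩
  have hnd : (List.ofFn fun i => (i, σ i)).Nodup :=
    List.nodup_ofFn.2 fun i j h => (Prod.ext_iff.1 h).1
  rw [cnt, hnd.count, permExp]
  by_cases h : σ i = a
  · simp [h, List.mem_ofFn]
  · simp [h, List.mem_ofFn]

theorem detq_eq_sum : detq q n = ∑ σ : Equiv.Perm (Fin n),
    (-q) ^ len n σ • wordProd (Y q n) (List.ofFn fun i => (i, σ i)) := by
  refine Finset.sum_congr rfl fun σ _ => ?_
  rw [wordProd, List.map_ofFn]
  rfl

theorem wordProd_perm_mem_leSpan (σ : Equiv.Perm (Fin n)) :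
    wordProd (Y q n) (List.ofFn fun i => (i, σ i)) ∈ leSpan hq (permExp σ) :=
  cnt_ofFn σ ▸ wordProd_mem_leSpan hq _

theorem detq_mem_leSpan : detq q n ∈ leSpan hq (diagExp n) := by
  rw [detq_eq_sum]
  exact Submodule.sum_mem _ fun σ _ => Submodule.smul_mem _ _
    (leSpan_mono hq (diagExp_sub_permExp_mem σ) (wordProd_perm_mem_leSpan hq σ))

theorem detq_pow_mem_leSpan (m : ℕ) : detq q n ^ m ∈ leSpan hq (m • diagExp n) := by
  induction m with
  | zero =>
    have := wordProd_mem_leSpan (n := n) hq []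
    simpa [cnt_nil] using this
  | succ m ih =>
    rw [pow_succ, succ_nsmul]
    exact mul_mem_leSpan hq ih (detq_mem_leSpan hq)

theorem rightExp_smul (m : ℕ) (v : Fin n × Fin n → ℤ) (r : Fin n × Fin n) :
    rightExp (m • v) r = m * rightExp v r := by
  simp [rightExp, Finset.mul_sum, mul_assoc]

theorem rightExp_diagExp_self (k : Fin n) : rightExp (diagExp n) (k, k) = 0 := by
  refine Finset.sum_eq_zero fun s _ => ?_
  obtain ⟨i, a⟩ := s
  by_cases h : i = a
  · subst h
    by_cases h' : i = k
    · simp [h']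
    · simp [comm, h']
  · simp [diagExp, h]

/-- In multiplying by one more determinant only the identity permutation reaches the top exponent.
No power of q arises, since distinct diagonal positions share neither row nor column. -/
theorem coef_detq_pow (m : ℕ) : coef hq (m • diagExp n) (detq q n ^ m) = 1 := by
  induction m with
  | zero =>
    have := coef_cnt_wordProd (n := n) hq []
    simpa [cnt_nil, invExp] using this
  | succ m ih =>
    have h0 := detq_pow_mem_leSpan (n := n) hq m
    rw [pow_succ, succ_nsmul]
    generalize detq q n ^ m = x at h0 ih ⊢
    have h1 : ∀ σ : Equiv.Perm (Fin n), σ ≠ 1 → coef hq (m • diagExp n + diagExp n)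
        (x * wordProd (Y q n) (List.ofFn fun i => (i, σ i))) = 0 := by
      intro σ hσ
      have h2 := mul_mem_leSpan hq h0 (wordProd_perm_mem_leSpan hq σ)
      have h3 := coef_add_eq_zero hq h2 (diagExp_sub_permExp_mem σ) fun h =>
        hσ (permExp_injective (sub_eq_zero.1 h).symm)
      rwa [add_assoc, add_sub_cancel] at h3
    rw [detq_eq_sum, Finset.mul_sum, map_sum, Finset.sum_eq_single 1]
    · have h2 := coef_mul_wordProd hq h0 (List.ofFn fun i => (i, (1 : Equiv.Perm (Fin n)) i))
      have h3 : len n (1 : Equiv.Perm (Fin n)) = 0 := by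
        rw [len, Finset.card_eq_zero, Finset.filter_eq_empty_iff]
        rintro p - ⟨h, h'⟩
        exact absurd h' (by simpa using h.le)
      have h4 : invExp (List.ofFn fun i => (i, (1 : Equiv.Perm (Fin n)) i)) = 0 := by
        refine invExp_eq_zero ?_
        rw [List.pairwise_ofFn]
        intro i j hij
        exact (Prod.Lex.toLex_lt_toLex.2 (Or.inl hij)).le
      have h5 : ((List.ofFn fun i => (i, (1 : Equiv.Perm (Fin n)) i)).map
          (rightExp (m • diagExp n))).sum = 0 := by
        rw [List.map_ofFn, List.sum_ofFn]
        refine Finset.sum_eq_zero fun k _ => ?_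
        rw [Function.comp_apply, rightExp_smul, Equiv.Perm.one_apply, rightExp_diagExp_self,
          mul_zero]
      rw [cnt_ofFn, permExp_one, h4, h5, ih] at h2
      rw [h3, pow_zero, one_smul, h2]
      simp
    · intro σ _ hσ
      rw [mul_smul_comm, map_smul, h1 σ hσ, smul_zero]
    · simp

end Determinant

/-! ### Exponents whose monomials commute with the generators up to lower terms. -/

section Kernel

variable {n : ℕ}

/-- The contribution of one row to `eps`. -/
def rowEps (f : Fin n → ℤ) (a : Fin n) : ℤ := ∑ b, f b * sg a b

theorem eps_eq (v : Fin n × Fin n → ℤ) (i a : Fin n) :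
    eps (i, a) v = rowEps (fun b => v (i, b)) a + rowEps (fun j => v (j, a)) i := by
  simp only [eps, comm, mul_add, Finset.sum_add_distrib, rowEps, Fintype.sum_prod_type]
  congr 1
  · rw [Finset.sum_eq_single i]
    · simp
    · intro j _ hj
      simp [hj.symm]
    · simp
  · refine Finset.sum_congr rfl fun j _ => ?_
    rw [Finset.sum_eq_single a]
    · simp
    · intro b _ hb
      simp [hb.symm]
    · simp

theorem rowEps_sub (f : Fin n → ℤ) {a b : Fin n} (h : (b : ℕ) = a + 1) :
    rowEps f a - rowEps f b = f a + f b := by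
  have hab : a < b := by rw [Fin.lt_def]; omega
  rw [rowEps, rowEps, ← Finset.sum_sub_distrib]
  have : ∀ c, f c * sg a c - f c * sg b c =
      (if c = a then f a else 0) + (if c = b then f b else 0) := by
    intro c
    by_cases hca : c = a
    · subst hca
      simp [sg, hab, hab.ne, hab.not_gt]
    · by_cases hcb : c = b
      · subst hcb
        simp [sg, hab, hab.ne']
      · have : sg a c = sg b c := by
          have h1 : (c : ℕ) ≠ a := fun h => hca (Fin.ext h)
          have h2 : (c : ℕ) ≠ b := fun h => hcb (Fin.ext h)
          simp only [sg, Fin.lt_def]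
          split_ifs <;> omega
        simp [hca, hcb, this]
  simp [this, Finset.sum_add_distrib]

/-- Exponents of monomials that commute with all generators up to lower terms are constant along
diagonals. -/
theorem eq_of_eps_eq_zero {v : Fin n × Fin n → ℤ} (hv : ∀ p, eps p v = 0) {i j a b : Fin n}
    (hij : (j : ℕ) = i + 1) (hab : (b : ℕ) = a + 1) : v (i, a) = v (j, b) := by
  have h1 := hv (i, a)
  have h2 := hv (i, b)
  have h3 := hv (j, a)
  have h4 := hv (j, b)
  rw [eps_eq] at h1 h2 h3 h4
  -- In the alternating sum of `eps` over the four corners of the cell, the entries at (i,b) and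
  -- (j,a) cancel, and twice v(i,a) - v(j,b) remains.
  have e1 := rowEps_sub (fun b => v (i, b)) hab
  have e2 := rowEps_sub (fun b => v (j, b)) hab
  have e3 := rowEps_sub (fun j => v (j, a)) hij
  have e4 := rowEps_sub (fun j => v (j, b)) hij
  linarith

theorem eq_of_eps_eq_zero_add {v : Fin n × Fin n → ℤ} (hv : ∀ p, eps p v = 0) {i j a b : Fin n}
    {k : ℕ} (hij : (j : ℕ) = i + k) (hab : (b : ℕ) = a + k) : v (i, a) = v (j, b) := by
  induction k generalizing j b with
  | zero =>
    rw [Fin.ext hij, Fin.ext hab]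
  | succ k ih =>
    rw [ih (j := ⟨i + k, by omega⟩) (b := ⟨a + k, by omega⟩) rfl rfl]
    exact eq_of_eps_eq_zero hv (by simp; omega) (by simp; omega)

theorem rowEps_zero (f : Fin n → ℤ) {a : Fin n} (h : (a : ℕ) = 0) :
    rowEps f a = ∑ b, if b = a then 0 else f b := by
  refine Finset.sum_congr rfl fun b _ => ?_
  by_cases hb : b = a
  · simp [hb, sg]
  · have : a < b := by
      rw [Fin.lt_def]
      have : (b : ℕ) ≠ a := fun h => hb (Fin.ext h)
      omega
    simp [sg, hb, this]

/-- At the corner (0,0) the value of `eps` is the sum of the remaining entries of the first row and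
column. These are nonnegative, so all vanish, and constancy along diagonals leaves only the main
diagonal. -/
theorem eq_smul_diagExp {v : Fin n × Fin n → ℤ} (hv : ∀ p, eps p v = 0) (h0 : ∀ p, 0 ≤ v p) :
    ∃ m : ℕ, v = m • diagExp n := by
  rcases Nat.eq_zero_or_pos n with rfl | hn
  · exact ⟨0, funext fun p => p.1.elim0⟩
  set o : Fin n := ⟨0, hn⟩ with ho
  have h1 := hv (o, o)
  rw [eps_eq, rowEps_zero _ rfl, rowEps_zero _ rfl] at h1
  have hA : 0 ≤ ∑ b, if b = o then 0 else v (o, b) :=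
    Finset.sum_nonneg fun b _ => by split_ifs <;> simp [h0]
  have hB : 0 ≤ ∑ b, if b = o then 0 else v (b, o) :=
    Finset.sum_nonneg fun b _ => by split_ifs <;> simp [h0]
  have hA0 : ∀ b, b ≠ o → v (o, b) = 0 := by
    intro b hb
    have := (Finset.sum_eq_zero_iff_of_nonneg fun b _ => by split_ifs <;> simp [h0]).1
      (le_antisymm (by linarith) hA) b (Finset.mem_univ b)
    simpa [hb] using this
  have hB0 : ∀ b, b ≠ o → v (b, o) = 0 := by
    intro b hb
    have := (Finset.sum_eq_zero_iff_of_nonneg fun b _ => by split_ifs <;> simp [h0]).1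
      (le_antisymm (by linarith) hB) b (Finset.mem_univ b)
    simpa [hb] using this
  refine ⟨(v (o, o)).toNat, funext fun ⟨i, a⟩ => ?_⟩
  have hoo : ((v (o, o)).toNat : ℤ) = v (o, o) := Int.toNat_of_nonneg (h0 _)
  simp only [Pi.smul_apply, diagExp, nsmul_eq_mul, hoo]
  rcases le_total (i : ℕ) a with h | h
  · rw [← eq_of_eps_eq_zero_add hv (i := o) (a := ⟨a - i, by omega⟩) (k := i) (by simp [ho])
      (by simp; omega)]
    by_cases hia : i = a
    · subst hia
      simp [ho]
    · rw [hA0 _ fun h' => hia (Fin.ext (by simp [ho] at h'; omega))]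
      simp [hia]
  · rw [← eq_of_eps_eq_zero_add hv (i := ⟨i - a, by omega⟩) (a := o) (k := a) (by simp; omega)
      (by simp [ho])]
    by_cases hia : i = a
    · subst hia
      simp [ho]
    · rw [hB0 _ fun h' => hia (Fin.ext (by simp [ho] at h'; omega))]
      simp [hia]

theorem eps_transpose (v : Fin n × Fin n → ℤ) (p : Fin n × Fin n) :
    eps p.swap (fun s => v s.swap) = eps p v := by
  obtain ⟨i, a⟩ := p
  rw [Prod.swap_prod_mk, eps_eq, eps_eq, add_comm]
  rfl

theorem sum_eq_sum_succ_sub {f g : Fin n → ℤ} (h : ∀ i j : Fin n, (j : ℕ) = i + 1 → f i = g j)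
    {o t : Fin n} (ho : (o : ℕ) = 0) (ht : (t : ℕ) = n - 1) :
    ∑ i, f i - f t = ∑ i, g i - g o := by
  obtain ⟨N, rfl⟩ : ∃ N, n = N + 1 := ⟨n - 1, by have := o.2; omega⟩
  have ho' : o = 0 := Fin.ext ho
  have ht' : t = Fin.last N := Fin.ext ht
  subst ho' ht'
  rw [Fin.sum_univ_castSucc, Fin.sum_univ_succ]
  have : ∑ i : Fin N, f i.castSucc = ∑ i : Fin N, g i.succ :=
    Finset.sum_congr rfl fun i _ => h _ _ (by simp)
  linarith

/-- The wrap-around condition on exponents of monomials that commute with all generators up to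
lower terms. -/
theorem add_eq_zero_of_eps_eq_zero {v : Fin n × Fin n → ℤ} (hv : ∀ p, eps p v = 0)
    {o t a b : Fin n} (ho : (o : ℕ) = 0) (ht : (t : ℕ) = n - 1) (hab : (b : ℕ) = a + 1) :
    v (o, b) + v (t, a) = 0 := by
  have h1 := hv (o, a)
  have h2 := hv (o, b)
  rw [eps_eq] at h1 h2
  have e1 := rowEps_sub (fun b => v (o, b)) hab
  -- Column `b` is column `a` shifted down by one row, so the two column sums differ only through
  -- the entries v(t,a) and v(o,b).
  have e2 := sum_eq_sum_succ_sub (f := fun j => v (j, a)) (g := fun j => v (j, b))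
    (fun i j hij => eq_of_eps_eq_zero hv hij hab) ho ht
  have e3 : ∀ f : Fin n → ℤ, rowEps f o = ∑ i, f i - f o := by
    intro f
    rw [rowEps_zero _ ho, ← Finset.add_sum_erase _ f (Finset.mem_univ o),
      ← Finset.add_sum_erase _ _ (Finset.mem_univ o)]
    simp only [if_true, zero_add, add_sub_cancel_left]
    exact Finset.sum_congr rfl fun i hi => if_neg (Finset.ne_of_mem_erase hi)
  rw [e3 fun j => v (j, a)] at h1
  rw [e3 fun j => v (j, b)] at h2
  linarith

end Kernel

end QMatrix

end

noncomputable section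

namespace QMatrix

/-! ### The centre -/

/-! ### Finite lower closed sets of exponents and induction over them. -/

section LowerClosed

variable {n : ℕ}

/-- A finite set of exponents is lower closed if it contains all exponents with entries at least
`-1` that are lower than one of its elements. -/
def LowerClosed (W : Finset (Fin n × Fin n → ℤ)) : Prop :=
  ∀ w ∈ W, ∀ z ∈ cone n, (∀ p, -1 ≤ (w - z) p) → w - z ∈ W

/-- Subtracting an element of the cone preserves the sum of the entries, and entries bounded below
with fixed sum are bounded above; hence only finitely many exponents lie below a given one. -/
theorem exists_lowerClosed {S : Set (Fin n × Fin n → ℤ)} (hS : S.Finite) :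
    ∃ W : Finset (Fin n × Fin n → ℤ), S ⊆ W ∧ LowerClosed W := by
  set T : Set (Fin n × Fin n → ℤ) :=
    {x | ∃ w ∈ S, ∃ z ∈ cone n, x = w - z ∧ ∀ p, -1 ≤ x p} with hT
  have hfin : T.Finite := by
    refine (hS.biUnion fun w _ => Set.finite_Icc (fun _ : Fin n × Fin n => (-1 : ℤ))
      fun _ => ∑ p, w p + Fintype.card (Fin n × Fin n)).subset ?_
    rintro x ⟨w, hw, z, hz, rfl, hx⟩
    refine Set.mem_biUnion hw ⟨hx, fun p => ?_⟩
    have h1 := Finset.single_le_sum (f := fun p => (w - z) p + 1)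
      (fun p _ => by have := hx p; linarith) (Finset.mem_univ p)
    simp only [Pi.sub_apply, Finset.sum_add_distrib, Finset.sum_sub_distrib,
      sum_eq_zero_of_mem_cone hz, Finset.sum_const, Finset.card_univ, nsmul_eq_mul, mul_one,
      sub_zero] at h1 ⊢
    linarith
  refine ⟨(hS.union hfin).toFinset, fun w hw => by simp [hw], fun w hw z hz h => ?_⟩
  rw [Set.Finite.mem_toFinset] at hw ⊢
  rcases hw with hw | ⟨w', hw', z', hz', rfl, -⟩
  · exact Or.inr ⟨w, hw, z, hz, rfl, h⟩
  · exact Or.inr ⟨w', hw', z' + z, add_mem hz' hz, by abel, h⟩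

/-- Induction over lower closed sets by removal of maximal elements. -/
theorem LowerClosed.induction {P : Finset (Fin n × Fin n → ℤ) → Prop} (h0 : P ∅)
    (hs : ∀ W, LowerClosed W → ∀ v ∈ W, (∀ z ∈ cone n, z ≠ 0 → v + z ∉ W) →
      P (W.erase v) → P W) {W : Finset (Fin n × Fin n → ℤ)} (hW : LowerClosed W) : P W := by
  obtain ⟨k, hk⟩ : ∃ k, W.card = k := ⟨_, rfl⟩
  induction k generalizing W with
  | zero => rwa [Finset.card_eq_zero.1 hk]
  | succ k ih =>
    have hne : W.Nonempty := by
      rw [← Finset.card_pos]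
      omega
    obtain ⟨v, hv, hmax⟩ := Finset.exists_max_image W ht hne
    have htop : ∀ z ∈ cone n, z ≠ 0 → v + z ∉ W := fun z hz hz0 h => by
      have h1 := hmax _ h
      have h2 := ht_pos hz hz0
      rw [ht_add] at h1
      omega
    refine hs W hW v hv htop (ih (fun w hw z hz h => ?_) ?_)
    · refine Finset.mem_erase.2 ⟨fun h' => ?_, hW w (Finset.mem_of_mem_erase hw) z hz h⟩
      have hwv : w = v + z := by rw [← h']; abel
      by_cases hz0 : z = 0
      · rw [hz0, add_zero] at hwv
        exact Finset.ne_of_mem_erase hw hwv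
      · exact htop z hz hz0 (hwv ▸ Finset.mem_of_mem_erase hw)
    · rw [Finset.card_erase_of_mem hv]
      omega

end LowerClosed

/-! ### The centre as a polynomial ring in the quantum determinant. -/

section Center

variable {K : Type*} [Field K] {q : K} {n : ℕ}

theorem zpow_eq_one_iff_of_not_root (hq : ∀ m : ℕ, 0 < m → q ^ m ≠ 1) (k : ℤ) :
    q ^ k = 1 ↔ k = 0 := by
  refine ⟨fun h => ?_, fun h => by simp [h]⟩
  by_contra hk
  have hpos : 0 < k.natAbs := Int.natAbs_pos.2 hk
  refine hq _ hpos ?_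
  rcases Int.natAbs_eq k with h' | h'
  · rw [h', zpow_natCast] at h
    exact h
  · rw [h', zpow_neg, zpow_natCast, inv_eq_one] at h
    exact h

theorem smul_diagExp_apply (m : ℕ) (p : Fin n × Fin n) :
    (m • diagExp n) p = m * diagExp n p := by
  rw [Pi.smul_apply, nsmul_eq_mul]

variable (hq0 : q ≠ 0)

theorem coef_smul_diagExp_detq_pow (hn : 0 < n) (m k : ℕ) :
    coef hq0 (m • diagExp n) (detq q n ^ k) = if k = m then 1 else 0 := by
  split_ifs with h
  · rw [h, coef_detq_pow]
  · by_contra h'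
    have h1 := sum_eq_zero_of_mem_cone (detq_pow_mem_leSpan hq0 k _ h')
    have h2 : ∑ p, diagExp n p = n := by
      rw [Fintype.sum_prod_type]
      simp [diagExp]
    simp only [Pi.sub_apply, smul_diagExp_apply,
      ← Finset.mul_sum, h2, ← sub_mul] at h1
    rcases mul_eq_zero.1 h1 with h1 | h1 <;> omega

theorem coef_aeval_detq (hn : 0 < n) (f : Polynomial K) (m : ℕ) :
    coef hq0 (m • diagExp n) (Polynomial.aeval (detq q n) f) = f.coeff m := by
  rw [Polynomial.aeval_eq_sum_range, map_sum]
  simp only [map_smul, coef_smul_diagExp_detq_pow hq0 hn, smul_eq_mul, mul_ite, mul_one, mul_zero]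
  rw [Finset.sum_ite_eq' (Finset.range (f.natDegree + 1)) m]
  split_ifs with h
  · rfl
  · rw [Polynomial.coeff_eq_zero_of_natDegree_lt]
    simpa [Nat.lt_succ_iff] using h

theorem transcendental_detq (hq0 : q ≠ 0) (hn : 0 < n) : Transcendental K (detq q n) := by
  rw [transcendental_iff]
  intro f hf
  ext m
  rw [← coef_aeval_detq hq0 hn, hf, map_zero, Polynomial.coeff_zero]

/-- Comparison of the leading terms of Y_p x and x Y_p kills every `eps p` on a top exponent, which
is therefore m times the diagonal. Subtracting a multiple of the m-th power of the determinant
removes it from the support. -/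
theorem center_eq_adjoin (hq0 : q ≠ 0) (hq : ∀ m : ℕ, 0 < m → q ^ m ≠ 1) :
    Subalgebra.center K (QMat q n) = Algebra.adjoin K {detq q n} := by
  refine le_antisymm (fun x hx => ?_) (Algebra.adjoin_le ?_)
  · obtain ⟨W, hxW, hW⟩ := exists_lowerClosed (finite_coef_ne_zero hq0 x)
    replace hxW : ∀ w, coef hq0 w x ≠ 0 → w ∈ W := fun w hw => hxW hw
    revert x
    refine LowerClosed.induction (P := fun W => ∀ x ∈ Subalgebra.center K (QMat q n),
      (∀ w, coef hq0 w x ≠ 0 → w ∈ W) → x ∈ Algebra.adjoin K {detq q n}) ?_ ?_ hW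
    · intro x _ h
      have : x = 0 := eq_zero_of_coef hq0 fun w => by
        by_contra h'
        simpa using h w h'
      rw [this]
      exact zero_mem _
    · intro W hW v hv htop ih x hx hxW
      by_cases hc : coef hq0 v x = 0
      · exact ih x hx fun w hw => Finset.mem_erase.2 ⟨fun h => hw (h ▸ hc), hxW w hw⟩
      have htop' : ∀ z ∈ cone n, z ≠ 0 → coef hq0 (v + z) x = 0 := fun z hz h0 => by
        by_contra h
        exact htop z hz h0 (hxW _ h)
      have hnn : ∀ p, 0 ≤ v p := fun p => by
        by_contra! h
        exact hc (coef_eq_zero_of_neg hq0 h x)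
      have heps : ∀ p, eps p v = 0 := by
        intro p
        have h1 := coef_mul_Y hq0 htop' p
        rw [← Subalgebra.mem_center_iff.1 hx, coef_Y_mul hq0 htop' p, leftExp_eq,
          zpow_add₀ hq0, mul_assoc] at h1
        have h2 := mul_left_cancel₀ (zpow_ne_zero _ hq0) h1
        exact (zpow_eq_one_iff_of_not_root hq _).1 (mul_right_cancel₀ hc (by rw [h2, one_mul]))
      obtain ⟨m, rfl⟩ := eq_smul_diagExp heps hnn
      have hd : detq q n ^ m ∈ Algebra.adjoin K {detq q n} :=
        pow_mem (Algebra.self_mem_adjoin_singleton K _) m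
      have hdz : detq q n ^ m ∈ Subalgebra.center K (QMat q n) := pow_mem (detq_mem_center hq0) m
      have h1 := ih (x - coef hq0 (m • diagExp n) x • detq q n ^ m)
        (sub_mem hx (Subalgebra.smul_mem _ hdz _)) fun w hw => ?_
      · have := add_mem h1 (Subalgebra.smul_mem _ hd (coef hq0 (m • diagExp n) x))
        rwa [sub_add_cancel] at this
      · rw [map_sub, map_smul, smul_eq_mul] at hw
        refine Finset.mem_erase.2 ⟨fun h => hw (by rw [h, coef_detq_pow, mul_one, sub_self]), ?_⟩
        by_cases hxw : coef hq0 w x = 0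
        · have hdw : coef hq0 w (detq q n ^ m) ≠ 0 := fun h => hw (by rw [hxw, h]; simp)
          -- The exponents of the m-th power of the determinant are nonnegative and lie below the
          -- removed one, so lower closedness keeps them in `W`.
          have h2 := hW _ hv _ (detq_pow_mem_leSpan hq0 m _ hdw) fun p => ?_
          · rwa [sub_sub_cancel] at h2
          · rw [sub_sub_cancel]
            by_contra! h
            exact hdw (coef_eq_zero_of_neg hq0 (h.trans (by norm_num)) _)
        · exact hxW w hxw
  · rw [Set.singleton_subset_iff]
    exact detq_mem_center hq0

end Center

end QMatrix

end

noncomputable section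

namespace QMatrix

/-! ### Derivations of two by two quantum matrices -/

section QCommute

variable {K A : Type*} [CommSemiring K] [Semiring A] [Algebra K A] {t : K} {x y : A}

theorem pow_mul_of_qcomm (h : y * x = t • (x * y)) (k : ℕ) : y ^ k * x = t ^ k • (x * y ^ k) := by
  induction k with
  | zero => simp
  | succ k ih =>
    rw [pow_succ', mul_assoc, ih, mul_smul_comm, ← mul_assoc, h, smul_mul_assoc, smul_smul,
      mul_assoc, ← pow_succ]

theorem mul_pow_of_qcomm (h : y * x = t • (x * y)) (k : ℕ) : y * x ^ k = t ^ k • (x ^ k * y) := by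
  induction k with
  | zero => simp
  | succ k ih =>
    rw [pow_succ, ← mul_assoc, ih, smul_mul_assoc, mul_assoc, h, mul_smul_comm, smul_smul,
      mul_assoc, ← pow_succ]

end QCommute

theorem Der.map_mem_center {K A : Type*} [CommRing K] [Ring A] [Algebra K A] (D : Der K A) {x : A}
    (hx : x ∈ Subalgebra.center K A) : D x ∈ Subalgebra.center K A := by
  rw [Subalgebra.mem_center_iff] at hx ⊢
  intro y
  have h := congrArg D (hx y)
  rw [D.leibniz, D.leibniz, hx] at h
  rw [add_comm, add_right_cancel_iff] at h
  exact h

/-! ### Multiplication in the monomial basis a^i b^j c^k d^l. -/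

section TwoByTwo

variable {K : Type*} [Field K] {q : K}

/-- The exponent vector of `a ^ i * b ^ j * c ^ k * d ^ l`, where `a, b, c, d` are the entries of
a two by two matrix. -/
def exp2 (i j k l : ℕ) : Fin 2 × Fin 2 → ℕ := fun p => ![![i, j], ![k, l]] p.1 p.2

theorem exp2_eta (u : Fin 2 × Fin 2 → ℕ) : exp2 (u (0, 0)) (u (0, 1)) (u (1, 0)) (u (1, 1)) = u := by
  funext ⟨i, a⟩
  fin_cases i <;> fin_cases a <;> rfl

theorem exp2_inj {i j k l i' j' k' l' : ℕ} :
    exp2 i j k l = exp2 i' j' k' l' ↔ i = i' ∧ j = j' ∧ k = k' ∧ l = l' := by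
  constructor
  · intro h
    exact ⟨congrFun h (0, 0), congrFun h (0, 1), congrFun h (1, 0), congrFun h (1, 1)⟩
  · rintro ⟨rfl, rfl, rfl, rfl⟩
    rfl

theorem mono_exp2 (i j k l : ℕ) : mono q (exp2 i j k l) =
    Y q 2 0 0 ^ i * Y q 2 0 1 ^ j * Y q 2 1 0 ^ k * Y q 2 1 1 ^ l := by
  have : List.finRange 2 = [0, 1] := by decide
  simp [mono, word, this, wordProd, exp2, mul_assoc]

theorem Y00_mul_mono (i j k l : ℕ) :
    Y q 2 0 0 * mono q (exp2 i j k l) = mono q (exp2 (i + 1) j k l) := by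
  simp only [mono_exp2, pow_succ', mul_assoc]

theorem mono_mul_Y11 (i j k l : ℕ) :
    mono q (exp2 i j k l) * Y q 2 1 1 = mono q (exp2 i j k (l + 1)) := by
  simp only [mono_exp2, pow_succ, mul_assoc]

theorem Y01_mul_Y00 : Y q 2 0 1 * Y q 2 0 0 = q⁻¹ • (Y q 2 0 0 * Y q 2 0 1) :=
  (isQM_Y q 2).row 0 (by decide)

theorem Y10_mul_Y00 : Y q 2 1 0 * Y q 2 0 0 = q⁻¹ • (Y q 2 0 0 * Y q 2 1 0) :=
  (isQM_Y q 2).col 0 (by decide)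

theorem Y11_mul_Y01 : Y q 2 1 1 * Y q 2 0 1 = q⁻¹ • (Y q 2 0 1 * Y q 2 1 1) :=
  (isQM_Y q 2).col 1 (by decide)

theorem Y11_mul_Y10 : Y q 2 1 1 * Y q 2 1 0 = q⁻¹ • (Y q 2 1 0 * Y q 2 1 1) :=
  (isQM_Y q 2).row 1 (by decide)

theorem commute_Y10_Y01 : Commute (Y q 2 1 0) (Y q 2 0 1) :=
  (isQM_Y q 2).anti (by decide) (by decide)

theorem Y11_mul_Y00 : Y q 2 1 1 * Y q 2 0 0 =
    Y q 2 0 0 * Y q 2 1 1 - (q - q⁻¹) • (Y q 2 0 1 * Y q 2 1 0) :=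
  (isQM_Y q 2).diag (by decide) (by decide)

theorem Y01_mul_mono (i j k l : ℕ) :
    Y q 2 0 1 * mono q (exp2 i j k l) = q⁻¹ ^ i • mono q (exp2 i (j + 1) k l) := by
  simp only [mono_exp2, ← mul_assoc]
  rw [mul_pow_of_qcomm Y01_mul_Y00]
  simp only [smul_mul_assoc, mul_assoc, pow_succ']

theorem Y10_mul_mono (i j k l : ℕ) :
    Y q 2 1 0 * mono q (exp2 i j k l) = q⁻¹ ^ i • mono q (exp2 i j (k + 1) l) := by
  simp only [mono_exp2, ← mul_assoc]
  rw [mul_pow_of_qcomm Y10_mul_Y00]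
  simp only [smul_mul_assoc]
  rw [mul_assoc _ (Y q 2 1 0), (commute_Y10_Y01.pow_right j).eq]
  simp only [mul_assoc, pow_succ']

theorem mono_mul_Y10 (i j k l : ℕ) :
    mono q (exp2 i j k l) * Y q 2 1 0 = q⁻¹ ^ l • mono q (exp2 i j (k + 1) l) := by
  simp only [mono_exp2, mul_assoc]
  rw [pow_mul_of_qcomm Y11_mul_Y10]
  simp only [mul_smul_comm, ← mul_assoc, pow_succ]

theorem mono_mul_Y01 (i j k l : ℕ) :
    mono q (exp2 i j k l) * Y q 2 0 1 = q⁻¹ ^ l • mono q (exp2 i (j + 1) k l) := by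
  simp only [mono_exp2, mul_assoc]
  rw [pow_mul_of_qcomm Y11_mul_Y01]
  simp only [mul_smul_comm]
  rw [← mul_assoc (Y q 2 1 0 ^ k), (commute_Y10_Y01.pow_left k).eq]
  simp only [← mul_assoc, pow_succ]

theorem mono_mul_Y00_of_zero (i j k : ℕ) :
    mono q (exp2 i j k 0) * Y q 2 0 0 = q⁻¹ ^ (j + k) • mono q (exp2 (i + 1) j k 0) := by
  simp only [mono_exp2, pow_zero, mul_one, mul_assoc]
  rw [pow_mul_of_qcomm Y10_mul_Y00, mul_smul_comm, ← mul_assoc (Y q 2 0 1 ^ j),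
    pow_mul_of_qcomm Y01_mul_Y00]
  simp only [mul_smul_comm, smul_mul_assoc, smul_smul, pow_succ, mul_assoc, pow_add, mul_comm]

theorem Y11_pow_mul_Y00 (hq : q ≠ 0) (l : ℕ) : Y q 2 1 1 ^ (l + 1) * Y q 2 0 0 =
    Y q 2 0 0 * Y q 2 1 1 ^ (l + 1) -
      (q * (1 - q⁻¹ ^ (2 * (l + 1)))) • (Y q 2 0 1 * Y q 2 1 0 * Y q 2 1 1 ^ l) := by
  induction l with
  | zero =>
    have : q * (1 - q⁻¹ ^ (2 * (0 + 1))) = q - q⁻¹ := by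
      linear_combination (-q⁻¹) * mul_inv_cancel₀ hq
    rw [this]
    simpa using Y11_mul_Y00
  | succ l ih =>
    have h1 : Y q 2 1 1 * (Y q 2 0 1 * Y q 2 1 0) = (q⁻¹ * q⁻¹) •
        (Y q 2 0 1 * Y q 2 1 0 * Y q 2 1 1) := by
      rw [← mul_assoc, Y11_mul_Y01, smul_mul_assoc, mul_assoc, Y11_mul_Y10, mul_smul_comm,
        smul_smul, mul_assoc]
    rw [pow_succ' _ (l + 1), mul_assoc, ih, mul_sub, ← mul_assoc, Y11_mul_Y00, mul_smul_comm,
      ← mul_assoc (Y q 2 1 1), h1, sub_mul, smul_mul_assoc, smul_mul_assoc, smul_smul, sub_sub,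
      mul_assoc _ (Y q 2 1 1) (Y q 2 1 1 ^ l), ← pow_succ', ← add_smul, mul_assoc]
    congr 2
    rw [show 2 * (l + 1 + 1) = 2 * (l + 1) + 2 by ring, pow_add]
    linear_combination q⁻¹ * mul_inv_cancel₀ hq

theorem mono_mul_Y00_of_succ (hq : q ≠ 0) (i j k l : ℕ) :
    mono q (exp2 i j k (l + 1)) * Y q 2 0 0 =
      q⁻¹ ^ (j + k) • mono q (exp2 (i + 1) j k (l + 1)) -
        (q * (1 - q⁻¹ ^ (2 * (l + 1)))) • mono q (exp2 i (j + 1) (k + 1) l) := by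
  have h1 := mono_mul_Y00_of_zero (q := q) i j k
  have h2 := mono_mul_Y01 (q := q) i j k 0
  have h3 := mono_mul_Y10 (q := q) i (j + 1) k 0
  have h4 : ∀ i j k l, mono q (exp2 i j k l) = mono q (exp2 i j k 0) * Y q 2 1 1 ^ l := by
    intro i j k l
    simp [mono_exp2]
  rw [h4 i, h4 (i + 1), h4 i (j + 1), mul_assoc, Y11_pow_mul_Y00 hq, mul_sub, ← mul_assoc, h1,
    mul_smul_comm, smul_mul_assoc, ← mul_assoc, ← mul_assoc, h2]
  simp only [pow_zero, one_smul] at h3 ⊢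
  rw [h3]

theorem detq_two : detq q 2 = Y q 2 0 0 * Y q 2 1 1 - q • (Y q 2 0 1 * Y q 2 1 0) := by
  have h : (Finset.univ : Finset (Equiv.Perm (Fin 2))) = {1, Equiv.swap 0 1} := by decide
  have h1 : len 2 1 = 0 := by decide
  have h2 : len 2 (Equiv.swap 0 1) = 1 := by decide
  rw [detq, h, Finset.sum_pair (by decide), h1, h2]
  simp [sub_eq_add_neg]

variable (hq : q ≠ 0)

/-- The coefficient of `a ^ i * b ^ j * c ^ k * d ^ l`. -/
def coef2 (i j k l : ℕ) : QMat q 2 →ₗ[K] K := coef hq fun p => (exp2 i j k l p : ℤ)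

theorem coef2_mono (i j k l i' j' k' l' : ℕ) : coef2 hq i j k l (mono q (exp2 i' j' k' l')) =
    if i = i' ∧ j = j' ∧ k = k' ∧ l = l' then 1 else 0 := by
  rw [coef2, coef_mono]
  congr 1
  rw [← exp2_inj, eq_iff_iff]
  constructor
  · intro h
    funext p
    exact_mod_cast congrFun h p
  · intro h
    rw [h]

theorem linearMap_ext_two (hq : q ≠ 0) {M : Type*} [AddCommMonoid M] [Module K M]
    {f g : QMat q 2 →ₗ[K] M}
    (h : ∀ i j k l, f (mono q (exp2 i j k l)) = g (mono q (exp2 i j k l))) : f = g := by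
  refine (monoBasis hq 2).ext fun u => ?_
  rw [monoBasis_apply, ← exp2_eta u]
  exact h _ _ _ _

theorem coef2_Y00_mul (i j k l : ℕ) (x : QMat q 2) :
    coef2 hq (i + 1) j k l (Y q 2 0 0 * x) = coef2 hq i j k l x := by
  refine LinearMap.congr_fun (f := (coef2 hq (i + 1) j k l).comp (LinearMap.mulLeft K (Y q 2 0 0)))
    (linearMap_ext_two hq fun i' j' k' l' => ?_) x
  simp [Y00_mul_mono, coef2_mono]

theorem coef2_zero_Y00_mul (j k l : ℕ) (x : QMat q 2) :
    coef2 hq 0 j k l (Y q 2 0 0 * x) = 0 := by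
  refine LinearMap.congr_fun (f := (coef2 hq 0 j k l).comp (LinearMap.mulLeft K (Y q 2 0 0)))
    (g := 0) (linearMap_ext_two hq fun i' j' k' l' => ?_) x
  simp [Y00_mul_mono, coef2_mono]

theorem coef2_mul_Y11 (i j k l : ℕ) (x : QMat q 2) :
    coef2 hq i j k (l + 1) (x * Y q 2 1 1) = coef2 hq i j k l x := by
  refine LinearMap.congr_fun (f := (coef2 hq i j k (l + 1)).comp (LinearMap.mulRight K (Y q 2 1 1)))
    (linearMap_ext_two hq fun i' j' k' l' => ?_) x
  simp [mono_mul_Y11, coef2_mono]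

theorem coef2_zero_mul_Y11 (i j k : ℕ) (x : QMat q 2) :
    coef2 hq i j k 0 (x * Y q 2 1 1) = 0 := by
  refine LinearMap.congr_fun (f := (coef2 hq i j k 0).comp (LinearMap.mulRight K (Y q 2 1 1)))
    (g := 0) (linearMap_ext_two hq fun i' j' k' l' => ?_) x
  simp [mono_mul_Y11, coef2_mono]

theorem coef2_mul_Y10 (i j k l : ℕ) (x : QMat q 2) :
    coef2 hq i j (k + 1) l (x * Y q 2 1 0) = q⁻¹ ^ l * coef2 hq i j k l x := by
  refine LinearMap.congr_fun (f := (coef2 hq i j (k + 1) l).comp (LinearMap.mulRight K (Y q 2 1 0)))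
    (g := q⁻¹ ^ l • coef2 hq i j k l) (linearMap_ext_two hq fun i' j' k' l' => ?_) x
  simp only [LinearMap.comp_apply, LinearMap.mulRight_apply, mono_mul_Y10, map_smul, coef2_mono,
    LinearMap.smul_apply, add_left_inj]
  split_ifs with h
  · rw [h.2.2.2]
  · simp

theorem coef2_zero_mul_Y10 (i j l : ℕ) (x : QMat q 2) :
    coef2 hq i j 0 l (x * Y q 2 1 0) = 0 := by
  refine LinearMap.congr_fun (f := (coef2 hq i j 0 l).comp (LinearMap.mulRight K (Y q 2 1 0)))
    (g := 0) (linearMap_ext_two hq fun i' j' k' l' => ?_) x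
  simp [mono_mul_Y10, coef2_mono]

theorem coef2_mul_Y01 (i j k l : ℕ) (x : QMat q 2) :
    coef2 hq i (j + 1) k l (x * Y q 2 0 1) = q⁻¹ ^ l * coef2 hq i j k l x := by
  refine LinearMap.congr_fun (f := (coef2 hq i (j + 1) k l).comp (LinearMap.mulRight K (Y q 2 0 1)))
    (g := q⁻¹ ^ l • coef2 hq i j k l) (linearMap_ext_two hq fun i' j' k' l' => ?_) x
  simp only [LinearMap.comp_apply, LinearMap.mulRight_apply, mono_mul_Y01, map_smul, coef2_mono,
    LinearMap.smul_apply, add_left_inj]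
  split_ifs with h
  · rw [h.2.2.2]
  · simp

theorem coef2_zero_mul_Y01 (i k l : ℕ) (x : QMat q 2) :
    coef2 hq i 0 k l (x * Y q 2 0 1) = 0 := by
  refine LinearMap.congr_fun (f := (coef2 hq i 0 k l).comp (LinearMap.mulRight K (Y q 2 0 1)))
    (g := 0) (linearMap_ext_two hq fun i' j' k' l' => ?_) x
  simp [mono_mul_Y01, coef2_mono]

theorem coef2_Y01_mul (i j k l : ℕ) (x : QMat q 2) :
    coef2 hq i (j + 1) k l (Y q 2 0 1 * x) = q⁻¹ ^ i * coef2 hq i j k l x := by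
  refine LinearMap.congr_fun (f := (coef2 hq i (j + 1) k l).comp (LinearMap.mulLeft K (Y q 2 0 1)))
    (g := q⁻¹ ^ i • coef2 hq i j k l) (linearMap_ext_two hq fun i' j' k' l' => ?_) x
  simp only [LinearMap.comp_apply, LinearMap.mulLeft_apply, Y01_mul_mono, map_smul, coef2_mono,
    LinearMap.smul_apply, add_left_inj]
  split_ifs with h
  · rw [h.1]
  · simp

theorem coef2_zero_Y01_mul (i k l : ℕ) (x : QMat q 2) :
    coef2 hq i 0 k l (Y q 2 0 1 * x) = 0 := by
  refine LinearMap.congr_fun (f := (coef2 hq i 0 k l).comp (LinearMap.mulLeft K (Y q 2 0 1)))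
    (g := 0) (linearMap_ext_two hq fun i' j' k' l' => ?_) x
  simp [Y01_mul_mono, coef2_mono]

theorem coef2_Y10_mul (i j k l : ℕ) (x : QMat q 2) :
    coef2 hq i j (k + 1) l (Y q 2 1 0 * x) = q⁻¹ ^ i * coef2 hq i j k l x := by
  refine LinearMap.congr_fun (f := (coef2 hq i j (k + 1) l).comp (LinearMap.mulLeft K (Y q 2 1 0)))
    (g := q⁻¹ ^ i • coef2 hq i j k l) (linearMap_ext_two hq fun i' j' k' l' => ?_) x
  simp only [LinearMap.comp_apply, LinearMap.mulLeft_apply, Y10_mul_mono, map_smul, coef2_mono,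
    LinearMap.smul_apply, add_left_inj]
  split_ifs with h
  · rw [h.1]
  · simp

theorem coef2_zero_Y10_mul (i j l : ℕ) (x : QMat q 2) :
    coef2 hq i j 0 l (Y q 2 1 0 * x) = 0 := by
  refine LinearMap.congr_fun (f := (coef2 hq i j 0 l).comp (LinearMap.mulLeft K (Y q 2 1 0)))
    (g := 0) (linearMap_ext_two hq fun i' j' k' l' => ?_) x
  simp [Y10_mul_mono, coef2_mono]

/-- Moving `a` to the left past a power of `d` creates a single remainder, in which one `d` is
replaced by `b c`. This is the second term. -/
theorem coef2_mul_Y00 (i j k l : ℕ) (x : QMat q 2) :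
    coef2 hq (i + 1) (j + 1) (k + 1) l (x * Y q 2 0 0) =
      q⁻¹ ^ (j + k + 2) * coef2 hq i (j + 1) (k + 1) l x -
        q * (1 - q⁻¹ ^ (2 * (l + 1))) * coef2 hq (i + 1) j k (l + 1) x := by
  refine LinearMap.congr_fun
    (f := (coef2 hq (i + 1) (j + 1) (k + 1) l).comp (LinearMap.mulRight K (Y q 2 0 0)))
    (g := q⁻¹ ^ (j + k + 2) • coef2 hq i (j + 1) (k + 1) l -
      (q * (1 - q⁻¹ ^ (2 * (l + 1)))) • coef2 hq (i + 1) j k (l + 1))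
    (linearMap_ext_two hq fun i' j' k' l' => ?_) x
  simp only [LinearMap.comp_apply, LinearMap.mulRight_apply, LinearMap.sub_apply,
    LinearMap.smul_apply, coef2_mono, smul_eq_mul]
  rcases l' with _ | l'
  · rw [mono_mul_Y00_of_zero, map_smul, coef2_mono]
    by_cases h : i = i' ∧ j + 1 = j' ∧ k + 1 = k' ∧ l = 0
    · obtain ⟨rfl, rfl, rfl, rfl⟩ := h
      simp
      ring
    · simp [h]
  · rw [mono_mul_Y00_of_succ hq, map_sub, map_smul, map_smul, coef2_mono, coef2_mono]
    congr 1
    · by_cases h : i = i' ∧ j + 1 = j' ∧ k + 1 = k' ∧ l = l' + 1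
      · obtain ⟨rfl, rfl, rfl, rfl⟩ := h
        simp
        ring
      · simp [h]
    · by_cases h : i + 1 = i' ∧ j = j' ∧ k = k' ∧ l = l'
      · obtain ⟨rfl, rfl, rfl, rfl⟩ := h
        simp
      · simp [h]

/-- The remainder always contains both `b` and `c`, so it does not contribute here. -/
theorem coef2_mul_Y00_of_eq_zero (i j k l : ℕ) (h0 : j = 0 ∨ k = 0) (x : QMat q 2) :
    coef2 hq (i + 1) j k l (x * Y q 2 0 0) = q⁻¹ ^ (j + k) * coef2 hq i j k l x := by
  refine LinearMap.congr_fun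
    (f := (coef2 hq (i + 1) j k l).comp (LinearMap.mulRight K (Y q 2 0 0)))
    (g := q⁻¹ ^ (j + k) • coef2 hq i j k l)
    (linearMap_ext_two hq fun i' j' k' l' => ?_) x
  simp only [LinearMap.comp_apply, LinearMap.mulRight_apply, LinearMap.smul_apply, coef2_mono,
    smul_eq_mul]
  rcases l' with _ | l'
  · rw [mono_mul_Y00_of_zero, map_smul, coef2_mono]
    by_cases h : i = i' ∧ j = j' ∧ k = k' ∧ l = 0
    · obtain ⟨rfl, rfl, rfl, rfl⟩ := h
      simp
    · simp [h]
  · rw [mono_mul_Y00_of_succ hq, map_sub, map_smul, map_smul, coef2_mono, coef2_mono,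
      if_neg (c := i + 1 = i' ∧ j = j' + 1 ∧ k = k' + 1 ∧ l = l') (by omega), smul_zero, sub_zero]
    by_cases h : i = i' ∧ j = j' ∧ k = k' ∧ l = l' + 1
    · obtain ⟨rfl, rfl, rfl, rfl⟩ := h
      simp
    · simp [h]

/-- By centrality det^(s+1) = a det^s d - q det^s b c. The first term has no monomial free of `a`,
so on monomials in `b` and `c` alone each factor det acts as -q b c. -/
theorem coef2_detq_pow (s j k : ℕ) :
    coef2 hq 0 j k 0 (detq q 2 ^ s) = if j = s ∧ k = s then (-q) ^ s else 0 := by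
  induction s generalizing j k with
  | zero =>
    have h : (1 : QMat q 2) = mono q (exp2 0 0 0 0) := by simp [mono_exp2]
    simp [h, coef2_mono]
  | succ s ih =>
    have hd : detq q 2 ^ (s + 1) = Y q 2 0 0 * (detq q 2 ^ s * Y q 2 1 1) -
        q • (detq q 2 ^ s * Y q 2 0 1 * Y q 2 1 0) := by
      have h : detq q 2 ^ (s + 1) =
          detq q 2 ^ s * (Y q 2 0 0 * Y q 2 1 1 - q • (Y q 2 0 1 * Y q 2 1 0)) := by
        rw [pow_succ, ← detq_two]
      rw [← mul_assoc (Y q 2 0 0),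
        Subalgebra.mem_center_iff.1 (pow_mem (detq_mem_center hq) s) (Y q 2 0 0), h]
      simp only [mul_sub, mul_smul_comm, mul_assoc]
    rw [hd, map_sub, coef2_zero_Y00_mul, map_smul, zero_sub]
    rcases k with _ | k
    · simp [coef2_zero_mul_Y10]
    rcases j with _ | j
    · simp [coef2_mul_Y10, coef2_zero_mul_Y01]
    rw [coef2_mul_Y10, coef2_mul_Y01, ih]
    by_cases h : j = s ∧ k = s
    · simp [h]
      ring
    · simp [h]

/-! ### Coefficient recursion along monomials with equal powers of a and d. -/

section ARel

variable {x : QMat q 2}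
  (hx : ∀ l j k, coef2 hq (l + 1) j k l (Y q 2 0 0 * x - q • (x * Y q 2 0 0)) = 0)

include hx

/-- The hypothesis is tailored to the values of a derivation at `b` and `c`, see `coef2_der_Y01` and
`coef2_der_Y10`. It lets powers of b c be traded for powers of a and d. -/
theorem coef2_recursion (l j k : ℕ) :
    (1 - q⁻¹ ^ (j + k + 1)) * coef2 hq l (j + 1) (k + 1) l x =
      -q ^ 2 * ((1 - q⁻¹ ^ (2 * (l + 1))) * coef2 hq (l + 1) j k (l + 1) x) := by
  have h := hx l (j + 1) (k + 1)
  rw [map_sub, coef2_Y00_mul, map_smul, coef2_mul_Y00, smul_eq_mul] at h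
  have h2 : q * q⁻¹ ^ (j + k + 2) = q⁻¹ ^ (j + k + 1) := by
    rw [pow_succ' _ (j + k + 1), ← mul_assoc, mul_inv_cancel₀ hq, one_mul]
  linear_combination h + coef2 hq l (j + 1) (k + 1) l x * h2

variable (hroot : ∀ m : ℕ, 0 < m → q ^ m ≠ 1)

include hroot

omit hx hq in
theorem one_sub_inv_pow_ne_zero {k : ℕ} (hk : 0 < k) : 1 - q⁻¹ ^ k ≠ 0 := by
  rw [sub_ne_zero, inv_pow, ne_comm, ne_eq, inv_eq_one]
  exact hroot k hk

/-- The recursion reduces to `j = 0` or `k = 0`. There the hypothesis reads (1 - q^(1-j-k)) times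
the coefficient equals 0, and j + k ≥ 2 makes the factor nonzero. -/
theorem coef2_eq_zero_of_le {l j k : ℕ} (h : j + 2 ≤ k ∨ k + 2 ≤ j) :
    coef2 hq l j k l x = 0 := by
  have key : ∀ l j k, (j = 0 ∨ k = 0) → 2 ≤ j + k → coef2 hq l j k l x = 0 := by
    intro l j k h0 h2
    have h := hx l j k
    rw [map_sub, coef2_Y00_mul, map_smul, coef2_mul_Y00_of_eq_zero hq _ _ _ _ h0,
      smul_eq_mul] at h
    obtain ⟨s, hs⟩ : ∃ s, j + k = s + 2 := ⟨j + k - 2, by omega⟩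
    have h3 : q * q⁻¹ ^ (j + k) = q⁻¹ ^ (s + 1) := by
      rw [hs, pow_succ' _ (s + 1), ← mul_assoc, mul_inv_cancel₀ hq, one_mul]
    have h4 : (1 - q⁻¹ ^ (s + 1)) * coef2 hq l j k l x = 0 := by
      linear_combination h + coef2 hq l j k l x * h3
    exact (mul_eq_zero.1 h4).resolve_left (one_sub_inv_pow_ne_zero hroot (by omega))
  induction j generalizing l k with
  | zero => exact key l 0 k (Or.inl rfl) (by omega)
  | succ j ih =>
    rcases k with _ | k
    · exact key l (j + 1) 0 (Or.inr rfl) (by omega)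
    · have h1 := coef2_recursion hq hx l j k
      rw [ih (by omega), mul_zero, mul_zero] at h1
      exact (mul_eq_zero.1 h1).resolve_left (one_sub_inv_pow_ne_zero hroot (by omega))

omit hx hroot hq in
/-- A telescoping identity of `q`-binomial type. -/
theorem eq_pow_mul_of_recursion {w : ℕ → K} (hw : ∀ k, 0 < k → w k ≠ 0) {r : K} {g : ℕ → K}
    {m : ℕ} (h : ∀ l < m, w (m - l) * g l = r * (w (l + 1) * g (l + 1))) : g 0 = r ^ m * g m := by
  have key : ∀ l ≤ m, (∏ i ∈ Finset.range l, w (m - i)) * g 0 =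
      r ^ l * ((∏ i ∈ Finset.range l, w (i + 1)) * g l) := by
    intro l hl
    induction l with
    | zero => simp
    | succ l ih =>
      rw [Finset.prod_range_succ, Finset.prod_range_succ]
      linear_combination w (m - l) * ih (by omega) +
        r ^ l * (∏ i ∈ Finset.range l, w (i + 1)) * h l (by omega)
  have h1 := key m le_rfl
  -- Over the full range both products run through w 1, ..., w m in opposite orders, so they cancel.
  have h2 : ∏ i ∈ Finset.range m, w (m - i) = ∏ i ∈ Finset.range m, w (i + 1) := by
    rw [← Finset.prod_range_reflect]
    refine Finset.prod_congr rfl fun i hi => ?_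
    rw [Finset.mem_range] at hi
    congr 1
    omega
  have h3 : ∏ i ∈ Finset.range m, w (i + 1) ≠ 0 :=
    Finset.prod_ne_zero_iff.2 fun i _ => hw _ (by omega)
  rw [h2] at h1
  exact mul_left_cancel₀ h3 (by linear_combination h1)

/-- Along this family the exponent j + k + 1 in the recursion is 2(m - l), so both factors are
values of the same sequence w k = 1 - q^(-2k) and the recursion telescopes. -/
theorem coef2_succ_left (m : ℕ) :
    coef2 hq 0 (m + 1) m 0 x = (-q ^ 2) ^ m * coef2 hq m 1 0 m x := by
  have := eq_pow_mul_of_recursion (w := fun k => 1 - q⁻¹ ^ (2 * k)) (r := -q ^ 2) (m := m)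
    (g := fun l => coef2 hq l (m - l + 1) (m - l) l x)
    (fun k hk => one_sub_inv_pow_ne_zero hroot (by omega)) fun l hl => ?_
  · simpa using this
  · obtain ⟨s, rfl⟩ : ∃ s, m = l + s + 1 := ⟨m - l - 1, by omega⟩
    have h1 := coef2_recursion hq hx l (s + 1) s
    rw [show l + s + 1 - l = s + 1 by omega, show l + s + 1 - (l + 1) = s by omega]
    rw [show 2 * (s + 1) = s + 1 + s + 1 by ring]
    exact h1

theorem coef2_succ_right (m : ℕ) :
    coef2 hq 0 m (m + 1) 0 x = (-q ^ 2) ^ m * coef2 hq m 0 1 m x := by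
  have := eq_pow_mul_of_recursion (w := fun k => 1 - q⁻¹ ^ (2 * k)) (r := -q ^ 2) (m := m)
    (g := fun l => coef2 hq l (m - l) (m - l + 1) l x)
    (fun k hk => one_sub_inv_pow_ne_zero hroot (by omega)) fun l hl => ?_
  · simpa using this
  · obtain ⟨s, rfl⟩ : ∃ s, m = l + s + 1 := ⟨m - l - 1, by omega⟩
    have h1 := coef2_recursion hq hx l s (s + 1)
    rw [show l + s + 1 - l = s + 1 by omega, show l + s + 1 - (l + 1) = s by omega]
    rw [show 2 * (s + 1) = s + (s + 1) + 1 by ring]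
    exact h1

end ARel

/-! ### Consequences of D(det) being a polynomial in det. -/

section Derivation

variable (D : Der K (QMat q 2))

/-- Differentiating ab = q ba turns the expression into q b D(a) - D(a) b. At a^(l+1) b^j c^k d^l,
moving `b` in from the left costs q^(-(l+1)) and from the right q^(-l), so the two coefficients
cancel. -/
theorem coef2_der_Y01 (l j k : ℕ) : coef2 hq (l + 1) j k l
    (Y q 2 0 0 * D (Y q 2 0 1) - q • (D (Y q 2 0 1) * Y q 2 0 0)) = 0 := by
  have h := congrArg (fun y => D (q • y)) (Y01_mul_Y00 (q := q))
  simp only [smul_smul, mul_inv_cancel₀ hq, one_smul, map_smul, Der.leibniz] at h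
  have h2 : Y q 2 0 0 * D (Y q 2 0 1) - q • (D (Y q 2 0 1) * Y q 2 0 0) =
      q • (Y q 2 0 1 * D (Y q 2 0 0)) - D (Y q 2 0 0) * Y q 2 0 1 := by
    rw [smul_add] at h
    rw [sub_eq_sub_iff_add_eq_add, add_comm _ (D (Y q 2 0 0) * _), ← h, add_comm]
  rw [h2, map_sub, map_smul]
  rcases j with _ | j
  · simp [coef2_zero_mul_Y01, coef2_zero_Y01_mul]
  · rw [coef2_mul_Y01, coef2_Y01_mul, smul_eq_mul, pow_succ', ← mul_assoc, ← mul_assoc,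
      mul_inv_cancel₀ hq, one_mul, sub_self]

theorem coef2_der_Y10 (l j k : ℕ) : coef2 hq (l + 1) j k l
    (Y q 2 0 0 * D (Y q 2 1 0) - q • (D (Y q 2 1 0) * Y q 2 0 0)) = 0 := by
  have h := congrArg (fun y => D (q • y)) (Y10_mul_Y00 (q := q))
  simp only [smul_smul, mul_inv_cancel₀ hq, one_smul, map_smul, Der.leibniz] at h
  have h2 : Y q 2 0 0 * D (Y q 2 1 0) - q • (D (Y q 2 1 0) * Y q 2 0 0) =
      q • (Y q 2 1 0 * D (Y q 2 0 0)) - D (Y q 2 0 0) * Y q 2 1 0 := by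
    rw [smul_add] at h
    rw [sub_eq_sub_iff_add_eq_add, add_comm _ (D (Y q 2 0 0) * _), ← h, add_comm]
  rw [h2, map_sub, map_smul]
  rcases k with _ | k
  · simp [coef2_zero_mul_Y10, coef2_zero_Y10_mul]
  · rw [coef2_mul_Y10, coef2_Y10_mul, smul_eq_mul, pow_succ', ← mul_assoc, ← mul_assoc,
      mul_inv_cancel₀ hq, one_mul, sub_self]

theorem der_detq_two : D (detq q 2) = D (Y q 2 0 0) * Y q 2 1 1 + Y q 2 0 0 * D (Y q 2 1 1) -
    q • (D (Y q 2 0 1) * Y q 2 1 0 + Y q 2 0 1 * D (Y q 2 1 0)) := by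
  rw [detq_two, map_sub, map_smul, Der.leibniz, Der.leibniz]

theorem coef2_aeval_detq (f : Polynomial K) (j k : ℕ) :
    coef2 hq 0 j k 0 (Polynomial.aeval (detq q 2) f) =
      if j = k then f.coeff j * (-q) ^ j else 0 := by
  rw [Polynomial.aeval_eq_sum_range, map_sum]
  simp only [map_smul, coef2_detq_pow, smul_eq_mul]
  split_ifs with h
  · subst h
    simp only [and_self, mul_ite, mul_zero]
    rw [Finset.sum_ite_eq (Finset.range (f.natDegree + 1)) j]
    split_ifs with h
    · rfl
    · rw [Polynomial.coeff_eq_zero_of_natDegree_lt, zero_mul]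
      simpa [Nat.lt_succ_iff] using h
  · refine Finset.sum_eq_zero fun s _ => ?_
    rw [if_neg (by omega), mul_zero]

variable (hroot : ∀ m : ℕ, 0 < m → q ^ m ≠ 1)

include hroot

theorem exists_der_detq {n : ℕ} (hq : q ≠ 0) (D : Der K (QMat q n)) :
    ∃ f : Polynomial K, D (detq q n) = Polynomial.aeval (detq q n) f := by
  have h := D.map_mem_center (detq_mem_center hq)
  rw [center_eq_adjoin hq hroot, Algebra.adjoin_singleton_eq_range_aeval] at h
  obtain ⟨f, hf⟩ := h
  exact ⟨f, hf.symm⟩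

/-- The polynomial D(det) has no monomial b^m c^(m+2). There only D(b) c can contribute, since the
coefficient needed from D(c) vanishes by `coef2_eq_zero_of_le`, and telescoping carries the result
back to a^m c d^m. The other half is symmetric in b and c. -/
theorem coef2_der_corner (m : ℕ) :
    coef2 hq m 0 1 m (D (Y q 2 0 1)) = 0 ∧ coef2 hq m 1 0 m (D (Y q 2 1 0)) = 0 := by
  obtain ⟨f, hf⟩ := exists_der_detq hroot hq D
  rw [der_detq_two] at hf
  have hb := coef2_der_Y01 hq D
  have hc := coef2_der_Y10 hq D
  have hq2 : (-q ^ 2) ^ m ≠ 0 := pow_ne_zero _ (neg_ne_zero.2 (pow_ne_zero _ hq))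
  constructor
  · have h := congrArg (coef2 hq 0 m (m + 2) 0) hf
    rw [coef2_aeval_detq hq, if_neg (by omega), map_sub, map_add, coef2_zero_mul_Y11,
      coef2_zero_Y00_mul, map_smul, map_add, coef2_mul_Y10, coef2_succ_right hq hb hroot] at h
    have h0 : coef2 hq 0 m (m + 2) 0 (Y q 2 0 1 * D (Y q 2 1 0)) = 0 := by
      rcases m with _ | m
      · rw [coef2_zero_Y01_mul]
      · rw [coef2_Y01_mul, coef2_eq_zero_of_le hq hc hroot (by omega), mul_zero]
    rw [h0] at h
    simpa [hq] using h
  · have h := congrArg (coef2 hq 0 (m + 2) m 0) hf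
    rw [coef2_aeval_detq hq, if_neg (by omega), map_sub, map_add, coef2_zero_mul_Y11,
      coef2_zero_Y00_mul, map_smul, map_add, coef2_Y01_mul, coef2_succ_left hq hc hroot] at h
    have h0 : coef2 hq 0 (m + 2) m 0 (D (Y q 2 0 1) * Y q 2 1 0) = 0 := by
      rcases m with _ | m
      · rw [coef2_zero_mul_Y10]
      · rw [coef2_mul_Y10, coef2_eq_zero_of_le hq hb hroot (by omega), mul_zero]
    rw [h0] at h
    simpa [hq] using h

/-- Let f(det) = D(det). The coefficient of f in degree m + 1 is the left side when read at a^(m+1)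
d^(m+1). Read at b^(m+1) c^(m+1), it involves only D(b) and D(c), and telescoping converts those
coefficients into the right side. -/
theorem coef2_der_diag (m : ℕ) :
    coef2 hq (m + 1) 0 0 m (D (Y q 2 0 0)) + coef2 hq m 0 0 (m + 1) (D (Y q 2 1 1)) =
      q ^ m * (coef2 hq m 1 0 m (D (Y q 2 0 1)) + coef2 hq m 0 1 m (D (Y q 2 1 0))) := by
  obtain ⟨f, hf⟩ := exists_der_detq hroot hq D
  rw [der_detq_two] at hf
  have h1 := congrArg (coef2 hq 0 (m + 1) (m + 1) 0) hf
  rw [coef2_aeval_detq hq, if_pos rfl, map_sub, map_add, coef2_zero_mul_Y11,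
    coef2_zero_Y00_mul, map_smul, map_add, coef2_Y01_mul, coef2_mul_Y10,
    coef2_succ_left hq (coef2_der_Y01 hq D) hroot,
    coef2_succ_right hq (coef2_der_Y10 hq D) hroot, smul_eq_mul] at h1
  have h2 := congrArg (coef2 hq (m + 1) 0 0 (m + 1)) hf
  have h3 : (fun p => (exp2 (m + 1) 0 0 (m + 1) p : ℤ)) = (m + 1) • diagExp 2 := by
    funext ⟨i, a⟩
    rw [smul_diagExp_apply]
    fin_cases i <;> fin_cases a <;> simp [exp2, diagExp]
  have h4 : coef2 hq (m + 1) 0 0 (m + 1) (Polynomial.aeval (detq q 2) f) = f.coeff (m + 1) := by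
    rw [coef2, h3, coef_aeval_detq hq two_pos]
  rw [h4, map_sub, map_add, coef2_mul_Y11, coef2_Y00_mul, map_smul, map_add, coef2_zero_mul_Y10,
    coef2_zero_Y01_mul] at h2
  have h5 : (-q ^ 2) ^ m = (-q) ^ m * q ^ m := by
    rw [← mul_pow]
    congr 1
    ring
  rw [h5, pow_succ] at h1
  have h6 : (-q) ^ m * q ≠ 0 := mul_ne_zero (pow_ne_zero _ (neg_ne_zero.2 hq)) hq
  refine mul_left_cancel₀ h6 ?_
  rw [smul_eq_mul] at h2
  linear_combination ((-q) ^ m * q) * h2 + h1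

end Derivation

end TwoByTwo

end QMatrix

end

noncomputable section

namespace QMatrix

/-! ### Quadrant sums on the cone -/

section Quadrants

variable {n : ℕ}

/-- Summing over `T` detects the unit cells around the lattice point `(k, l)`. -/
def IsQuadrant (T : Finset (Fin n × Fin n)) (k l : ℕ) : Prop :=
  ∀ i j α β : Fin n, i < j → α < β → ∑ p ∈ T, block i j α β p =
    if (i : ℕ) < k ∧ k ≤ j ∧ (α : ℕ) < l ∧ l ≤ β then -1 else 0

/-- The positions in rows before `k` and columns from `l` on. -/
def upper (n k l : ℕ) : Finset (Fin n × Fin n) :=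
  Finset.univ.filter fun p => (p.1 : ℕ) < k ∧ l ≤ p.2

/-- The positions in rows from `k` on and columns before `l`. -/
def lower (n k l : ℕ) : Finset (Fin n × Fin n) :=
  Finset.univ.filter fun p => k ≤ (p.1 : ℕ) ∧ (p.2 : ℕ) < l

theorem mem_upper {k l : ℕ} {p : Fin n × Fin n} : p ∈ upper n k l ↔ (p.1 : ℕ) < k ∧ l ≤ p.2 := by
  simp [upper]

theorem mem_lower {k l : ℕ} {p : Fin n × Fin n} : p ∈ lower n k l ↔ k ≤ p.1 ∧ (p.2 : ℕ) < l := by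
  simp [lower]

theorem sum_block (T : Finset (Fin n × Fin n)) (i j α β : Fin n) :
    ∑ p ∈ T, block i j α β p = (if (i, α) ∈ T then 1 else 0) + (if (j, β) ∈ T then 1 else 0) -
      ((if (i, β) ∈ T then 1 else 0) + if (j, α) ∈ T then 1 else 0) := by
  simp only [block, Pi.sub_apply, Pi.add_apply, Finset.sum_sub_distrib, Finset.sum_add_distrib,
    Finset.sum_pi_single']

theorem isQuadrant_upper (k l : ℕ) : IsQuadrant (upper n k l) k l := by
  intro i j α β h h'
  rw [Fin.lt_def] at h h'
  simp only [sum_block, mem_upper]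
  split_ifs <;> omega

theorem isQuadrant_lower (k l : ℕ) : IsQuadrant (lower n k l) k l := by
  intro i j α β h h'
  rw [Fin.lt_def] at h h'
  simp only [sum_block, mem_lower]
  split_ifs <;> omega

variable {T T₀ : Finset (Fin n × Fin n)} {k l : ℕ}

theorem IsQuadrant.sum_nonpos (hT : IsQuadrant T k l) {z : Fin n × Fin n → ℤ} (hz : z ∈ cone n) :
    ∑ p ∈ T, z p ≤ 0 := by
  induction hz using AddSubmonoid.closure_induction with
  | mem z h =>
    obtain ⟨i, j, α, β, h, h', rfl⟩ := h
    rw [hT i j α β h h']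
    split_ifs <;> norm_num
  | zero => simp
  | add x y hx hy ihx ihy =>
    simp only [Pi.add_apply, Finset.sum_add_distrib]
    linarith

theorem block_mem_cone_of_le {i j α β : Fin n} (h : i ≤ j) (h' : α ≤ β) :
    block i j α β ∈ cone n := by
  rcases h.lt_or_eq with h | rfl
  · rcases h'.lt_or_eq with h' | rfl
    · exact block_mem_cone h h'
    · rw [show block i j α α = 0 by rw [block, sub_self]]
      exact zero_mem _
  · rw [show block i i α β = 0 by rw [block, add_comm, sub_self]]
    exact zero_mem _

/-- A lattice point around which an element of the cone is nontrivial gives a unit cell that can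
be subtracted. -/
theorem IsQuadrant.sub_block_mem {i j α β : Fin n} (hij : (j : ℕ) = i + 1) (hab : (β : ℕ) = α + 1)
    (hT : IsQuadrant T j β) {z : Fin n × Fin n → ℤ} (hz : z ∈ cone n)
    (hneg : ∑ p ∈ T, z p < 0) : z - block i j α β ∈ cone n := by
  induction hz using AddSubmonoid.closure_induction with
  | mem z h =>
    obtain ⟨i', j', α', β', h, h', rfl⟩ := h
    rw [hT i' j' α' β' h h'] at hneg
    split_ifs at hneg with hc
    · have e : block i' j' α' β' - block i j α β = block i' i α' β' + block i j α' α +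
          block i j β β' + block j j' α' β' := by
        simp only [block]
        abel
      rw [e]
      refine add_mem (add_mem (add_mem ?_ ?_) ?_) ?_ <;> refine block_mem_cone_of_le ?_ ?_ <;>
        rw [Fin.le_def] <;> omega
    · simp at hneg
  | zero => simp at hneg
  | add x y hx hy ihx ihy =>
    simp only [Pi.add_apply, Finset.sum_add_distrib] at hneg
    by_cases h : ∑ p ∈ T, x p < 0
    · have := add_mem (ihx h) hy
      rwa [← add_sub_right_comm] at this
    · have := add_mem hx (ihy (by linarith))
      rwa [← add_sub_assoc] at this

/-- The cell contributes nothing to the sum over `T`, so v' - v has nonpositive sum there; being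
nonnegative on `T`, it has nonpositive sum on the smaller set T₀ as well. With the contribution -1
of the cell the sum over T₀ becomes negative, so the cell can be subtracted. -/
theorem IsQuadrant.sub_mem_cone {i j α β : Fin n} (hij : (j : ℕ) = i + 1) (hab : (β : ℕ) = α + 1)
    (hT₀ : IsQuadrant T₀ j β) (hT : IsQuadrant T k l) (hkl : ¬ (k = j ∧ l = β)) (hsub : T₀ ⊆ T)
    {v v' : Fin n × Fin n → ℤ} (hv : ∀ p ∈ T, v p ≤ v' p)
    (h : v' - v + block i j α β ∈ cone n) : v' - v ∈ cone n := by
  have hi : i < j := by rw [Fin.lt_def]; omega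
  have ha : α < β := by rw [Fin.lt_def]; omega
  by_cases hneg : ∑ p ∈ T₀, (v' - v + block i j α β) p < 0
  · have := hT₀.sub_block_mem hij hab h hneg
    rwa [add_sub_cancel_right] at this
  · exfalso
    have h1 := hT.sum_nonpos h
    have e1 := hT i j α β hi ha
    have e0 := hT₀ i j α β hi ha
    rw [if_neg (by omega)] at e1
    rw [if_pos ⟨hi, le_rfl, ha, le_rfl⟩] at e0
    simp only [Pi.add_apply, Finset.sum_add_distrib, e1, e0] at h1 hneg
    have h2 : ∑ p ∈ T₀, (v' - v) p ≤ ∑ p ∈ T, (v' - v) p :=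
      Finset.sum_le_sum_of_subset_of_nonneg hsub fun p hp _ => by
        have := hv p hp
        simp only [Pi.sub_apply]
        linarith
    linarith

/-- A multiple of the diagonal exponent is maximal among nonnegative exponents. -/
theorem eq_zero_of_add_smul_diagExp_nonneg {z : Fin n × Fin n → ℤ} (hz : z ∈ cone n) {m : ℕ}
    (h : ∀ p, 0 ≤ (m • diagExp n + z) p) : z = 0 := by
  have hoff : ∀ p : Fin n × Fin n, p.1 ≠ p.2 → 0 ≤ z p := by
    intro p hp
    have := h p
    rw [Pi.add_apply, smul_diagExp_apply, diagExp, if_neg hp] at this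
    simpa using this
  have h0 : ∀ p : Fin n × Fin n, p.1 ≠ p.2 → z p = 0 := by
    intro p hp
    -- The quadrant with corner `p` pointing away from the diagonal meets only off-diagonal
    -- positions, where `z` is nonnegative, yet its sum is nonpositive.
    refine le_antisymm ?_ (hoff p hp)
    rcases lt_or_gt_of_ne hp with h' | h'
    · rw [Fin.lt_def] at h'
      refine (Finset.single_le_sum (f := z) (fun s hs => hoff s fun h => ?_) ?_).trans
        ((isQuadrant_upper (p.1 + 1) p.2).sum_nonpos hz)
      · rw [mem_upper, h] at hs
        omega
      · rw [mem_upper]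
        omega
    · rw [Fin.lt_def] at h'
      refine (Finset.single_le_sum (f := z) (fun s hs => hoff s fun h => ?_) ?_).trans
        ((isQuadrant_lower p.1 (p.2 + 1)).sum_nonpos hz)
      · rw [mem_lower, h] at hs
        omega
      · rw [mem_lower]
        omega
  -- Elements of the cone have zero row sums, so once the off-diagonal entries vanish the diagonal
  -- ones do too.
  have hrow : ∀ i : Fin n, ∑ a, z (i, a) = 0 := by
    intro i
    clear h hoff h0
    induction hz using AddSubmonoid.closure_induction with
    | mem z h =>
      obtain ⟨i', j', α', β', h, h', rfl⟩ := h
      have e : ∀ (s : Fin n × Fin n), ∑ a, (Pi.single s 1 : Fin n × Fin n → ℤ) (i, a) =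
          if i = s.1 then 1 else 0 := by
        rintro ⟨j, b⟩
        by_cases hj : i = j <;> simp [Pi.single_apply, hj]
      simp only [block, Pi.sub_apply, Pi.add_apply, Finset.sum_sub_distrib,
        Finset.sum_add_distrib, e]
      ring
    | zero => simp
    | add x y hx hy ihx ihy => simp [Finset.sum_add_distrib, ihx, ihy]
  funext ⟨i, a⟩
  by_cases hia : i = a
  · subst hia
    refine Eq.trans ?_ (hrow i)
    rw [Finset.sum_eq_single i]
    · intro b _ hb
      exact h0 _ hb.symm
    · simp
  · exact h0 _ hia

end Quadrants

/-! ### Leading coefficients of derivations -/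

section Leading

variable {K : Type*} [Field K] {q : K} {n : ℕ} (hq : q ≠ 0)

theorem exists_coef_ne_zero_of_mul_Y {x : QMat q n} {w : Fin n × Fin n → ℤ} {r : Fin n × Fin n}
    (h : coef hq w (x * Y q n r.1 r.2) ≠ 0) :
    ∃ u, coef hq u x ≠ 0 ∧ u + Pi.single r 1 - w ∈ cone n := by
  have h1 := map_eq_sum_coef hq ((coef hq w).comp (LinearMap.mulRight K (Y q n r.1 r.2))) x
  rw [LinearMap.comp_apply, LinearMap.mulRight_apply] at h1
  rw [h1] at h
  obtain ⟨u, -, hu⟩ := Finset.exists_ne_zero_of_sum_ne_zero h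
  refine ⟨_, left_ne_zero_of_smul hu, ?_⟩
  exact mul_mem_leSpan hq (mono_mem_leSpan hq u) (Y_mem_leSpan hq r) w (right_ne_zero_of_smul hu)

theorem exists_coef_ne_zero_of_Y_mul {x : QMat q n} {w : Fin n × Fin n → ℤ} {r : Fin n × Fin n}
    (h : coef hq w (Y q n r.1 r.2 * x) ≠ 0) :
    ∃ u, coef hq u x ≠ 0 ∧ u + Pi.single r 1 - w ∈ cone n := by
  have h1 := map_eq_sum_coef hq ((coef hq w).comp (LinearMap.mulLeft K (Y q n r.1 r.2))) x
  rw [LinearMap.comp_apply, LinearMap.mulLeft_apply] at h1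
  rw [h1] at h
  obtain ⟨u, -, hu⟩ := Finset.exists_ne_zero_of_sum_ne_zero h
  refine ⟨_, left_ne_zero_of_smul hu, ?_⟩
  have := mul_mem_leSpan hq (Y_mem_leSpan hq r) (mono_mem_leSpan hq u) w
    (right_ne_zero_of_smul hu)
  rwa [add_comm (Pi.single r 1)] at this

/-- The commutation relation of two arbitrary generators. -/
theorem exists_relation (hq : q ≠ 0) (p r : Fin n × Fin n) : ∃ (μ : K) (b c : Fin n × Fin n),
    Y q n p.1 p.2 * Y q n r.1 r.2 = q ^ comm p r • (Y q n r.1 r.2 * Y q n p.1 p.2) +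
      μ • (Y q n b.1 b.2 * Y q n c.1 c.2) ∧
    (μ = 0 ∨ ∃ z ∈ cone n, z ≠ 0 ∧
      (Pi.single p 1 + Pi.single r 1 : Fin n × Fin n → ℤ) =
        Pi.single b 1 + Pi.single c 1 + z) := by
  obtain ⟨i, α⟩ := p
  obtain ⟨j, β⟩ := r
  have hY := isQM_Y q n
  rcases lt_trichotomy i j with hij | rfl | hij <;> rcases lt_trichotomy α β with hab | rfl | hab
  · refine ⟨q - q⁻¹, (i, β), (j, α), ?_, Or.inr ⟨_, block_mem_cone hij hab,
      block_ne_zero hij hab, ?_⟩⟩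
    · simp [comm, hij.ne, hab.ne, hY.diag hij hab]
    · simp [block]
  · refine ⟨0, (i, α), (i, α), ?_, Or.inl rfl⟩
    simp [comm, hij.ne, sg, hij, hY.col α hij, smul_smul, hq]
  · refine ⟨0, (i, α), (i, α), ?_, Or.inl rfl⟩
    simp [comm, hij.ne, hab.ne', hY.anti hij hab]
  · refine ⟨0, (i, α), (i, α), ?_, Or.inl rfl⟩
    simp [comm, hab.ne, sg, hab, hY.row i hab, smul_smul, hq]
  · refine ⟨0, (i, α), (i, α), ?_, Or.inl rfl⟩
    simp [comm, sg]
  · refine ⟨0, (i, α), (i, α), ?_, Or.inl rfl⟩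
    simp [comm, hab.ne', sg, hab, hab.not_gt, hY.row i hab]
  · refine ⟨0, (i, α), (i, α), ?_, Or.inl rfl⟩
    simp [comm, hij.ne', hab.ne, hY.anti hij hab]
  · refine ⟨0, (i, α), (i, α), ?_, Or.inl rfl⟩
    simp [comm, hij.ne', sg, hij, hij.not_gt, hY.col α hij]
  · refine ⟨-(q - q⁻¹), (j, α), (i, β), ?_, Or.inr ⟨_, block_mem_cone hij hab,
      block_ne_zero hij hab, ?_⟩⟩
    · simp only [comm, hij.ne', hab.ne', if_false, add_zero, zpow_zero, one_smul,
        hY.diag hij hab]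
      module
    · simp [block, add_comm]

/-- All monomials of the values `D (Y p)` have exponents in `W + e_p`. -/
def SuppIn (W : Finset (Fin n × Fin n → ℤ)) (D : Der K (QMat q n)) : Prop :=
  ∀ v p, coef hq (v + Pi.single p 1) (D (Y q n p.1 p.2)) ≠ 0 → v ∈ W

/-- The normalized leading coefficient of `D (Y p)` at `v + e_p`. -/
def lead (v : Fin n × Fin n → ℤ) (D : Der K (QMat q n)) (p : Fin n × Fin n) : K :=
  q ^ (-rightExp v p) * coef hq (v + Pi.single p 1) (D (Y q n p.1 p.2))

variable {hq} {W : Finset (Fin n × Fin n → ℤ)} {D : Der K (QMat q n)} {v : Fin n × Fin n → ℤ}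

theorem coef_eq_lead (v : Fin n × Fin n → ℤ) (D : Der K (QMat q n)) (p : Fin n × Fin n) :
    coef hq (v + Pi.single p 1) (D (Y q n p.1 p.2)) = q ^ rightExp v p * lead hq v D p := by
  rw [lead, ← mul_assoc, ← zpow_add₀ hq, add_neg_cancel, zpow_zero, one_mul]

theorem lead_eq_zero_iff {p : Fin n × Fin n} :
    lead hq v D p = 0 ↔ coef hq (v + Pi.single p 1) (D (Y q n p.1 p.2)) = 0 := by
  rw [coef_eq_lead]
  simp [zpow_ne_zero, hq]

variable (hD : SuppIn hq W D) (htop : ∀ z ∈ cone n, z ≠ 0 → v + z ∉ W)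

include hD htop

theorem SuppIn.coef_top {z : Fin n × Fin n → ℤ} (p : Fin n × Fin n) (hz : z ∈ cone n)
    (h0 : z ≠ 0) : coef hq (v + Pi.single p 1 + z) (D (Y q n p.1 p.2)) = 0 := by
  by_contra h
  rw [add_right_comm] at h
  exact htop z hz h0 (hD _ _ h)

theorem SuppIn.coef_der_mul (p r : Fin n × Fin n) :
    coef hq (v + Pi.single p 1 + Pi.single r 1) (D (Y q n p.1 p.2) * Y q n r.1 r.2) =
      q ^ (rightExp v p + rightExp v r + rightExp (Pi.single p 1) r) * lead hq v D p := by
  rw [coef_mul_Y hq (fun z hz h0 => hD.coef_top htop p hz h0), coef_eq_lead, ← mul_assoc,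
    ← zpow_add₀ hq, rightExp_add]
  congr 2
  ring

theorem SuppIn.coef_mul_der (p r : Fin n × Fin n) :
    coef hq (v + Pi.single p 1 + Pi.single r 1) (Y q n p.1 p.2 * D (Y q n r.1 r.2)) =
      q ^ (rightExp v p + rightExp v r + rightExp (Pi.single r 1) p + eps p v + comm p r) *
        lead hq v D r := by
  rw [add_right_comm, coef_Y_mul hq (fun z hz h0 => hD.coef_top htop r hz h0), coef_eq_lead,
    ← mul_assoc, ← zpow_add₀ hq, leftExp_eq, rightExp_add, eps_add, eps_single]
  congr 2
  ring

/-- Shows that the correction term of a commutation relation is invisible at the top: its exponent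
is lower by `z`, so a contribution would require an element of `W` strictly above `v`. -/
theorem SuppIn.coef_der_mul_eq_zero (b c : Fin n × Fin n) {z : Fin n × Fin n → ℤ}
    (hz : z ∈ cone n) (h0 : z ≠ 0) :
    coef hq (v + (Pi.single b 1 + Pi.single c 1 + z)) (D (Y q n b.1 b.2 * Y q n c.1 c.2)) = 0 := by
  have key : ∀ u p s, coef hq u (D (Y q n p.1 p.2)) ≠ 0 →
      u + Pi.single s 1 - (v + (Pi.single p 1 + Pi.single s 1 + z)) ∈ cone n → False := by
    intro u p s hu hc
    have h1 : u - Pi.single p 1 ∈ W := hD _ p (by rwa [sub_add_cancel])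
    refine htop (u + Pi.single s 1 - (v + (Pi.single p 1 + Pi.single s 1 + z)) + z)
      (add_mem hc hz) (fun h => ?_) (by convert h1 using 1; abel)
    have h2 := ht_pos hz h0
    have h3 := ht_nonneg hc
    have h4 := congrArg ht h
    rw [ht_add] at h4
    simp [ht] at h2 h3 h4
    linarith
  rw [Der.leibniz, map_add]
  by_contra h
  rcases ne_or_eq (coef hq (v + (Pi.single b 1 + Pi.single c 1 + z))
    (D (Y q n b.1 b.2) * Y q n c.1 c.2)) 0 with h1 | h1
  · obtain ⟨u, hu, hc⟩ := exists_coef_ne_zero_of_mul_Y hq h1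
    exact key u b c hu hc
  · rw [h1, zero_add] at h
    obtain ⟨u, hu, hc⟩ := exists_coef_ne_zero_of_Y_mul hq h
    exact key u c b hu (by rwa [add_comm (Pi.single c 1)])

/-- The commutation relations constrain the leading coefficients of a derivation. -/
theorem SuppIn.lead_mul (p r : Fin n × Fin n) :
    lead hq v D p * (1 - q ^ eps r v) = lead hq v D r * (1 - q ^ eps p v) := by
  obtain ⟨μ, b, c, h1, h2⟩ := exists_relation hq p r
  have h3 := congrArg (fun x => coef hq (v + Pi.single p 1 + Pi.single r 1) (D x)) h1
  have h4 : μ * coef hq (v + Pi.single p 1 + Pi.single r 1)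
      (D (Y q n b.1 b.2 * Y q n c.1 c.2)) = 0 := by
    rcases h2 with h2 | ⟨z, hz, h0, h2⟩
    · rw [h2, zero_mul]
    · rw [add_assoc, h2, hD.coef_der_mul_eq_zero htop b c hz h0, mul_zero]
  simp only [map_add, map_smul, smul_eq_mul, h4, add_zero] at h3
  rw [Der.leibniz, Der.leibniz, map_add, map_add, hD.coef_der_mul htop p r,
    hD.coef_mul_der htop p r, add_right_comm v, hD.coef_der_mul htop r p,
    hD.coef_mul_der htop r p] at h3
  -- The placement costs of the two orders of `p` and `r` differ by `comm p r`; this cancels the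
  -- power of q in the relation.
  have e1 : rightExp (Pi.single p 1) r = rightExp (Pi.single r 1) p + comm p r := by
    have := leftExp_eq p (Pi.single r 1)
    rw [eps_single] at this
    rw [← this, rightExp_single, leftExp, Finset.sum_eq_single r]
    · simp
    · intro t _ h
      simp [Pi.single_eq_of_ne h]
    · simp
  rw [e1, comm_swap p r] at h3
  set A := rightExp v p
  set B := rightExp v r
  set C := rightExp (Pi.single r 1) p
  have e2 : q ^ (A + B + (C + comm p r)) ≠ 0 := zpow_ne_zero _ hq
  refine mul_left_cancel₀ e2 ?_
  have e3 : ∀ k l : ℤ, q ^ (k + l) = q ^ k * q ^ l := zpow_add₀ hq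
  have e4 : q ^ comm p r * q ^ (-comm p r) = 1 := by
    rw [← e3, add_neg_cancel, zpow_zero]
  simp only [e3] at h3 ⊢
  linear_combination h3 + q ^ A * q ^ B * q ^ C * q ^ comm p r * q ^ eps r v * lead hq v D p * e4

/-- The constraint imposed on leading coefficients by a unit cell off the diagonal. -/
theorem SuppIn.lead_add_lead (hq2 : q - q⁻¹ ≠ 0) (hv : ∀ p, eps p v = 0) {i j α β : Fin n}
    (hij : (j : ℕ) = i + 1) (hab : (β : ℕ) = α + 1)
    {T₀ T₁ T₂ : Finset (Fin n × Fin n)} {k₁ l₁ k₂ l₂ : ℕ} (hT₀ : IsQuadrant T₀ j β)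
    (hT₁ : IsQuadrant T₁ k₁ l₁) (hT₂ : IsQuadrant T₂ k₂ l₂) (h₁ : ¬ (k₁ = j ∧ l₁ = β))
    (h₂ : ¬ (k₂ = j ∧ l₂ = β)) (hs₁ : T₀ ⊆ T₁) (hs₂ : T₀ ⊆ T₂) (ha : (i, α) ∉ T₁)
    (hd : (j, β) ∉ T₂) (hv₁ : ∀ p ∈ T₁, v p ≤ 0) (hv₂ : ∀ p ∈ T₂, v p ≤ 0)
    (hla : lead hq v D (i, α) = 0) (hld : lead hq v D (j, β) = 0) :
    lead hq v D (i, β) + lead hq v D (j, α) = 0 := by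
  have hi : i < j := by rw [Fin.lt_def]; omega
  have hα : α < β := by rw [Fin.lt_def]; omega
  -- This is the exponent v + e_{iα} + e_{jβ} lowered by one unit cell, where the correction term of
  -- the diagonal relation becomes visible.
  set w := v + Pi.single (i, β) 1 + Pi.single (j, α) 1 with hw
  -- A monomial of D(Y_p) that reaches `w` lies, after the shift by e_p, above `v` up to one unit
  -- cell. It is nonnegative on `T` even after the shift, while v ≤ 0 there, so the quadrant
  -- argument removes the cell. The shifted exponent is then `v`, where `lead` vanishes, or strictly
  -- above it, outside `W`.
  have key : ∀ u p (T : Finset (Fin n × Fin n)) k l, IsQuadrant T k l → ¬ (k = j ∧ l = β) →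
      T₀ ⊆ T → p ∉ T → (∀ s ∈ T, v s ≤ 0) → lead hq v D p = 0 →
      coef hq u (D (Y q n p.1 p.2)) ≠ 0 →
      u - Pi.single p 1 - v + block i j α β ∈ cone n → False := by
    intro u p T k l hT hkl hs hp hvT hlp hu hc
    have h1 : u - Pi.single p 1 ∈ W := hD _ p (by rwa [sub_add_cancel])
    have h2 := IsQuadrant.sub_mem_cone hij hab hT₀ hT hkl hs (v := v) (v' := u - Pi.single p 1)
      (fun s hs' => (hvT s hs').trans ?_) hc
    · by_cases h0 : u - Pi.single p 1 - v = 0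
      · have h3 : u = v + Pi.single p 1 := by
          rw [sub_eq_zero] at h0
          rw [← h0, sub_add_cancel]
        rw [h3] at hu
        exact hu (lead_eq_zero_iff.1 hlp)
      · exact htop _ h2 h0 (by rwa [add_sub_cancel])
    · have hsp : s ≠ p := fun h => hp (h ▸ hs')
      rw [Pi.sub_apply, Pi.single_eq_of_ne hsp, sub_zero]
      by_contra! h
      exact hu (coef_eq_zero_of_neg hq h _)
  have hA1 : coef hq w (D (Y q n i α) * Y q n j β) = 0 := by
    by_contra h
    obtain ⟨u, hu, hc⟩ := exists_coef_ne_zero_of_mul_Y (r := (j, β)) hq h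
    refine key u (i, α) T₁ k₁ l₁ hT₁ h₁ hs₁ ha hv₁ hla hu ?_
    convert hc using 1
    rw [hw, block]
    abel
  have hA2 : coef hq w (Y q n j β * D (Y q n i α)) = 0 := by
    by_contra h
    obtain ⟨u, hu, hc⟩ := exists_coef_ne_zero_of_Y_mul (r := (j, β)) hq h
    refine key u (i, α) T₁ k₁ l₁ hT₁ h₁ hs₁ ha hv₁ hla hu ?_
    convert hc using 1
    rw [hw, block]
    abel
  have hD1 : coef hq w (D (Y q n j β) * Y q n i α) = 0 := by
    by_contra h
    obtain ⟨u, hu, hc⟩ := exists_coef_ne_zero_of_mul_Y (r := (i, α)) hq h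
    refine key u (j, β) T₂ k₂ l₂ hT₂ h₂ hs₂ hd hv₂ hld hu ?_
    convert hc using 1
    rw [hw, block]
    abel
  have hD2 : coef hq w (Y q n i α * D (Y q n j β)) = 0 := by
    by_contra h
    obtain ⟨u, hu, hc⟩ := exists_coef_ne_zero_of_Y_mul (r := (i, α)) hq h
    refine key u (j, β) T₂ k₂ l₂ hT₂ h₂ hs₂ hd hv₂ hld hu ?_
    convert hc using 1
    rw [hw, block]
    abel
  have h3 := congrArg (fun x => coef hq w (D x)) ((isQM_Y q n).diag hi hα)
  simp only [Der.leibniz, map_sub, map_add, map_smul, hA1, hA2, hD1,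
    hD2, add_zero, zero_sub, smul_eq_mul] at h3
  have h4 := (mul_eq_zero.1 (neg_eq_zero.1 h3.symm)).resolve_left hq2
  have e1 := hD.coef_der_mul htop (i, β) (j, α)
  have e2 := hD.coef_mul_der htop (i, β) (j, α)
  have hcomm : comm (i, β) (j, α) = 0 := by simp [comm, hi.ne, hα.ne']
  have hcomm' : comm (j, α) (i, β) = 0 := by simp [comm, hi.ne', hα.ne]
  simp only [rightExp_single, hcomm, hcomm', ite_self, hv, add_zero] at e1 e2
  rw [e1, e2, ← mul_add] at h4
  exact (mul_eq_zero.1 h4).resolve_left (zpow_ne_zero _ hq)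

end Leading

end QMatrix

end

noncomputable section

namespace QMatrix

/-! ### Restriction of derivations to two by two diagonal blocks -/

section DiagonalBlock

variable {n : ℕ} (i j : Fin n)

/-- The index in the two by two block of the indices `i` and `j`. -/
def blockIdx (r : Fin n) : Fin 2 := if r = j then 1 else 0

/-- The inclusion of the indices of the two by two block. -/
def blockIncl (a : Fin 2) : Fin n := if a = 1 then j else i

/-- A position belongs to the block with rows and columns `i`, `j`. -/
def InBlock (p : Fin n × Fin n) : Prop := (p.1 = i ∨ p.1 = j) ∧ (p.2 = i ∨ p.2 = j)

instance : DecidablePred (InBlock i j) := fun _ => inferInstanceAs (Decidable (_ ∧ _))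

variable {K : Type*} [Field K] (q : K)

/-- The generic block diagonal quantum matrix with a two by two block at `i`, `j` and central
variables as the remaining diagonal entries. -/
def blockMat (r s : Fin n) : AddMonoidAlgebra (QMat q 2) (Fin n → ℕ) :=
  if InBlock i j (r, s) then AddMonoidAlgebra.single 0 (Y q 2 (blockIdx j r) (blockIdx j s))
  else if r = s then AddMonoidAlgebra.single (Pi.single r 1) 1 else 0

variable {i j q}

theorem blockMat_eq_zero {r s : Fin n} (h : ¬ InBlock i j (r, s)) (hrs : r ≠ s) :
    blockMat i j q r s = 0 := by
  rw [blockMat, if_neg h, if_neg hrs]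

theorem blockMat_of_mem {r s : Fin n} (h : InBlock i j (r, s)) : blockMat i j q r s =
    AddMonoidAlgebra.single 0 (Y q 2 (blockIdx j r) (blockIdx j s)) := by
  rw [blockMat, if_pos h]

theorem blockMat_diag {r : Fin n} (h : ¬ InBlock i j (r, r)) :
    blockMat i j q r r = AddMonoidAlgebra.single (Pi.single r 1) 1 := by
  rw [blockMat, if_neg h, if_pos rfl]

theorem blockMat_commute {r s r' s' : Fin n}
    (h : ¬ (InBlock i j (r, s) ∧ InBlock i j (r', s'))) :
    Commute (blockMat i j q r s) (blockMat i j q r' s') := by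
  have key : ∀ (r s : Fin n) x, ¬ InBlock i j (r, s) → Commute (blockMat i j q r s) x := by
    intro r s x h
    by_cases hrs : r = s
    · subst hrs
      rw [blockMat_diag h]
      exact AddMonoidAlgebra.single_commute (fun _ => AddCommute.all _ _) (fun _ =>
        Commute.one_left _) x
    · rw [blockMat_eq_zero h hrs]
      exact Commute.zero_left x
  by_cases h1 : InBlock i j (r, s)
  · exact (key r' s' _ fun h2 => h ⟨h1, h2⟩).symm
  · exact key r s _ h1

/-- Adjacency of `i` and `j` is essential: for an index k strictly between them, the diagonal
relation for the zero entries (i,k) and (k,j) would force the product of the entries (i,j) and (k,k)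
to vanish. -/
theorem isQM_blockMat (hij : (j : ℕ) = i + 1) : IsQM q (blockMat i j q) := by
  have hlt : i < j := by rw [Fin.lt_def]; omega
  have hi : blockIdx j i = 0 := if_neg hlt.ne
  have hj : blockIdx j j = 1 := if_pos rfl
  have hY := (isQM_Y q 2).map (AddMonoidAlgebra.singleZeroAlgHom (R := K) (A := QMat q 2)
    (M := Fin n → ℕ))
  have hord : ∀ {r s : Fin n}, r < s → (r = i ∨ r = j) → (s = i ∨ s = j) → r = i ∧ s = j := by
    intro r s h hr hs
    rcases hr with rfl | rfl <;> rcases hs with rfl | rfl <;> first | exact ⟨rfl, rfl⟩ | skip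
    · exact absurd h (lt_irrefl _)
    · exact absurd h hlt.not_gt
    · exact absurd h (lt_irrefl _)
  have h01 : (0 : Fin 2) < 1 := by decide
  constructor
  · intro r α β hab
    by_cases h1 : InBlock i j (r, α)
    · by_cases h2 : InBlock i j (r, β)
      · obtain ⟨rfl, rfl⟩ := hord hab h1.2 h2.2
        rw [blockMat_of_mem h1, blockMat_of_mem h2, hi, hj]
        exact hY.row _ h01
      · rw [blockMat_eq_zero h2 fun h => h2 (h ▸ ⟨h1.1, h1.1⟩)]
        simp
    · by_cases hr : r = α
      · subst hr
        rw [blockMat_eq_zero (s := β) (fun h => h1 ⟨h.1, h.1⟩) hab.ne]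
        simp
      · rw [blockMat_eq_zero h1 hr]
        simp
  · intro r r' α hrr
    by_cases h1 : InBlock i j (r, α)
    · by_cases h2 : InBlock i j (r', α)
      · obtain ⟨rfl, rfl⟩ := hord hrr h1.1 h2.1
        rw [blockMat_of_mem h1, blockMat_of_mem h2, hi, hj]
        exact hY.col _ h01
      · have h3 : α = i ∨ α = j := h1.2
        rw [blockMat_eq_zero h2 fun h => h2 ⟨h ▸ h3, h3⟩]
        simp
    · by_cases hr : r = α
      · subst hr
        rw [blockMat_eq_zero (r := r') (fun h => h1 ⟨h.2, h.2⟩) hrr.ne']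
        simp
      · rw [blockMat_eq_zero h1 hr]
        simp
  · intro r r' α β hrr hab
    by_cases h : InBlock i j (r', β) ∧ InBlock i j (r, α)
    · obtain ⟨rfl, rfl⟩ := hord hrr h.2.1 h.1.1
      obtain ⟨rfl, rfl⟩ := hord hab h.1.2 h.2.2
      rw [blockMat_of_mem h.1, blockMat_of_mem h.2, hi, hj]
      exact hY.anti h01 h01
    · exact blockMat_commute h
  · intro r r' α β hrr hab
    by_cases h : InBlock i j (r', β) ∧ InBlock i j (r, α)
    · have h1 : InBlock i j (r, β) := ⟨h.2.1, h.1.2⟩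
      have h2 : InBlock i j (r', α) := ⟨h.1.1, h.2.2⟩
      rw [blockMat_of_mem h.1, blockMat_of_mem h.2, blockMat_of_mem h1, blockMat_of_mem h2]
      obtain ⟨rfl, rfl⟩ := hord hrr h.2.1 h.1.1
      obtain ⟨rfl, rfl⟩ := hord hab h.2.2 h.1.2
      rw [hi, hj]
      exact hY.diag h01 h01
    · have h0 : blockMat i j q r β * blockMat i j q r' α = 0 := by
        by_cases h1 : InBlock i j (r, β)
        · have h2 : ¬ InBlock i j (r', α) := fun h2 => h ⟨⟨h2.1, h1.2⟩, h1.1, h2.2⟩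
          rw [blockMat_eq_zero h2, mul_zero]
          rintro rfl
          have h3 : r' ≠ i ∧ r' ≠ j := by
            constructor <;> rintro rfl <;> exact h2 ⟨by simp, by simp⟩
          obtain ⟨rfl, rfl⟩ := hord (hrr.trans hab) h1.1 h1.2
          rw [Fin.lt_def] at hrr hab
          omega
        · by_cases hrb : r = β
          · subst hrb
            by_cases h2 : InBlock i j (r', α)
            · obtain ⟨rfl, rfl⟩ := hord (hab.trans hrr) h2.2 h2.1
              rw [Fin.lt_def] at hrr hab
              omega
            · rw [blockMat_eq_zero h2 (hab.trans hrr).ne', mul_zero]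
          · rw [blockMat_eq_zero h1 hrb, zero_mul]
      rw [h0, smul_zero, sub_zero]
      exact blockMat_commute h

/-- The exponent of a block diagonal monomial. -/
def blockExp (i j : Fin n) (u : Fin 2 × Fin 2 → ℕ) (e : Fin n → ℕ) : Fin n × Fin n → ℕ := fun p =>
  if InBlock i j p then u (blockIdx j p.1, blockIdx j p.2) else if p.1 = p.2 then e p.1 else 0

theorem wordProd_blockMat {l : List (Fin n × Fin n)} (h : ∀ p ∈ l, InBlock i j p ∨ p.1 = p.2) :
    wordProd (blockMat i j q) l = AddMonoidAlgebra.single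
      (fun k => if InBlock i j (k, k) then 0 else l.count (k, k))
      (wordProd (Y q 2) ((l.filter fun p => InBlock i j p).map
        fun p => (blockIdx j p.1, blockIdx j p.2))) := by
  induction l with
  | nil =>
    simp only [wordProd_nil, List.count_nil, ite_self, List.filter_nil, List.map_nil]
    rfl
  | cons p l ih =>
    rw [wordProd_cons, ih fun p hp => h p (by simp [hp])]
    by_cases hp : InBlock i j p
    · rw [blockMat_of_mem hp, AddMonoidAlgebra.single_mul_single, zero_add,
        List.filter_cons_of_pos (by simpa using hp), List.map_cons, wordProd_cons]
      congr 1
      funext k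
      split_ifs with hk
      · rfl
      · rw [List.count_cons_of_ne]
        rintro rfl
        exact hk hp
    · obtain ⟨r, s⟩ := p
      obtain rfl : r = s := (h (r, s) (by simp)).resolve_left hp
      rw [blockMat_diag hp, AddMonoidAlgebra.single_mul_single, one_mul,
        List.filter_cons_of_neg (by simpa using hp)]
      congr 1
      funext k
      rw [Pi.add_apply]
      by_cases hk : k = r
      · subst hk
        simp [hp, add_comm]
      · rw [Pi.single_eq_of_ne hk, zero_add, List.count_cons_of_ne]
        intro h'
        exact hk (Prod.ext_iff.1 h').1.symm

theorem filter_word_blockIdx (hlt : i < j) (u : Fin n × Fin n → ℕ) :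
    ((word u).filter fun p => InBlock i j p).map (fun p => (blockIdx j p.1, blockIdx j p.2)) =
      word fun p : Fin 2 × Fin 2 => u (blockIncl i j p.1, blockIncl i j p.2) := by
  have hi : blockIdx j i = 0 := if_neg hlt.ne
  have hj : blockIdx j j = 1 := if_pos rfl
  refine eq_word_of_pairwise ?_ fun p => ?_
  · rw [List.pairwise_map]
    refine ((word_pairwise u).filter _).imp_of_mem fun {p s} hp hs h => ?_
    have hp' : InBlock i j p := by simpa using (List.mem_filter.1 hp).2
    have hs' : InBlock i j s := by simpa using (List.mem_filter.1 hs).2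
    obtain ⟨r, t⟩ := p
    obtain ⟨r', t'⟩ := s
    rw [Prod.Lex.toLex_le_toLex] at h ⊢
    obtain ⟨h1, h2⟩ := hp'
    obtain ⟨h3, h4⟩ := hs'
    simp only at h1 h2 h3 h4 h ⊢
    rcases h1 with rfl | rfl <;> rcases h2 with rfl | rfl <;> rcases h3 with rfl | rfl <;>
      rcases h4 with rfl | rfl <;> simp [hi, hj, hlt.not_ge, hlt.not_gt, hlt.ne, hlt.ne'] at h ⊢
  · rw [← count_word u, List.count, List.countP_map, List.countP_filter, List.count]
    refine List.countP_congr fun s _ => ?_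
    obtain ⟨a, b⟩ := p
    obtain ⟨r, t⟩ := s
    simp only [Function.comp_apply, beq_iff_eq, Bool.and_eq_true, decide_eq_true_eq,
      Prod.mk.injEq]
    constructor
    · rintro ⟨⟨rfl, rfl⟩, h1, h2⟩
      simp only at h1 h2
      rcases h1 with rfl | rfl <;> rcases h2 with rfl | rfl <;> simp [hi, hj, blockIncl]
    · rintro ⟨rfl, rfl⟩
      fin_cases a <;> fin_cases b <;> simp [hi, hj, blockIncl, InBlock]

/-- The homomorphism to block diagonal matrices. -/
def blockHom (q : K) (hij : (j : ℕ) = i + 1) :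
    QMat q n →ₐ[K] AddMonoidAlgebra (QMat q 2) (Fin n → ℕ) := liftQM (isQM_blockMat hij)

/-- The coefficient of a monomial in the central variables, as a linear map. -/
def varCoeff (q : K) (e : Fin n → ℕ) :
    AddMonoidAlgebra (QMat q 2) (Fin n → ℕ) →ₗ[K] QMat q 2 where
  toFun x := x.coeff e
  map_add' _ _ := rfl
  map_smul' _ _ := rfl

theorem varCoeff_apply (e : Fin n → ℕ) (x : AddMonoidAlgebra (QMat q 2) (Fin n → ℕ)) :
    varCoeff q e x = x.coeff e := rfl

theorem blockHom_mono (hij : (j : ℕ) = i + 1) (u : Fin n × Fin n → ℕ) :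
    blockHom q hij (mono q u) = wordProd (blockMat i j q) (word u) := by
  rw [mono, wordProd, wordProd, map_list_prod, List.map_map]
  congr 1
  refine List.map_congr_left fun p _ => ?_
  exact liftQM_Y (isQM_blockMat hij) p.1 p.2

/-- An ordered monomial goes to an ordered two by two monomial times a monomial in the central
variables, or to zero if it uses a position outside the block and off the diagonal. The variables at
`i` and `j` never occur, hence the condition on `e`. -/
theorem coef_blockExp (hq : q ≠ 0) (hij : (j : ℕ) = i + 1) (u : Fin 2 × Fin 2 → ℕ)
    {e : Fin n → ℕ} (he : e i = 0 ∧ e j = 0) (x : QMat q n) :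
    coef hq (fun p => (blockExp i j u e p : ℤ)) x =
      coef hq (fun p => (u p : ℤ)) (varCoeff q e (blockHom q hij x)) := by
  have hlt : i < j := by rw [Fin.lt_def]; omega
  refine LinearMap.congr_fun (f := coef hq (fun p => (blockExp i j u e p : ℤ)))
    (g := (coef hq (fun p => (u p : ℤ))).comp ((varCoeff q e).comp (blockHom q hij).toLinearMap))
    ((monoBasis hq n).ext fun w => ?_) x
  have hi : blockIdx j i = 0 := if_neg hlt.ne
  have hj : blockIdx j j = 1 := if_pos rfl
  have hcast : ∀ {ι : Type} (f g : ι → ℕ), ((fun p => (f p : ℤ)) = fun p => (g p : ℤ)) ↔ f = g :=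
    fun f g => ⟨fun h => funext fun p => by exact_mod_cast congrFun h p, fun h => by rw [h]⟩
  rw [monoBasis_apply, coef_mono]
  simp only [hcast]
  rw [LinearMap.comp_apply, LinearMap.comp_apply,
    AlgHom.toLinearMap_apply, blockHom_mono, varCoeff_apply]
  by_cases hsupp : ∀ p ∈ word w, InBlock i j p ∨ p.1 = p.2
  · rw [wordProd_blockMat hsupp, filter_word_blockIdx hlt, AddMonoidAlgebra.coeff_single,
      Finsupp.single_apply]
    simp only [count_word]
    have hiff : blockExp i j u e = w ↔
        (fun k => if InBlock i j (k, k) then 0 else w (k, k)) = e ∧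
          u = fun p => w (blockIncl i j p.1, blockIncl i j p.2) := by
      constructor
      · rintro rfl
        constructor
        · funext k
          by_cases hk : InBlock i j (k, k)
          · rw [if_pos hk]
            rcases hk.1 with hk | hk <;> simp only at hk <;> rw [hk]
            exacts [he.1.symm, he.2.symm]
          · rw [if_neg hk, blockExp, if_neg hk, if_pos rfl]
        · funext ⟨a, b⟩
          rw [blockExp, if_pos]
          · fin_cases a <;> fin_cases b <;> simp [blockIncl, hi, hj]
          · fin_cases a <;> fin_cases b <;> simp [blockIncl, InBlock]
      · rintro ⟨rfl, rfl⟩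
        funext ⟨r, s⟩
        rw [blockExp]
        split_ifs with h1 h2 h3
        · obtain ⟨h1, h2⟩ := h1
          simp only at h1 h2
          rcases h1 with rfl | rfl <;> rcases h2 with rfl | rfl <;> simp [hi, hj, blockIncl]
        · simp only at h2
          subst h2
          exact absurd h3 h1
        · simp only at h2
          subst h2
          rfl
        · by_contra h0
          have : (r, s) ∈ word w := by
            rw [← List.count_pos_iff, count_word]
            omega
          exact (hsupp _ this).elim h1 h2
    by_cases h1 : (fun k => if InBlock i j (k, k) then 0 else w (k, k)) = e
    · rw [if_pos h1]
      by_cases h2 : u = fun p => w (blockIncl i j p.1, blockIncl i j p.2)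
      · rw [if_pos (hiff.2 ⟨h1, h2⟩)]
        have := coef_mono hq (fun p => (u p : ℤ)) u
        rw [if_pos rfl] at this
        rw [← this, mono, h2]
      · rw [if_neg fun h => h2 (hiff.1 h).2]
        have := coef_mono hq (fun p => (u p : ℤ))
          fun p => w (blockIncl i j p.1, blockIncl i j p.2)
        simp only [hcast] at this
        rw [if_neg h2] at this
        exact this.symm
    · rw [if_neg h1, map_zero, if_neg fun h => h1 (hiff.1 h).1]
  · push Not at hsupp
    obtain ⟨p, hp, h1, h2⟩ := hsupp
    have h3 : wordProd (blockMat i j q) (word w) = 0 := by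
      rw [wordProd]
      refine List.prod_eq_zero (List.mem_map.2 ⟨p, hp, blockMat_eq_zero h1 h2⟩)
    rw [h3, AddMonoidAlgebra.coeff_zero, Finsupp.zero_apply, map_zero, if_neg]
    rintro rfl
    rw [← List.count_pos_iff, count_word, blockExp, if_neg h1, if_neg h2] at hp
    exact lt_irrefl _ hp

theorem strictMono_blockIncl (hlt : i < j) : StrictMono (blockIncl i j) := by
  intro a b h
  fin_cases a <;> fin_cases b <;> simp [blockIncl] at h ⊢
  exact hlt

/-- The inclusion of a two by two diagonal block. -/
def blockInclHom (q : K) (hlt : i < j) : QMat q 2 →ₐ[K] QMat q n :=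
  liftQM ((isQM_Y q n).comp (strictMono_blockIncl hlt) (strictMono_blockIncl hlt))

theorem blockHom_blockInclHom (hij : (j : ℕ) = i + 1) (hlt : i < j) (x : QMat q 2) :
    blockHom q hij (blockInclHom q hlt x) = AddMonoidAlgebra.single 0 x := by
  have h : (blockHom q hij).comp (blockInclHom q hlt) =
      AddMonoidAlgebra.singleZeroAlgHom (R := K) (A := QMat q 2) (M := Fin n → ℕ) := by
    refine QMat.algHom_ext fun a b => ?_
    rw [AlgHom.comp_apply, blockInclHom, liftQM_Y, blockHom, liftQM_Y, blockMat_of_mem]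
    · have hi : blockIdx j i = 0 := if_neg hlt.ne
      have hj : blockIdx j j = 1 := if_pos rfl
      have : ∀ a, blockIdx j (blockIncl i j a) = a := by
        intro a
        fin_cases a <;> simp [blockIncl, hi, hj]
      rw [this, this]
      rfl
    · fin_cases a <;> fin_cases b <;> simp [blockIncl, InBlock]
  exact DFunLike.congr_fun h x

/-- A component of the restriction of a derivation to a two by two diagonal block. -/
def blockDer (hij : (j : ℕ) = i + 1) (hlt : i < j) (e : Fin n → ℕ) (D : Der K (QMat q n)) :
    Der K (QMat q 2) :=
  ⟨(varCoeff q e).comp ((blockHom q hij).toLinearMap.comp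
    (D.toLin.comp (blockInclHom q hlt).toLinearMap)), by
    intro a b
    -- The included block maps into degree zero, and taking the coefficient at `e` is linear on both
    -- sides over degree zero, so the Leibniz rule survives.
    simp only [LinearMap.comp_apply, AlgHom.toLinearMap_apply, map_mul, Der.leibniz, map_add,
      blockHom_blockInclHom, varCoeff_apply, AddMonoidAlgebra.coeff_mul_single_zero,
      AddMonoidAlgebra.coeff_single_zero_mul]⟩

theorem blockDer_apply (hij : (j : ℕ) = i + 1) (hlt : i < j) (e : Fin n → ℕ)
    (D : Der K (QMat q n)) (a b : Fin 2) : blockDer hij hlt e D (Y q 2 a b) =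
      varCoeff q e (blockHom q hij (D (Y q n (blockIncl i j a) (blockIncl i j b)))) := by
  change varCoeff q e (blockHom q hij (D (blockInclHom q hlt (Y q 2 a b)))) = _
  rw [blockInclHom, liftQM_Y]

/-- The constraint imposed on leading coefficients by a unit cell on the diagonal. -/
theorem lead_diag_cell (hq : q ≠ 0) (hroot : ∀ m : ℕ, 0 < m → q ^ m ≠ 1)
    (hij : (j : ℕ) = i + 1) (m : ℕ) (D : Der K (QMat q n)) :
    lead hq (m • diagExp n) D (i, i) + lead hq (m • diagExp n) D (j, j) =
      lead hq (m • diagExp n) D (i, j) + lead hq (m • diagExp n) D (j, i) := by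
  have hlt : i < j := by rw [Fin.lt_def]; omega
  have hi : blockIdx j i = 0 := if_neg hlt.ne
  have hj : blockIdx j j = 1 := if_pos rfl
  -- Selects the m-th power of every diagonal variable outside the block, as prescribed by the
  -- exponent m times the diagonal.
  set e : Fin n → ℕ := fun k => if k = i ∨ k = j then 0 else m with he
  have key : ∀ (a b : Fin 2) (u : Fin 2 × Fin 2 → ℕ),
      (∀ p, (u p : ℤ) = m * diagExp 2 p + (Pi.single (a, b) 1 : Fin 2 × Fin 2 → ℤ) p) →
      coef hq (m • diagExp n + Pi.single (blockIncl i j a, blockIncl i j b) 1)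
        (D (Y q n (blockIncl i j a) (blockIncl i j b))) =
      coef hq (fun p => (u p : ℤ)) (blockDer hij hlt e D (Y q 2 a b)) := by
    intro a b u hu
    rw [blockDer_apply, ← coef_blockExp hq hij u (by simp [he])]
    congr 1
    have hinj := (strictMono_blockIncl hlt).injective
    have hin : ∀ a, blockIncl i j a = i ∨ blockIncl i j a = j := by
      intro a
      fin_cases a <;> simp [blockIncl]
    have hidx : ∀ k, (k = i ∨ k = j) → blockIncl i j (blockIdx j k) = k := by
      rintro k (rfl | rfl) <;> simp [hi, hj, blockIncl]
    congr 1
    funext ⟨r, s⟩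
    rw [Pi.add_apply, smul_diagExp_apply, blockExp]
    split_ifs with h1 h2
    · rw [hu]
      have e1 := hidx r h1.1
      have e2 := hidx s h1.2
      simp only [diagExp, Pi.single_apply, Prod.mk.injEq]
      conv_lhs => rw [← e1, ← e2]
      simp only [hinj.eq_iff]
    · simp only at h2
      subst h2
      have h3 : ¬ (r = i ∨ r = j) := fun h => h1 ⟨h, h⟩
      rw [Pi.single_eq_of_ne]
      · simp [diagExp, he, h3]
      · intro h
        rw [Prod.mk.injEq] at h
        exact h3 (h.1 ▸ hin a)
    · rw [Pi.single_eq_of_ne]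
      · simp only at h2
        simp [diagExp, h2]
      · intro h
        rw [Prod.mk.injEq] at h
        exact h1 ⟨h.1 ▸ hin a, h.2 ▸ hin b⟩
  have k00 := key 0 0 (exp2 (m + 1) 0 0 m) (by
    rintro ⟨a, b⟩
    fin_cases a <;> fin_cases b <;> simp [exp2, diagExp])
  have k01 := key 0 1 (exp2 m 1 0 m) (by
    rintro ⟨a, b⟩
    fin_cases a <;> fin_cases b <;> simp [exp2, diagExp])
  have k10 := key 1 0 (exp2 m 0 1 m) (by
    rintro ⟨a, b⟩
    fin_cases a <;> fin_cases b <;> simp [exp2, diagExp])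
  have k11 := key 1 1 (exp2 m 0 0 (m + 1)) (by
    rintro ⟨a, b⟩
    fin_cases a <;> fin_cases b <;> simp [exp2, diagExp])
  have h0 : blockIncl i j 0 = i := rfl
  have h1 : blockIncl i j 1 = j := rfl
  rw [h0] at k00 k01 k10
  rw [h1] at k01 k10 k11
  have hmain := coef2_der_diag hq (blockDer hij hlt e D) hroot m
  simp only [coef2] at hmain
  rw [← k00, ← k01, ← k10, ← k11] at hmain
  -- The normalization of `lead` at (i,j) and (j,i) is thus q^m, exactly the factor occurring in
  -- `coef2_der_diag`.
  have r01 : rightExp (diagExp n) (i, j) = -1 := by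
    rw [rightExp, Finset.sum_eq_single (j, j)]
    · simp [diagExp, comm, hlt.ne', sg, hlt, hlt.not_gt, Prod.Lex.toLex_lt_toLex]
    · rintro ⟨r, s⟩ - h
      by_cases hrs : r = s
      · subst hrs
        have hr : r ≠ j := fun h' => h (by rw [h'])
        by_cases hri : r = i
        · subst hri
          simp [Prod.Lex.toLex_lt_toLex, hlt.not_gt]
        · simp [comm, hr, hri]
      · simp [diagExp, hrs]
    · simp
  have r10 : rightExp (diagExp n) (j, i) = -1 := by
    rw [rightExp, Finset.sum_eq_single (j, j)]
    · simp [diagExp, comm, hlt.ne', sg, hlt, hlt.not_gt, Prod.Lex.toLex_lt_toLex]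
    · rintro ⟨r, s⟩ - h
      by_cases hrs : r = s
      · subst hrs
        have hr : r ≠ j := fun h' => h (by rw [h'])
        by_cases hri : r = i
        · subst hri
          simp [Prod.Lex.toLex_lt_toLex, hlt.not_gt]
        · simp [comm, hr, hri]
      · simp [diagExp, hrs]
    · simp
  simp only [lead, rightExp_smul, rightExp_diagExp_self, r01, r10, mul_zero, neg_zero, zpow_zero,
    one_mul, mul_neg, mul_one, neg_neg, zpow_natCast]
  rw [hmain]
  ring

end DiagonalBlock

end QMatrix

end

noncomputable section

namespace QMatrix

/-! ### Reduction of derivations -/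

section Reduction

variable {K : Type*} [Field K] {q : K} {n : ℕ}

theorem Der.ext_Y {D E : Der K (QMat q n)} (h : ∀ i a, D (Y q n i a) = E (Y q n i a)) : D = E := by
  refine Der.ext fun x => ?_
  have hx : x ∈ Submodule.span K (Set.range (wordProd (Y q n))) := by
    rw [span_wordProd]
    trivial
  have h1 : ∀ F : Der K (QMat q n), F 1 = 0 := by
    intro F
    have := F.leibniz 1 1
    simpa using this
  induction hx using Submodule.span_induction with
  | mem x hx =>
    obtain ⟨l, rfl⟩ := hx
    induction l with
    | nil => rw [wordProd_nil, h1, h1]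
    | cons p l ih => rw [wordProd_cons, Der.leibniz, Der.leibniz, ih, h]
  | zero => rw [map_zero, map_zero]
  | add x y _ _ hx hy => rw [map_add, map_add, hx, hy]
  | smul c x _ hx => rw [map_smul, map_smul, hx]

variable (hq : q ≠ 0)

theorem lead_sub (v : Fin n × Fin n → ℤ) (D E : Der K (QMat q n)) (p : Fin n × Fin n) :
    lead hq v (D - E) p = lead hq v D p - lead hq v E p := by
  rw [lead, lead, lead, Der.sub_apply, map_sub, mul_sub]

theorem lead_zero (v : Fin n × Fin n → ℤ) (p : Fin n × Fin n) :
    lead hq v (0 : Der K (QMat q n)) p = 0 := by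
  rw [lead, Der.zero_apply, map_zero, mul_zero]

variable {hq} {W : Finset (Fin n × Fin n → ℤ)} {v : Fin n × Fin n → ℤ}

theorem SuppIn.sub {D E : Der K (QMat q n)} (hD : SuppIn hq W D) (hE : SuppIn hq W E) :
    SuppIn hq W (D - E) := by
  intro u p h
  rw [Der.sub_apply, map_sub] at h
  by_cases h1 : coef hq (u + Pi.single p 1) (D (Y q n p.1 p.2)) = 0
  · rw [h1, zero_sub, neg_ne_zero] at h
    exact hE u p h
  · exact hD u p h1

theorem suppIn_zero : SuppIn hq W (0 : Der K (QMat q n)) := by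
  intro u p h
  rw [Der.zero_apply, map_zero] at h
  exact absurd rfl h

theorem SuppIn.erase {D : Der K (QMat q n)} (hD : SuppIn hq W D) (h : ∀ p, lead hq v D p = 0) :
    SuppIn hq (W.erase v) D := by
  intro u p hu
  refine Finset.mem_erase.2 ⟨?_, hD u p hu⟩
  rintro rfl
  exact hu (lead_eq_zero_iff.1 (h p))

/-- Exponents of monomials are nonnegative, so after the shift by e_p they are at least -1; this is
the bound built into `LowerClosed`. -/
theorem suppIn_of_mem_leSpan {E : Der K (QMat q n)} (hW : LowerClosed W) (hv : v ∈ W)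
    (hE : ∀ p : Fin n × Fin n, E (Y q n p.1 p.2) ∈ leSpan hq (v + Pi.single p 1)) :
    SuppIn hq W E := by
  intro u p hu
  have h1 := hE p _ hu
  rw [add_sub_add_right_eq_sub] at h1
  have h2 := hW v hv _ h1 fun s => ?_
  · rwa [sub_sub_cancel] at h2
  · rw [sub_sub_cancel]
    by_contra! h
    refine hu (coef_eq_zero_of_neg hq (p := s) ?_ _)
    rw [Pi.add_apply, Pi.single_apply]
    split_ifs <;> omega

/-- A power of the determinant as a central element. -/
def detPow (hq : q ≠ 0) (n m : ℕ) : Subalgebra.center K (QMat q n) :=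
  ⟨detq q n ^ m, pow_mem (detq_mem_center hq) m⟩

theorem detPow_smul_scalingDer_apply (m : ℕ) (r c : Fin n → K) (p : Fin n × Fin n) :
    (detPow hq n m • scalingDer q n r c) (Y q n p.1 p.2) =
      (r p.1 + c p.2) • (detq q n ^ m * Y q n p.1 p.2) := by
  rw [Der.smul_apply, scalingDer_Y, mul_smul_comm, detPow]

theorem lead_detPow_smul (m : ℕ) (r c : Fin n → K) (p : Fin n × Fin n) :
    lead hq (m • diagExp n) (detPow hq n m • scalingDer q n r c) p = r p.1 + c p.2 := by
  rw [lead, detPow_smul_scalingDer_apply, map_smul, coef_mul_Y hq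
    (fun z hz h0 => coef_add_eq_zero hq (detq_pow_mem_leSpan hq m) hz h0), coef_detq_pow, mul_one,
    smul_eq_mul, mul_left_comm, ← zpow_add₀ hq, neg_add_cancel, zpow_zero, mul_one]

theorem suppIn_detPow_smul (hW : LowerClosed W) {m : ℕ} (hv : m • diagExp n ∈ W)
    (r c : Fin n → K) : SuppIn hq W (detPow hq n m • scalingDer q n r c) := by
  refine suppIn_of_mem_leSpan hW hv fun p => ?_
  rw [detPow_smul_scalingDer_apply]
  exact Submodule.smul_mem _ _ (mul_mem_leSpan hq (detq_pow_mem_leSpan hq m) (Y_mem_leSpan hq p))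

/-- The normalization cancels the cost of right multiplication, and left multiplication costs the
additional factor q^eps. This is the solution of `SuppIn.lead_mul` that inner derivations provide.
-/
theorem lead_ad_mono (u : Fin n × Fin n → ℕ) (κ : K) (p : Fin n × Fin n) :
    lead hq (fun p => (u p : ℤ)) (ad K (κ • mono q u)) p =
      κ * (1 - q ^ eps p fun p => (u p : ℤ)) := by
  have htop : ∀ z ∈ cone n, z ≠ 0 → coef hq ((fun p => (u p : ℤ)) + z) (mono q u) = 0 :=
    fun z hz h0 => coef_add_eq_zero hq (mono_mem_leSpan hq u) hz h0
  have h1 : coef hq (fun p => (u p : ℤ)) (mono q u) = 1 := by rw [coef_mono, if_pos rfl]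
  rw [lead, ad_apply, map_sub, smul_mul_assoc, mul_smul_comm, map_smul, map_smul,
    coef_mul_Y hq htop, coef_Y_mul hq htop, h1, leftExp_eq, zpow_add₀ hq, mul_one, mul_one,
    zpow_neg, smul_eq_mul, smul_eq_mul, ← mul_sub, mul_left_comm]
  congr 1
  have := zpow_ne_zero (rightExp (fun p => (u p : ℤ)) p) hq
  field_simp

theorem suppIn_ad_mono (hW : LowerClosed W) {u : Fin n × Fin n → ℕ}
    (hv : (fun p => (u p : ℤ)) ∈ W) (κ : K) : SuppIn hq W (ad K (κ • mono q u)) := by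
  refine suppIn_of_mem_leSpan hW hv fun p => ?_
  rw [ad_apply, smul_mul_assoc, mul_smul_comm]
  refine sub_mem (Submodule.smul_mem _ _ (mul_mem_leSpan hq (mono_mem_leSpan hq u)
    (Y_mem_leSpan hq p))) (Submodule.smul_mem _ _ ?_)
  rw [add_comm]
  exact mul_mem_leSpan hq (Y_mem_leSpan hq p) (mono_mem_leSpan hq u)

theorem eq_of_adjacent {α : Type*} {g : Fin n → α} (h : ∀ a b : Fin n, (b : ℕ) = a + 1 → g a = g b)
    (a b : Fin n) : g a = g b := by
  have key : ∀ (k : ℕ) (hk : k < n), g ⟨0, by omega⟩ = g ⟨k, hk⟩ := by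
    intro k hk
    induction k with
    | zero => rfl
    | succ k ih => exact (ih (by omega)).trans (h _ _ rfl)
  exact (key a a.2).symm.trans (key b b.2)

/-- Vanishing of the mixed difference on unit cells propagates to all rectangles; normalizing at the
first row and column splits `f`. -/
theorem exists_add_of_cells {f : Fin n × Fin n → K}
    (h : ∀ i j α β : Fin n, (j : ℕ) = i + 1 → (β : ℕ) = α + 1 →
      f (i, α) + f (j, β) = f (i, β) + f (j, α)) :
    ∃ r c : Fin n → K, ∀ p, f p = r p.1 + c p.2 := by
  rcases Nat.eq_zero_or_pos n with rfl | hn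
  · exact ⟨0, 0, fun p => p.1.elim0⟩
  set o : Fin n := ⟨0, hn⟩
  have h1 : ∀ i j α β : Fin n, (j : ℕ) = i + 1 → f (i, α) - f (j, α) = f (i, β) - f (j, β) :=
    fun i j α β hij => eq_of_adjacent (g := fun α => f (i, α) - f (j, α))
      (fun a b hab => by linear_combination h i j a b hij hab) α β
  have h2 : ∀ i j α β : Fin n, f (i, α) - f (i, β) = f (j, α) - f (j, β) :=
    fun i j α β => eq_of_adjacent (g := fun i => f (i, α) - f (i, β))
      (fun a b hab => by linear_combination h1 a b α β hab) i j
  refine ⟨fun i => f (i, o), fun α => f (o, α) - f (o, o), fun ⟨i, α⟩ => ?_⟩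
  linear_combination h2 i o α o

/-! ### Cell identities and excluded exponents at the top of the support. -/

section Top

variable {D : Der K (QMat q n)} (hroot : ∀ m : ℕ, 0 < m → q ^ m ≠ 1) (hD : SuppIn hq W D)
  (htop : ∀ z ∈ cone n, z ≠ 0 → v + z ∉ W)

theorem sub_inv_ne_zero (hq : q ≠ 0) (hroot : ∀ m : ℕ, 0 < m → q ^ m ≠ 1) : q - q⁻¹ ≠ 0 := by
  intro h
  refine hroot 2 two_pos ?_
  rw [sub_eq_zero] at h
  rw [pow_two]
  nth_rewrite 2 [h]
  exact mul_inv_cancel₀ hq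

include hroot hD htop

/-- At a multiple of the diagonal exponent, the leading coefficients of a derivation agree with
those of a multiple of a scaling derivation. -/
theorem SuppIn.lead_cell (hW : LowerClosed W) {m : ℕ} (hvm : v = m • diagExp n) (hv : v ∈ W)
    (heps : ∀ p, eps p v = 0) {i j α β : Fin n} (hij : (j : ℕ) = i + 1) (hab : (β : ℕ) = α + 1) :
    lead hq v D (i, α) + lead hq v D (j, β) = lead hq v D (i, β) + lead hq v D (j, α) := by
  have hji : j ≠ i := fun h => by rw [h] at hij; omega
  by_cases hia : i = α
  · subst hia
    obtain rfl : j = β := Fin.ext (by omega)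
    rw [hvm]
    exact lead_diag_cell hq hroot hij m D
  -- Row scalings by the leads at (i,α) and (j,β) make these two leads of `D - E` zero. The leads of
  -- `E` at (i,β) and (j,α) are then the same two numbers, so the cell identity follows once the
  -- leads of `D - E` there add up to zero.
  set E := detPow hq n m • scalingDer q n
    (Pi.single i (lead hq v D (i, α)) + Pi.single j (lead hq v D (j, β))) 0 with hE
  have hEl : ∀ p, lead hq v E p =
      (Pi.single i (lead hq v D (i, α)) + Pi.single j (lead hq v D (j, β)) : Fin n → K) p.1 := by
    intro p
    rw [hE]
    nth_rewrite 1 [hvm]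
    rw [lead_detPow_smul, Pi.zero_apply, add_zero]
  have hF : SuppIn hq W (D - E) := hD.sub (suppIn_detPow_smul hW (hvm ▸ hv) _ _)
  have hoff : ∀ p : Fin n × Fin n, p.1 ≠ p.2 → v p ≤ 0 := by
    intro p hp
    rw [hvm, smul_diagExp_apply, diagExp, if_neg hp, mul_zero]
  have hfin : lead hq v (D - E) (i, β) + lead hq v (D - E) (j, α) = 0 := by
    have hla : lead hq v (D - E) (i, α) = 0 := by
      rw [lead_sub, hEl]
      simp [hji.symm]
    have hld : lead hq v (D - E) (j, β) = 0 := by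
      rw [lead_sub, hEl]
      simp [hji]
    have hia' : (i : ℕ) ≠ α := fun h => hia (Fin.ext h)
    -- The quadrants point away from the diagonal, on the side where the cell lies, so `v` vanishes
    -- on them.
    rcases lt_or_gt_of_ne hia' with hlt | hlt
    · refine hF.lead_add_lead htop (sub_inv_ne_zero hq hroot) heps hij hab
        (isQuadrant_upper _ _) (isQuadrant_upper (j + 1) β) (isQuadrant_upper j α)
        (by omega) (by omega) (fun p hp => ?_) (fun p hp => ?_) (fun h => ?_) (fun h => ?_)
        (fun p hp => hoff p fun h => ?_) (fun p hp => hoff p fun h => ?_) hla hld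
      all_goals simp only [mem_upper] at *
      all_goals omega
    · refine hF.lead_add_lead htop (sub_inv_ne_zero hq hroot) heps hij hab
        (isQuadrant_lower _ _) (isQuadrant_lower j (β + 1)) (isQuadrant_lower i β)
        (by omega) (by omega) (fun p hp => ?_) (fun p hp => ?_) (fun h => ?_) (fun h => ?_)
        (fun p hp => hoff p fun h => ?_) (fun p hp => hoff p fun h => ?_) hla hld
      all_goals simp only [mem_lower] at *
      all_goals omega
  rw [lead_sub, lead_sub, hEl, hEl] at hfin
  simp only [Pi.add_apply, Pi.single_eq_same, Pi.single_eq_of_ne hji, Pi.single_eq_of_ne hji.symm,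
    add_zero, zero_add] at hfin
  linear_combination -hfin

/-- Leading exponents with a negative entry do not occur. -/
theorem SuppIn.lead_eq_zero_of_neg (hn : 1 < n) (heps : ∀ p, eps p v = 0) {s : Fin n × Fin n}
    (hs : v s < 0) : lead hq v D s = 0 := by
  by_contra hne
  have hother : ∀ r, r ≠ s → lead hq v D r = 0 := by
    intro r hr
    rw [lead_eq_zero_iff]
    refine coef_eq_zero_of_neg hq (p := s) ?_ _
    rw [Pi.add_apply, Pi.single_eq_of_ne hr.symm, add_zero]
    exact hs
  have hnn : ∀ r, 0 ≤ (v + Pi.single s 1 : Fin n × Fin n → ℤ) r := by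
    intro r
    by_contra! h
    exact hne (lead_eq_zero_iff.2 (coef_eq_zero_of_neg hq h _))
  have hpos : ∀ r, r ≠ s → 0 ≤ v r := by
    intro r hr
    have := hnn r
    rwa [Pi.add_apply, Pi.single_eq_of_ne hr, add_zero] at this
  have hvs : v s = -1 := by
    have := hnn s
    rw [Pi.add_apply, Pi.single_eq_same] at this
    omega
  obtain ⟨i, α⟩ := s
  obtain ⟨o, ho⟩ : ∃ o : Fin n, (o : ℕ) = 0 := ⟨⟨0, by omega⟩, rfl⟩
  obtain ⟨t, ht⟩ : ∃ t : Fin n, (t : ℕ) = n - 1 := ⟨⟨n - 1, by omega⟩, rfl⟩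
  -- The entry -1 would be repeated along its diagonal, while all other entries are nonnegative; so
  -- its diagonal has length one and it sits in a corner off the main diagonal.
  have hlast : (i : ℕ) = n - 1 ∨ (α : ℕ) = n - 1 := by
    by_contra! h
    have hi := i.2
    have hα := α.2
    have h1 := eq_of_eps_eq_zero heps (i := i) (a := α) (j := ⟨i + 1, by omega⟩)
      (b := ⟨α + 1, by omega⟩) rfl rfl
    have h2 := hpos (⟨i + 1, by omega⟩, ⟨α + 1, by omega⟩)
      (fun h => by simpa using congrArg (fun p => (p.1 : ℕ)) h)
    omega
  have hfirst : (i : ℕ) = 0 ∨ (α : ℕ) = 0 := by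
    by_contra! h
    have h1 := eq_of_eps_eq_zero heps (i := ⟨i - 1, by omega⟩) (a := ⟨α - 1, by omega⟩) (j := i)
      (b := α) (by simp; omega) (by simp; omega)
    have h2 := hpos (⟨i - 1, by omega⟩, ⟨α - 1, by omega⟩)
      (fun h' => by
        have := congrArg (fun p => (p.1 : ℕ)) h'
        simp at this
        omega)
    omega
  have hcorner : ((i : ℕ) = 0 ∧ (α : ℕ) = n - 1) ∨ ((i : ℕ) = n - 1 ∧ (α : ℕ) = 0) := by omega
  have hepsT : ∀ p, eps p (fun s => v s.swap) = 0 := by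
    intro p
    rw [← heps p.swap, ← eps_transpose v p.swap, Prod.swap_swap]
  rcases Nat.lt_or_ge 2 n with h3 | h3
  · rcases hcorner with ⟨hi, hα⟩ | ⟨hi, hα⟩
    · obtain ⟨j, hj⟩ : ∃ j : Fin n, (j : ℕ) = 1 := ⟨⟨1, by omega⟩, rfl⟩
      obtain ⟨γ, hγ⟩ : ∃ γ : Fin n, (γ : ℕ) = n - 2 := ⟨⟨n - 2, by omega⟩, rfl⟩
      -- The wrap-around condition pairs v(0,n-2) with v(n-1,n-3). Both are nonnegative, so both
      -- vanish, and `v` is nonpositive on the two corner quadrants needed for the corner cell; the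
      -- other three leads of that cell are zero.
      have e1 := add_eq_zero_of_eps_eq_zero heps (o := o) (t := t) (a := ⟨n - 3, by omega⟩)
        (b := γ) ho ht (by simp [hγ]; omega)
      have e2 := hpos (o, γ) (fun h => by
        have := congrArg (fun p => (p.2 : ℕ)) h
        simp [hγ] at this
        omega)
      have e3 := hpos (t, ⟨n - 3, by omega⟩) (fun h => by
        have := congrArg (fun p => (p.2 : ℕ)) h
        simp at this
        omega)
      have e4 : v (o, γ) = 0 := by omega
      have e5 : v (j, α) = 0 := by
        rw [← eq_of_eps_eq_zero heps (i := o) (a := γ) (by omega) (by omega), e4]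
      obtain rfl : o = i := Fin.ext (by omega)
      have hval : ∀ p : Fin n × Fin n, (p.1 : ℕ) < 2 → n - 2 ≤ p.2 →
          (p.1 = o ∨ p.2 = α) → v p ≤ 0 := by
        rintro ⟨r, c⟩ h1 h2 h
        simp only at h1 h2 h
        rcases h with rfl | rfl
        · by_cases hc : c = α
          · rw [hc, hvs]
            norm_num
          · obtain rfl : c = γ := Fin.ext (by
              have := c.2
              have : (c : ℕ) ≠ α := fun h => hc (Fin.ext h)
              omega)
            rw [e4]
        · by_cases hr : r = o
          · rw [hr, hvs]
            norm_num
          · obtain rfl : r = j := Fin.ext (by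
              have : (r : ℕ) ≠ o := fun h => hr (Fin.ext h)
              omega)
            rw [e5]
      have hfin := hD.lead_add_lead htop (sub_inv_ne_zero hq hroot) heps (i := o) (j := j)
        (α := γ) (β := α) (by omega) (by omega)
        (isQuadrant_upper _ _) (isQuadrant_upper (j + 1) α) (isQuadrant_upper j γ)
        (by omega) (by omega)
        (fun p hp => by simp only [mem_upper] at *; omega)
        (fun p hp => by simp only [mem_upper, hγ] at *; omega)
        (fun h => by simp only [mem_upper, hγ] at h; omega)
        (fun h => by simp only [mem_upper] at h; omega)
        (fun p hp => by
          simp only [mem_upper, hj] at hp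
          exact hval p (by omega) (by omega) (Or.inr (Fin.ext (by have := p.2.2; omega))))
        (fun p hp => by
          simp only [mem_upper, hj, hγ] at hp
          exact hval p (by omega) (by omega) (Or.inl (Fin.ext (by omega))))
        (hother _ fun h => by
          have := congrArg (fun p => (p.2 : ℕ)) h
          simp [hγ] at this
          omega)
        (hother _ fun h => by simpa [hj, ho] using congrArg (fun p => (p.1 : ℕ)) h)
      rw [hother (j, γ) fun h => by simpa [hj, ho] using congrArg (fun p => (p.1 : ℕ)) h,
        add_zero] at hfin
      exact hne hfin
    · obtain ⟨β, hβ⟩ : ∃ β : Fin n, (β : ℕ) = 1 := ⟨⟨1, by omega⟩, rfl⟩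
      obtain ⟨k, hk⟩ : ∃ k : Fin n, (k : ℕ) = n - 2 := ⟨⟨n - 2, by omega⟩, rfl⟩
      -- The opposite corner is handled by the wrap-around condition for the transposed exponent.
      have e1 := add_eq_zero_of_eps_eq_zero hepsT (o := o) (t := t) (a := ⟨n - 3, by omega⟩)
        (b := k) ho ht (by simp [hk]; omega)
      simp only [Prod.swap_prod_mk] at e1
      have e2 := hpos (k, o) (fun h => by
        have := congrArg (fun p => (p.1 : ℕ)) h
        simp [hk] at this
        omega)
      have e3 := hpos (⟨n - 3, by omega⟩, t) (fun h => by
        have := congrArg (fun p => (p.1 : ℕ)) h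
        simp at this
        omega)
      have e4 : v (k, o) = 0 := by omega
      have e5 : v (i, β) = 0 := by
        rw [← eq_of_eps_eq_zero heps (i := k) (a := o) (by omega) (by omega), e4]
      obtain rfl : o = α := Fin.ext (by omega)
      have hval : ∀ p : Fin n × Fin n, (p.2 : ℕ) < 2 → n - 2 ≤ p.1 →
          (p.2 = o ∨ p.1 = i) → v p ≤ 0 := by
        rintro ⟨r, c⟩ h1 h2 h
        simp only at h1 h2 h
        rcases h with rfl | rfl
        · by_cases hr : r = i
          · rw [hr, hvs]
            norm_num
          · obtain rfl : r = k := Fin.ext (by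
              have := r.2
              have : (r : ℕ) ≠ i := fun h => hr (Fin.ext h)
              omega)
            rw [e4]
        · by_cases hc : c = o
          · rw [hc, hvs]
            norm_num
          · obtain rfl : c = β := Fin.ext (by
              have : (c : ℕ) ≠ o := fun h => hc (Fin.ext h)
              omega)
            rw [e5]
      have hfin := hD.lead_add_lead htop (sub_inv_ne_zero hq hroot) heps (i := k) (j := i)
        (α := o) (β := β) (by omega) (by omega)
        (isQuadrant_lower _ _) (isQuadrant_lower i (β + 1)) (isQuadrant_lower k β)
        (by omega) (by omega)
        (fun p hp => by simp only [mem_lower] at *; omega)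
        (fun p hp => by simp only [mem_lower, hk] at *; omega)
        (fun h => by simp only [mem_lower, hk] at h; omega)
        (fun h => by simp only [mem_lower] at h; omega)
        (fun p hp => by
          simp only [mem_lower, hβ] at hp
          exact hval p (by omega) (by omega) (Or.inr (Fin.ext (by have := p.1.2; omega))))
        (fun p hp => by
          simp only [mem_lower, hβ, hk] at hp
          exact hval p (by omega) (by omega) (Or.inl (Fin.ext (by omega))))
        (hother _ fun h => by
          have := congrArg (fun p => (p.1 : ℕ)) h
          simp [hk] at this
          omega)
        (hother _ fun h => by simpa [hβ, ho] using congrArg (fun p => (p.2 : ℕ)) h)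
      rw [hother (k, β) fun h => by simpa [hβ, ho] using congrArg (fun p => (p.2 : ℕ)) h,
        zero_add] at hfin
      exact hne hfin
  -- For n = 2 the diagonals next to the corner are the main diagonal, so the quadrant argument is
  -- unavailable and the two by two computation replaces it.
  · obtain rfl : n = 2 := by omega
    have e1 := add_eq_zero_of_eps_eq_zero heps (o := 0) (t := 1) (a := 0) (b := 1) rfl rfl rfl
    have e2 := eq_of_eps_eq_zero heps (i := 0) (j := 1) (a := 0) (b := 1) rfl rfl
    have e3 : 0 ≤ v (0, 0) := hpos (0, 0) (fun h => by
      rw [Prod.mk.injEq] at h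
      obtain ⟨rfl, rfl⟩ := h
      simp at hlast)
    obtain ⟨m, hm⟩ := Int.eq_ofNat_of_zero_le e3
    rcases hcorner with ⟨hi, hα⟩ | ⟨hi, hα⟩
    · obtain rfl : i = 0 := Fin.ext hi
      obtain rfl : α = 1 := Fin.ext hα
      have hexp : v + Pi.single (0, 1) 1 = fun p => (exp2 m 0 1 m p : ℤ) := by
        funext ⟨r, c⟩
        fin_cases r <;> fin_cases c <;> simp [exp2] <;> omega
      have h1 := (coef2_der_corner hq D hroot m).1
      rw [coef2, ← hexp] at h1
      exact hne (lead_eq_zero_iff.2 h1)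
    · obtain rfl : i = 1 := Fin.ext hi
      obtain rfl : α = 0 := Fin.ext hα
      have hexp : v + Pi.single (1, 0) 1 = fun p => (exp2 m 1 0 m p : ℤ) := by
        funext ⟨r, c⟩
        fin_cases r <;> fin_cases c <;> simp [exp2] <;> omega
      have h1 := (coef2_der_corner hq D hroot m).2
      rw [coef2, ← hexp] at h1
      exact hne (lead_eq_zero_iff.2 h1)

end Top

end Reduction

end QMatrix

end

noncomputable section

namespace QMatrix

/-! ### Generation of derivations and uniqueness -/

/-! ### Inner and scaling derivations generate all derivations. -/

section Generation

variable {K : Type*} [Field K] {q : K} {n : ℕ}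

/-- The module spanned by the inner derivations and the scaling derivations. -/
def innScaling (q : K) (n : ℕ) : Submodule (Subalgebra.center K (QMat q n)) (Der K (QMat q n)) :=
  InnDer K (QMat q n) ⊔ Submodule.span _ (Set.range fun rc : (Fin n → K) × (Fin n → K) =>
    scalingDer q n rc.1 rc.2)

theorem ad_mem_innScaling (x : QMat q n) : ad K x ∈ innScaling q n :=
  Submodule.mem_sup_left ⟨x, rfl⟩

theorem smul_scalingDer_mem_innScaling (z : Subalgebra.center K (QMat q n)) (r c : Fin n → K) :
    z • scalingDer q n r c ∈ innScaling q n :=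
  Submodule.smul_mem _ _ (Submodule.mem_sup_right (Submodule.subset_span ⟨(r, c), rfl⟩))

variable (hq : q ≠ 0) (hroot : ∀ m : ℕ, 0 < m → q ^ m ≠ 1) (hn : 1 < n)

include hroot hn

/-- A nonzero family of leads must come from an inner derivation if some `eps p v` is nonzero, and
from a power of the determinant times a scaling derivation if all vanish. -/
theorem exists_lead_eq {W : Finset (Fin n × Fin n → ℤ)} {v : Fin n × Fin n → ℤ}
    (hW : LowerClosed W) (hv : v ∈ W) (htop : ∀ z ∈ cone n, z ≠ 0 → v + z ∉ W)
    {D : Der K (QMat q n)} (hD : SuppIn hq W D) :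
    ∃ E ∈ innScaling q n, SuppIn hq W E ∧ ∀ p, lead hq v E p = lead hq v D p := by
  have hzero : (∀ p, lead hq v D p = 0) →
      ∃ E ∈ innScaling q n, SuppIn hq W E ∧ ∀ p, lead hq v E p = lead hq v D p := fun h =>
    ⟨0, zero_mem _, suppIn_zero, fun p => by rw [lead_zero, h]⟩
  have hother : ∀ s, v s < 0 → ∀ r, r ≠ s → lead hq v D r = 0 := by
    intro s hs r hr
    rw [lead_eq_zero_iff]
    refine coef_eq_zero_of_neg hq (p := s) ?_ _
    rw [Pi.add_apply, Pi.single_eq_of_ne hr.symm, add_zero]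
    exact hs
  by_cases heps : ∀ p, eps p v = 0
  · by_cases hnn : ∀ p, 0 ≤ v p
    · obtain ⟨m, hm⟩ := eq_smul_diagExp heps hnn
      obtain ⟨r, c, hrc⟩ := exists_add_of_cells (f := lead hq v D)
        fun i j α β hij hab => hD.lead_cell hroot htop hW hm hv heps hij hab
      refine ⟨detPow hq n m • scalingDer q n r c, smul_scalingDer_mem_innScaling _ r c,
        suppIn_detPow_smul hW (hm ▸ hv) r c, fun p => ?_⟩
      rw [hrc]
      nth_rewrite 1 [hm]
      rw [lead_detPow_smul]
    · push Not at hnn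
      obtain ⟨s, hs⟩ := hnn
      refine hzero fun r => ?_
      by_cases hr : r = s
      · rw [hr]
        exact hD.lead_eq_zero_of_neg hroot htop hn heps hs
      · exact hother s hs r hr
  · push Not at heps
    obtain ⟨p, hp⟩ := heps
    have hp1 : 1 - q ^ eps p v ≠ 0 := fun h =>
      hp ((zpow_eq_one_iff_of_not_root hroot _).1 (sub_eq_zero.1 h).symm)
    set κ := lead hq v D p / (1 - q ^ eps p v) with hκ
    have hlead : ∀ r, lead hq v D r = κ * (1 - q ^ eps r v) := by
      intro r
      rw [hκ, div_mul_eq_mul_div, eq_div_iff hp1, hD.lead_mul htop]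
    by_cases hκ0 : κ = 0
    · exact hzero fun r => by rw [hlead, hκ0, zero_mul]
    have hnn : ∀ s, 0 ≤ v s := by
      by_contra! hs
      obtain ⟨s, hs⟩ := hs
      -- If v s < 0, a lead can be nonzero only at `s`, so `eps` vanishes elsewhere. Skew-symmetry
      -- then gives v s * eps s v = 0, contradicting the choice of `p`.
      have h1 : ∀ r, r ≠ s → eps r v = 0 := by
        intro r hr
        have h2 := hother s hs r hr
        rw [hlead] at h2
        have h3 := (mul_eq_zero.1 h2).resolve_left hκ0
        exact (zpow_eq_one_iff_of_not_root hroot _).1 (sub_eq_zero.1 h3).symm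
      have h4 := sum_mul_eps_self v
      rw [Finset.sum_eq_single s (fun r _ hr => by rw [h1 r hr, mul_zero]) (by simp)] at h4
      have h5 : eps s v = 0 := (mul_eq_zero.1 h4).resolve_left hs.ne
      by_cases hps : p = s
      · exact hp (hps ▸ h5)
      · exact hp (h1 p hps)
    have hu : (fun p => (((v p).toNat : ℕ) : ℤ)) = v := funext fun p => Int.toNat_of_nonneg (hnn p)
    refine ⟨ad K (κ • mono q fun p => (v p).toNat), ad_mem_innScaling _,
      suppIn_ad_mono hW (hu.symm ▸ hv) κ, fun r => ?_⟩
    have h6 := lead_ad_mono (hq := hq) (fun p => (v p).toNat) κ r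
    rw [hu] at h6
    rw [h6, hlead]

theorem innScaling_eq_top (hq : q ≠ 0) : innScaling q n = ⊤ := by
  rw [eq_top_iff]
  rintro D -
  have hfin : {v : Fin n × Fin n → ℤ | ∃ p : Fin n × Fin n,
      coef hq (v + Pi.single p 1) (D (Y q n p.1 p.2)) ≠ 0}.Finite := by
    rw [Set.ofPred_exists]
    refine Set.finite_iUnion fun p => ?_
    exact (finite_coef_ne_zero hq (D (Y q n p.1 p.2))).preimage (add_left_injective _).injOn
  obtain ⟨W, hDW, hW⟩ := exists_lowerClosed hfin
  have hD : SuppIn hq W D := fun v p h => hDW ⟨p, h⟩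
  clear hDW hfin
  revert D
  refine LowerClosed.induction (P := fun W => ∀ D, SuppIn hq W D → D ∈ innScaling q n) ?_ ?_ hW
  · intro D hD
    have : D = 0 := Der.ext_Y fun i a => by
      rw [Der.zero_apply]
      refine eq_zero_of_coef hq fun w => ?_
      by_contra h
      have := hD (w - Pi.single (i, a) 1) (i, a) (by rwa [sub_add_cancel])
      simp at this
    rw [this]
    exact zero_mem _
  · intro W hW v hv htop ih D hD
    obtain ⟨E, hE, hEW, hlead⟩ := exists_lead_eq hq hroot hn hW hv htop hD
    have h1 := ih (D - E) ((hD.sub hEW).erase fun p => by rw [lead_sub, hlead, sub_self])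
    have := add_mem h1 hE
    rwa [sub_add_cancel] at this

end Generation

/-! ### The listed derivations span the scaling derivations and are independent modulo inner ones.
-/

section Basis

variable {K : Type*} [Field K] (q : K) (n : ℕ)

/-- The eigenvalue of the derivation `D q n j` on `Y p`. -/
def weight (K : Type*) [Field K] (n : ℕ) (j : Fin (2 * n - 1)) (p : Fin n × Fin n) : K :=
  if (j : ℕ) + 1 < n then if (p.2 : ℕ) = n - 1 - j then 1 else 0
  else if (j : ℕ) + 1 = n then
    (if (p.1 : ℕ) = 0 then 1 else 0) + (if (p.2 : ℕ) = 0 then 1 else 0) - 1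
  else if (p.1 : ℕ) = j + 1 - n then 1 else 0

variable {q n}

theorem Der.sum_apply {A ι : Type*} [Ring A] [Algebra K A] (s : Finset ι) (F : ι → Der K A)
    (x : A) : (∑ i ∈ s, F i) x = ∑ i ∈ s, F i x := by
  classical
  induction s using Finset.induction_on with
  | empty => rw [Finset.sum_empty, Finset.sum_empty, Der.zero_apply]
  | insert a s ha ih => rw [Finset.sum_insert ha, Finset.sum_insert ha, Der.add_apply, ih]

theorem sum_rowDer_Y (i a : Fin n) : (∑ k, rowDer q n k) (Y q n i a) = Y q n i a := by
  rw [Der.sum_apply]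
  simp [rowDer_Y]

theorem sum_colDer_Y (i a : Fin n) : (∑ k, colDer q n k) (Y q n i a) = Y q n i a := by
  rw [Der.sum_apply]
  simp [colDer_Y]

theorem D_Y (j : Fin (2 * n - 1)) (p : Fin n × Fin n) :
    D q n j (Y q n p.1 p.2) = weight K n j p • Y q n p.1 p.2 := by
  rw [D, weight]
  by_cases h1 : (j : ℕ) + 1 < n
  · rw [if_pos h1, if_pos h1, colDer_Y]
    simp only [Fin.ext_iff, ite_smul, one_smul, zero_smul]
  · rw [if_neg h1, if_neg h1]
    by_cases h2 : (j : ℕ) + 1 = n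
    · rw [if_pos h2, if_pos h2, Der.sub_apply, Der.add_apply, rowDer_Y, colDer_Y, sum_rowDer_Y]
      simp only [Fin.ext_iff, sub_smul, add_smul, ite_smul, one_smul, zero_smul]
    · rw [if_neg h2, if_neg h2, rowDer_Y]
      simp only [Fin.ext_iff, ite_smul, one_smul, zero_smul]

/-- The span of the derivations `D q n j`. -/
def spanD (q : K) (n : ℕ) : Submodule (Subalgebra.center K (QMat q n)) (Der K (QMat q n)) :=
  Submodule.span _ (Set.range (D q n))

theorem colDer_mem_spanD_of_pos {a : Fin n} (ha : 0 < (a : ℕ)) : colDer q n a ∈ spanD q n := by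
  have h := a.2
  refine Submodule.subset_span ⟨⟨n - 1 - a, by omega⟩, ?_⟩
  rw [D, if_pos (by simp only; omega)]
  congr 1
  exact Fin.ext (by simp only; omega)

theorem rowDer_mem_spanD_of_pos {i : Fin n} (hi : 0 < (i : ℕ)) : rowDer q n i ∈ spanD q n := by
  have h := i.2
  refine Submodule.subset_span ⟨⟨n - 1 + i, by omega⟩, ?_⟩
  rw [D, if_neg (by simp only; omega), if_neg (by simp only; omega)]
  congr 1
  exact Fin.ext (by simp only; omega)

theorem sum_rowDer_eq_sum_colDer : ∑ k, rowDer q n k = ∑ k, colDer q n k :=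
  Der.ext_Y fun i a => by rw [sum_rowDer_Y, sum_colDer_Y]

/-- The first column derivation is the exceptional D_n plus all row derivations except the first. -/
theorem colDer_mem_spanD (a : Fin n) : colDer q n a ∈ spanD q n := by
  by_cases ha : 0 < (a : ℕ)
  · exact colDer_mem_spanD_of_pos ha
  have ha0 : (a : ℕ) = 0 := by omega
  have hn := a.2
  have h1 : rowDer q n a + colDer q n a - ∑ i, rowDer q n i ∈ spanD q n := by
    refine Submodule.subset_span ⟨⟨n - 1, by omega⟩, ?_⟩
    rw [D, if_neg (by simp only; omega), if_pos (by simp only; omega)]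
    have : (⟨0, by omega⟩ : Fin n) = a := Fin.ext ha0.symm
    rw [this]
  have h2 : ∑ i ∈ Finset.univ.erase a, rowDer q n i ∈ spanD q n := by
    refine Submodule.sum_mem _ fun i hi => rowDer_mem_spanD_of_pos ?_
    have : (i : ℕ) ≠ a := fun h => Finset.ne_of_mem_erase hi (Fin.ext h)
    omega
  rw [← Finset.add_sum_erase _ _ (Finset.mem_univ a)] at h1
  have := add_mem h1 h2
  convert this using 1
  abel

/-- The row derivations and the column derivations have the same sum, which fixes every generator;
this recovers the first row derivation. -/
theorem rowDer_mem_spanD (i : Fin n) : rowDer q n i ∈ spanD q n := by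
  by_cases hi : 0 < (i : ℕ)
  · exact rowDer_mem_spanD_of_pos hi
  have h1 : ∑ k, colDer q n k ∈ spanD q n := Submodule.sum_mem _ fun a _ => colDer_mem_spanD a
  have h2 : ∑ k ∈ Finset.univ.erase i, rowDer q n k ∈ spanD q n := by
    refine Submodule.sum_mem _ fun k hk => rowDer_mem_spanD_of_pos ?_
    have : (k : ℕ) ≠ i := fun h => Finset.ne_of_mem_erase hk (Fin.ext h)
    omega
  rw [← sum_rowDer_eq_sum_colDer, ← Finset.add_sum_erase _ _ (Finset.mem_univ i)] at h1
  exact (Submodule.add_mem_iff_left _ h2).1 h1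

theorem scalingDer_mem_spanD (r c : Fin n → K) : scalingDer q n r c ∈ spanD q n := by
  have h : scalingDer q n r c =
      ∑ i, algebraMap K (Subalgebra.center K (QMat q n)) (r i) • rowDer q n i +
        ∑ a, algebraMap K (Subalgebra.center K (QMat q n)) (c a) • colDer q n a := by
    refine Der.ext_Y fun i a => ?_
    rw [scalingDer_Y, Der.add_apply, Der.sum_apply, Der.sum_apply]
    simp only [Der.smul_apply, rowDer_Y, colDer_Y, mul_ite, mul_zero, Finset.sum_ite_eq,
      Finset.mem_univ, if_true, Subalgebra.coe_algebraMap]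
    rw [← Algebra.smul_def, ← Algebra.smul_def, add_smul]
  rw [h]
  exact add_mem (Submodule.sum_mem _ fun i _ => Submodule.smul_mem _ _ (rowDer_mem_spanD i))
    (Submodule.sum_mem _ fun a _ => Submodule.smul_mem _ _ (colDer_mem_spanD a))

theorem exists_decomposition (hq : q ≠ 0) (hroot : ∀ m : ℕ, 0 < m → q ^ m ≠ 1) (hn : 1 < n)
    (δ : Der K (QMat q n)) : ∃ E ∈ InnDer K (QMat q n),
      ∃ μ : Fin (2 * n - 1) → Subalgebra.center K (QMat q n), δ = E + ∑ j, μ j • D q n j := by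
  have h1 : δ ∈ innScaling q n := by
    rw [innScaling_eq_top hroot hn hq]
    trivial
  obtain ⟨E, hE, F, hF, rfl⟩ := Submodule.mem_sup.1 h1
  have h2 : F ∈ spanD q n := by
    refine Submodule.span_le.2 ?_ hF
    rintro _ ⟨rc, rfl⟩
    exact scalingDer_mem_spanD rc.1 rc.2
  obtain ⟨μ, rfl⟩ := (Submodule.mem_span_range_iff_exists_fun _).1 h2
  exact ⟨E, hE, μ, rfl⟩

theorem eps_diagExp (m : ℕ) (p : Fin n × Fin n) : eps p (m • diagExp n) = 0 := by
  obtain ⟨i, a⟩ := p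
  rw [eps_eq]
  simp only [smul_diagExp_apply, diagExp, rowEps]
  simp [sg_swap i a]

theorem coef_smul_diagExp_add_eq_zero (hq : q ≠ 0) (m : ℕ) (x : QMat q n)
    {z : Fin n × Fin n → ℤ} (hz : z ∈ cone n) (h0 : z ≠ 0) :
    coef hq (m • diagExp n + z) x = 0 := by
  by_contra h
  refine h0 (eq_zero_of_add_smul_diagExp_nonneg hz (m := m) fun p => ?_)
  by_contra! h'
  exact h (coef_eq_zero_of_neg hq h' x)

/-- Nothing nonnegative lies above m times the diagonal, so the leading-term formulas apply to every
`x`; since `eps` vanishes on this exponent, the two products have equal coefficients. -/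
theorem coef_ad_eq_zero (hq : q ≠ 0) (m : ℕ) (x : QMat q n) (p : Fin n × Fin n) :
    coef hq (m • diagExp n + Pi.single p 1) (ad K x (Y q n p.1 p.2)) = 0 := by
  have h := fun z hz h0 => coef_smul_diagExp_add_eq_zero (z := z) hq m x hz h0
  rw [ad_apply, map_sub, coef_mul_Y hq h, coef_Y_mul hq h, leftExp_eq, eps_diagExp, add_zero,
    sub_self]

/-- At the corner (0,0) only the exceptional derivation has nonzero weight, namely 1 + 1 - 1. Once
its coefficient is gone, each position in the rest of the first row or column isolates one of the
others. -/
theorem eq_zero_of_sum_weight (hn : 0 < n) {P : Fin (2 * n - 1) → K}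
    (h : ∀ p, ∑ j, weight K n j p * P j = 0) (j : Fin (2 * n - 1)) : P j = 0 := by
  obtain ⟨k, hk⟩ : ∃ k : Fin (2 * n - 1), (k : ℕ) + 1 = n := ⟨⟨n - 1, by omega⟩, by simp; omega⟩
  have hP0 : P k = 0 := by
    have h1 := h (⟨0, hn⟩, ⟨0, hn⟩)
    rw [Finset.sum_eq_single k] at h1
    · rw [weight, if_neg (by omega), if_pos hk] at h1
      simpa using h1
    · intro b _ hb
      have hb' : (b : ℕ) ≠ k := fun h' => hb (Fin.ext h')
      rw [weight]
      split_ifs with h2 h3 h4 h5 h6 <;> simp only at * <;> first | omega | simp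
    · simp
  have key : ∀ p j, weight K n j p = 1 → (∀ b, b ≠ j → b ≠ k → weight K n b p = 0) →
      j ≠ k → P j = 0 := by
    intro p j h1 h2 hjk
    have h3 := h p
    rw [Finset.sum_eq_single j] at h3
    · rwa [h1, one_mul] at h3
    · intro b _ hb
      by_cases hbk : b = k
      · rw [hbk, hP0, mul_zero]
      · rw [h2 b hb hbk, zero_mul]
    · simp
  have hj := j.2
  rcases lt_trichotomy ((j : ℕ) + 1) n with h1 | h1 | h1
  · refine key (⟨0, hn⟩, ⟨n - 1 - j, by omega⟩) j ?_ (fun b hb hbk => ?_) ?_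
    · rw [weight, if_pos h1, if_pos rfl]
    · have hb' : (b : ℕ) ≠ j := fun h' => hb (Fin.ext h')
      have hk' : (b : ℕ) ≠ k := fun h' => hbk (Fin.ext h')
      rw [weight]
      split_ifs with h2 h3 h4 h5 h6 <;> simp only at * <;> omega
    · rintro rfl
      omega
  · obtain rfl : j = k := Fin.ext (by omega)
    exact hP0
  · refine key (⟨j + 1 - n, by omega⟩, ⟨0, hn⟩) j ?_ (fun b hb hbk => ?_) ?_
    · rw [weight, if_neg (by omega), if_neg (by omega), if_pos rfl]
    · have hb' : (b : ℕ) ≠ j := fun h' => hb (Fin.ext h')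
      have hk' : (b : ℕ) ≠ k := fun h' => hbk (Fin.ext h')
      rw [weight]
      split_ifs with h2 h3 h4 h5 h6 <;> simp only at * <;> omega
    · rintro rfl
      omega

/-- At the exponents m·1 + e_p an inner derivation has no coefficient, so the coefficients of the `μ
j` at m·1 satisfy the weight equations and vanish. As the `μ j` are polynomials in the determinant,
these are all their coefficients. -/
theorem eq_zero_of_sum_smul_D_mem_innDer (hq : q ≠ 0) (hroot : ∀ m : ℕ, 0 < m → q ^ m ≠ 1)
    (hn : 0 < n) {μ : Fin (2 * n - 1) → Subalgebra.center K (QMat q n)}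
    (h : ∑ j, μ j • D q n j ∈ InnDer K (QMat q n)) (j : Fin (2 * n - 1)) : μ j = 0 := by
  obtain ⟨x, hx⟩ := h
  have hcoef : ∀ (m : ℕ) j, coef hq (m • diagExp n) (μ j : QMat q n) = 0 := by
    intro m
    refine eq_zero_of_sum_weight hn fun p => ?_
    have h1 := coef_ad_eq_zero hq m x p
    rw [hx, Der.sum_apply, map_sum] at h1
    have h2 : ∀ j, coef hq (m • diagExp n + Pi.single p 1) ((μ j • D q n j) (Y q n p.1 p.2)) =
        q ^ rightExp (m • diagExp n) p *
          (weight K n j p * coef hq (m • diagExp n) (μ j : QMat q n)) := by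
      intro j
      rw [Der.smul_apply, D_Y, mul_smul_comm, map_smul, coef_mul_Y hq
        (fun z hz h0 => coef_smul_diagExp_add_eq_zero hq m _ hz h0), smul_eq_mul]
      ring
    rw [Finset.sum_congr rfl fun j _ => h2 j, ← Finset.mul_sum] at h1
    exact (mul_eq_zero.1 h1).resolve_left (zpow_ne_zero _ hq)
  have hz := (center_eq_adjoin hq hroot).le (μ j).2
  rw [Algebra.adjoin_singleton_eq_range_aeval] at hz
  obtain ⟨f, hf⟩ := hz
  replace hf : Polynomial.aeval (detq q n) f = (μ j : QMat q n) := hf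
  have hf0 : f = 0 := by
    ext m
    rw [← coef_aeval_detq hq hn, hf, hcoef, Polynomial.coeff_zero]
  rw [hf0, map_zero] at hf
  exact Subtype.ext hf.symm

end Basis

end QMatrix

end

/-! ### The main theorem. -/

open QMatrix in
theorem mainTheorem1 {K : Type*} [Field K] [CharZero K] (q : K) (hq0 : q ≠ 0)
    (hq : ∀ m : ℕ, 0 < m → q ^ m ≠ 1) (n : ℕ) (hn : 1 < n) :
    -- the centre is the polynomial ring generated by the quantum determinant
    (Subalgebra.center K (QMat q n) = Algebra.adjoin K {detq q n} ∧
      Transcendental K (detq q n)) ∧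
    -- unique decomposition of derivations
    (∀ δ : Der K (QMat q n),
      ∃! p : InnDer K (QMat q n) × (Fin (2 * n - 1) → Subalgebra.center K (QMat q n)),
        δ = (p.1 : Der K (QMat q n)) + ∑ j, p.2 j • D q n j) ∧
    -- the classes of the derivations form a basis of the first Hochschild cohomology
    (∃ b : Module.Basis (Fin (2 * n - 1)) (Subalgebra.center K (QMat q n)) (HH1 K (QMat q n)),
      ∀ j, b j = (InnDer K (QMat q n)).mkQ (D q n j)) := by
  have hn0 : 0 < n := by omega
  refine ⟨⟨center_eq_adjoin hq0 hq, transcendental_detq hq0 hn0⟩, fun δ => ?_, ?_⟩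
  · obtain ⟨E, hE, μ, rfl⟩ := exists_decomposition hq0 hq hn δ
    refine ⟨(⟨E, hE⟩, μ), rfl, ?_⟩
    rintro ⟨⟨F, hF⟩, ν⟩ h
    simp only at h
    have h1 : ∑ j, (ν j - μ j) • D q n j = E - F := by
      simp only [sub_smul, Finset.sum_sub_distrib]
      rw [sub_eq_sub_iff_add_eq_add, add_comm, ← h]
    have h2 : ν = μ := funext fun j => sub_eq_zero.1
      (eq_zero_of_sum_smul_D_mem_innDer hq0 hq hn0 (μ := fun j => ν j - μ j)
        (h1 ▸ sub_mem hE hF) j)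
    subst h2
    have h3 : F = E := (add_right_cancel h).symm
    subst h3
    rfl
  · have hli : LinearIndependent (Subalgebra.center K (QMat q n))
        fun j => (InnDer K (QMat q n)).mkQ (D q n j) := by
      rw [Fintype.linearIndependent_iff]
      intro μ h j
      refine eq_zero_of_sum_smul_D_mem_innDer hq0 hq hn0 (μ := μ) ?_ j
      simp only [← map_smul, ← map_sum] at h
      rwa [Submodule.mkQ_apply, Submodule.Quotient.mk_eq_zero] at h
    have hsp : ⊤ ≤ Submodule.span (Subalgebra.center K (QMat q n))
        (Set.range fun j => (InnDer K (QMat q n)).mkQ (D q n j)) := by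
      rintro x -
      obtain ⟨δ, rfl⟩ := Submodule.mkQ_surjective _ x
      obtain ⟨E, hE, μ, rfl⟩ := exists_decomposition hq0 hq hn δ
      have hE0 : (InnDer K (QMat q n)).mkQ E = 0 := by
        rwa [Submodule.mkQ_apply, Submodule.Quotient.mk_eq_zero]
      rw [map_add, hE0, zero_add, map_sum]
      refine Submodule.sum_mem _ fun j _ => ?_
      rw [map_smul]
      exact Submodule.smul_mem _ _ (Submodule.subset_span ⟨j, rfl⟩)
    exact ⟨Module.Basis.mk hli hsp, fun j => Module.Basis.mk_apply hli hsp j⟩
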